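/- **Model.** Let $\mathcal H$ be a separable real Hilbert space, $d\ge 0$, $V_i\in\mathbb R^{d}$, $x_i\in\mathbb R^{d_x}$, $Z_i=Z(x_i)\in\mathcal H$ with $Z$ measurable, and let $(x_i,V_i,u_i)_{i\ge1}$ be iid. For sample size $n$ put $Y_{2i}=\Pi_nZ_i+V_i$, $y_i=1\{Y_{2i}'\beta_0\ge u_i\}$, $\Pi_n=\Lambda_n\Pi_0/\sqrt n$, $\Lambda_n=\widetilde\Lambda\,\mathrm{diag}(\mu_{1n},\dots,\mu_{dn})$, with $\Pi_0:\mathcal H\to\mathbb R^{d}$ bounded linear. Write $f_i=\Pi_0Z_i$, $g_i=((\Pi_nZ_i)',V_i')'$, $\theta_0=(\beta_0',\beta_0'+\psi_0')'$, $\mathcal S_n=\mathrm{diag}(\Lambda_n/\sqrt n,I_d)$, $a\otimes b=\langle a,\cdot\rangle b$, $\mathcal K=\mathbb E[Z_i\otimes Z_i]$, $\mathcal K_n=n^{-1}\sum_{i\le n}Z_i\otimes Z_i$; $x=(x_i)_i$, $V=(V_i)_i$; $\Phi,\phi$ are the standard normal distribution function and density. **Conditions.** 1. $\widetilde\Lambda\widetilde\Lambda'$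 is positive definite; $\mu_{jn}>0$; for each $j$ either $\mu_{jn}=\sqrt n$ for all $n$ or $\mu_{jn}/\sqrt n\to0$; $\mu_{m,n}=\min_j\mu_{jn}\to\infty$. 2. For some $\rho\ge 3/2$, every $\pi_{\ell,0}=\Pi_0^*e_\ell$ is orthogonal to $\ker\mathcal K$ and satisfies $\sum_{j:\kappa_j>0}\langle\varphi_j,\pi_{\ell,0}\rangle^2/\kappa_j^{2\rho}<\infty$, where $(\kappa_j,\varphi_j)$ is the eigensystem of $\mathcal K$. 3. $\mathbb E[V_i|x_i]=0$, $u_i|(x_i,V_i)\sim N(-\psi_0'V_i,1)$; $\mathbb E\|Z_i\|^4<\infty$, $\mathbb E\|V_i\|^4<\infty$; $\mathbb E[V_iV_i'|x_i]$ is positive definite a.s.; $\mathbb E[\|V_i\|^2|x_i]$ and $\sup_i\|f_i\|$ are a.s. bounded by constants; $\mathbb E[f_if_i']$ is positive definite. 4. $\Theta\subset\mathbb R^{2d}$ is compact with $\theta_0$ in its interior, and for each $\theta\in\Theta$ there is $\varepsilon>0$ such that a.s., for all large $n$, $\varepsilon\le\Phi(g_i'\theta)\le1-\varepsilon$ for all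 $i\le n$. 5. $q(\cdot,\alpha)$ is measurable, $q(\kappa,\alpha)\in[0,1]$ for $\kappa\ge0$, $\alpha>0$, $\lim_{\alpha\to0}q(\kappa,\alpha)=1$ for $\kappa>0$, and, for a constant $C$, all $\alpha\in(0,1]$ and some $\tilde\rho\in[1,(2\rho+1)/4]$: $\alpha\kappa^{-1}q(\kappa,\alpha)\le C$ and $\alpha^{1/2}\kappa^{-1}q(\kappa,\alpha)\le C$ for $\kappa>0$, and $\kappa^{2\tilde\rho}(1-q(\kappa,\alpha))\le C\alpha^{\min\{\tilde\rho,1\}}$ for $\kappa\ge0$. 6. $\alpha=\alpha_n>0$, $\alpha\to0$ and $\mu_{m,n}^2\alpha\to\infty$. 7. Let $m(\theta,g_i)$ be either $y_i\log\Phi(g_i'\theta)+(1-y_i)\log(1-\Phi(g_i'\theta))$ (RCMLE) or $-\frac12(y_i-\Phi(g_i'\theta))^2$ (RNLSE), and correspondingly $\dot m_i=\bigl(\frac{(y_i-\Phi(z))\phi(z)}{\Phi(z)(1-\Phi(z))}\bigr)^2$ or $\dot m_i=\phi(z)^2$, with $z=g_i'\theta_0$. With $\check m_i=\mathbb E[\dot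 m_i|x,V]$, the quantities $\mathbb E[\check m_i^k|x]$, $\mathbb E[\check m_i^kV_i|x]$, $\mathbb E[\check m_i^kV_iV_i'|x]$, $k=1,2$, are a.s. the same for all $i\le n$ and bounded by a constant. **Linearized estimator.** Let $\mathcal K_{n\alpha}^{-1}=\sum_{j:\hat\kappa_j>0}\hat\kappa_j^{-1}q(\hat\kappa_j,\alpha)\hat\varphi_j\otimes\hat\varphi_j$, where $(\hat\kappa_j,\hat\varphi_j)$ is the eigensystem of $\mathcal K_n$, and $\widehat\Pi_\alpha=(n^{-1}\sum_{i\le n}Z_i\otimes Y_{2i})\mathcal K_{n\alpha}^{-1}$. With $\mathcal G_i(\Pi)=((\Pi Z_i)',(Y_{2i}-\Pi Z_i)')'$ let $s_i(\theta,\Pi)=\nabla_\theta\, m(\theta,\mathcal G_i(\Pi))$, where $y_i$ and $Y_{2i}$ are held fixed, and $\mathcal M=n^{-1}\sum_{i\le n}s_i(\theta_0,\Pi_n)$. A measurable $\overline\theta$ solves $$\mathcal M+\Gamma_1(\overline\theta-\theta_0)+\Gamma_2(\widehat\Pi_\alpha-\Pi_n)=0,$$ where $\Gamma_1,\Gamma_2$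 are the derivatives of the score in $\theta$ and in $\Pi$ at $(\theta_0,\Pi_n)$, in one of two versions: (P) population derivatives $\Gamma_1=\mathbb E[\partial_\theta s_i]$, $\Gamma_2=\mathbb E[\partial_\Pi s_i]$; (S) sample derivatives $\Gamma_{1n}=n^{-1}\sum_{i\le n}\partial_\theta s_i$, $\Gamma_{2n}=n^{-1}\sum_{i\le n}\partial_\Pi s_i$. **Conclusion.** (P) For every $n\ge1$, $\Gamma_1$ is invertible. For all large $n$, $\|\mathcal S_n'(\overline\theta-\theta_0)\|^2$ is integrable, and $$\mathbb E\bigl[\|\mathcal S_n'(\overline\theta-\theta_0)\|^2\,\big|\,x\bigr]=O_p(n^{-1}\alpha^{-1/2}+\alpha^2).$$ (S) Let $A_n(\tau)$ be the event that all singular values of $\mathcal S_n^{-1}\Gamma_{1n}\mathcal S_n'^{-1}$ are at least $\tau$. For some $\tau>0$, $\mathbb P(A_n(\tau))\to1$. For every $\tau>0$ and $n\ge1$ the equation has exactly one solution on $A_n(\tau)$; for any measurable $\overline\theta$ that equals it on $A_n(\tau)$, $1_{A_n(\tau)}\|\mathcal S_n'(\overline\theta-\theta_0)\|^2$ is integrable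 for all large $n$, and $$\mathbb E\bigl[1_{A_n(\tau)}\|\mathcal S_n'(\overline\theta-\theta_0)\|^2\,\big|\,x\bigr]=O_p(n^{-1}\alpha^{-1/2}+\alpha^2).$$ Moreover, for all $c_1,c_2>0$ and $n\ge1$ the function $\alpha\mapsto c_1n^{-1}\alpha^{-1/2}+c_2\alpha^2$ on $(0,\infty)$ has a unique minimizer $\alpha_n^*$, and $\alpha^*_n$ is exactly of order $n^{-2/5}$ as $n\to\infty$. -/

import Mathlib

open MeasureTheory ProbabilityTheory Filter Topology

noncomputable section

namespace BinaryIV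

/-- `ℝ^d` with the Euclidean norm. -/
abbrev Vec (d : ℕ) := EuclideanSpace ℝ (Fin d)

/-- `ℝ^{2d}` with the Euclidean norm, written as pairs of vectors of `ℝ^d`. -/
abbrev Vec2 (d : ℕ) := WithLp 2 (Vec d × Vec d)

/-- The pair `(a', b')'`. -/
def pair {d : ℕ} (a b : Vec d) : Vec2 d := WithLp.toLp 2 (a, b)

/-- A matrix acting on column vectors of `ℝ^d`. -/
def matMap {d : ℕ} (A : Matrix (Fin d) (Fin d) ℝ) : Vec d →L[ℝ] Vec d :=
  Matrix.toEuclideanCLM (n := Fin d) (𝕜 := ℝ) A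

/-! ### Stochastic order -/

/-- `X n = O_p(r n)` under `P`. -/
def IsBigOp {Ω : Type*} [MeasurableSpace Ω] (P : Measure Ω) (X : ℕ → Ω → ℝ) (r : ℕ → ℝ) : Prop :=
  ∀ ε : ℝ, 0 < ε → ∃ C : ℝ, ∀ᶠ n in atTop, P {ω | C * r n < |X n ω|} ≤ ENNReal.ofReal ε

/-! ### Criterion functions -/

/-- Standard normal distribution function. -/
def Phi (z : ℝ) : ℝ := cdf (gaussianReal 0 1) z

/-- Standard normal density. -/
def phi (z : ℝ) : ℝ := gaussianPDFReal 0 1 z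

/-- The two second-stage criteria: conditional maximum likelihood (M) and
nonlinear least squares (N). -/
inductive Criterion
  | ml
  | nls

/-- Criterion of one observation, as a function of the response `y` and the index `z = g'θ`. -/
def crit : Criterion → ℝ → ℝ → ℝ
  | Criterion.ml, y, z => y * Real.log (Phi z) + (1 - y) * Real.log (1 - Phi z)
  | Criterion.nls, y, z => -(1 / 2) * (y - Phi z) ^ 2

/-- The weight whose conditional moments are restricted: squared score factor for M, squared
density for N. -/
def mdot : Criterion → ℝ → ℝ → ℝ
  | Criterion.ml, y, z => ((y - Phi z) / (Phi z * (1 - Phi z)) * phi z) ^ 2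
  | Criterion.nls, _, z => phi z ^ 2

section Operators

variable {H : Type*} [NormedAddCommGroup H] [InnerProductSpace ℝ H]

/-- `a ⊗ b`, the operator `h ↦ ⟨a, h⟩ b`. -/
def tensor {F : Type*} [NormedAddCommGroup F] [InnerProductSpace ℝ F] (a : H) (b : F) :
    H →L[ℝ] F :=
  (innerSL ℝ a).smulRight b

/-- Orthogonal projection onto the eigenspace `{h | T h = κ h}`
(the zero operator if `κ` is not an eigenvalue). -/
def eigProj [CompleteSpace H] (T : H →L[ℝ] H) (κ : ℝ) : H →L[ℝ] H :=
  (T - κ • ContinuousLinearMap.id ℝ H).ker.starProjection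

/-- Regularized inverse `∑_j κ_j⁻¹ q(κ_j, α) φ_j ⊗ φ_j` of a nonnegative operator of finite rank.
Terms with the same eigenvalue are grouped into the projection on its eigenspace; the sum runs
over the nonzero eigenvalues, because `0⁻¹ = 0`. -/
def regInv [CompleteSpace H] (q : ℝ → ℝ → ℝ) (α : ℝ) (T : H →L[ℝ] H) : H →L[ℝ] H :=
  ∑ᶠ κ : ℝ, (κ⁻¹ * q κ α) • eigProj T κ

/-- The regressor `((Π z)', (Y - Π z)')'`. -/
def regressor {d : ℕ} (z : H) (Y : Vec d) (A : H →L[ℝ] Vec d) : Vec2 d :=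
  pair (A z) (Y - A z)

/-- Score of one observation: gradient in `θ` of the criterion. -/
def score {d : ℕ} (c : Criterion) (y : ℝ) (z : H) (Y : Vec d) (θ : Vec2 d)
    (A : H →L[ℝ] Vec d) : Vec2 d :=
  gradient (fun t : Vec2 d => crit c y (inner ℝ (regressor z Y A) t)) θ

/-- Derivative in `θ` of the score of one observation. -/
def scoreD1 {d : ℕ} (c : Criterion) (y : ℝ) (z : H) (Y : Vec d) (θ : Vec2 d)
    (A : H →L[ℝ] Vec d) : Vec2 d →L[ℝ] Vec2 d :=
  fderiv ℝ (fun t : Vec2 d => score c y z Y t A) θ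

/-- Fréchet derivative of the score of one observation in the first-stage operator. -/
def scoreD2 {d : ℕ} (c : Criterion) (y : ℝ) (z : H) (Y : Vec d) (θ : Vec2 d)
    (A : H →L[ℝ] Vec d) : (H →L[ℝ] Vec d) →L[ℝ] Vec2 d :=
  fderiv ℝ (fun B : H →L[ℝ] Vec d => score c y z Y θ B) A

end Operators

/-- Primitives of the model: the instrument map `Z`, the exogenous variables `x_i`, the
first-stage errors `V_i`, the structural errors `u_i` (observations are indexed from `0`),
the operator `Π₀`, the matrix `Λ̃`, the strengths `μ_{jn}`, and the coefficients `β₀`, `ψ₀`. -/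
structure Design (Ω : Type*) (H : Type*) [NormedAddCommGroup H] [InnerProductSpace ℝ H]
    (dx d : ℕ) where
  Z : (Fin dx → ℝ) → H
  x : ℕ → Ω → Fin dx → ℝ
  V : ℕ → Ω → Vec d
  u : ℕ → Ω → ℝ
  Pi0 : H →L[ℝ] Vec d
  Lam : Matrix (Fin d) (Fin d) ℝ
  mu : Fin d → ℕ → ℝ
  beta0 : Vec d
  psi0 : Vec d

namespace Design

variable {Ω : Type*} {H : Type*} [NormedAddCommGroup H] [InnerProductSpace ℝ H] {dx d : ℕ}

/-- `Z_i = Z(x_i)`. -/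
def Zi (S : Design Ω H dx d) (i : ℕ) (ω : Ω) : H := S.Z (S.x i ω)

/-- `f_i = Π₀ Z_i`. -/
def f (S : Design Ω H dx d) (i : ℕ) (ω : Ω) : Vec d := S.Pi0 (S.Zi i ω)

/-- `Λ_n = Λ̃ diag(μ_{1n}, …, μ_{dn})`. -/
def LamN (S : Design Ω H dx d) (n : ℕ) : Matrix (Fin d) (Fin d) ℝ :=
  S.Lam * Matrix.diagonal (fun j => S.mu j n)

/-- `Π_n = Λ_n Π₀ / √n`. -/
def PiN (S : Design Ω H dx d) (n : ℕ) : H →L[ℝ] Vec d :=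
  (Real.sqrt n)⁻¹ • (matMap (S.LamN n)).comp S.Pi0

/-- `Y_{2i} = Π_n Z_i + V_i`. -/
def Y2 (S : Design Ω H dx d) (n i : ℕ) (ω : Ω) : Vec d := S.PiN n (S.Zi i ω) + S.V i ω

open Classical in
/-- `y_i = 1{Y_{2i}'β₀ ≥ u_i}`. -/
def y (S : Design Ω H dx d) (n i : ℕ) (ω : Ω) : ℝ :=
  if S.u i ω ≤ inner ℝ (S.Y2 n i ω) S.beta0 then 1 else 0

/-- `θ₀ = (β₀', β₀' + ψ₀')'`. -/
def theta0 (S : Design Ω H dx d) : Vec2 d := pair S.beta0 (S.beta0 + S.psi0)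

/-- `g_i = ((Π_n Z_i)', V_i')'`. -/
def g (S : Design Ω H dx d) (n i : ℕ) (ω : Ω) : Vec2 d :=
  regressor (S.Zi i ω) (S.Y2 n i ω) (S.PiN n)

/-- `S_n' = diag(Λ_n' / √n, I)`. -/
def scaleT (S : Design Ω H dx d) (n : ℕ) (v : Vec2 d) : Vec2 d :=
  pair ((Real.sqrt n)⁻¹ • matMap (S.LamN n).transpose v.fst) v.snd

/-- `S_n⁻¹ = diag(√n Λ_n⁻¹, I)`. -/
def scaleInv (S : Design Ω H dx d) (n : ℕ) (v : Vec2 d) : Vec2 d :=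
  pair (Real.sqrt n • matMap (S.LamN n)⁻¹ v.fst) v.snd

/-- `σ(x_i, i ≥ 0)`. -/
abbrev sigmaX (S : Design Ω H dx d) : MeasurableSpace Ω :=
  ⨆ i, MeasurableSpace.comap (S.x i) inferInstance

/-- `σ((x_i, V_i), i ≥ 0)`. -/
abbrev sigmaXV (S : Design Ω H dx d) : MeasurableSpace Ω :=
  ⨆ i, MeasurableSpace.comap (fun ω => (S.x i ω, S.V i ω)) inferInstance

/-- Covariance operator `K = E[Z_i ⊗ Z_i]`. -/
def cov [MeasurableSpace Ω] (S : Design Ω H dx d) (P : Measure Ω) : H →L[ℝ] H :=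
  ∫ ω, tensor (S.Zi 0 ω) (S.Zi 0 ω) ∂P

/-- Sample covariance operator `K_n = n⁻¹ ∑ Z_i ⊗ Z_i`. -/
def covN (S : Design Ω H dx d) (n : ℕ) (ω : Ω) : H →L[ℝ] H :=
  (n : ℝ)⁻¹ • ∑ i ∈ Finset.range n, tensor (S.Zi i ω) (S.Zi i ω)

/-- First-stage estimator `Π̂_α = (n⁻¹ ∑ Z_i ⊗ Y_{2i}) K_{nα}⁻¹`. -/
def PiHat [CompleteSpace H] (S : Design Ω H dx d) (q : ℝ → ℝ → ℝ) (α : ℝ) (n : ℕ) (ω : Ω) :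
    H →L[ℝ] Vec d :=
  ((n : ℝ)⁻¹ • ∑ i ∈ Finset.range n, tensor (S.Zi i ω) (S.Y2 n i ω)).comp
    (regInv q α (S.covN n ω))

/-- Sample score at `(θ₀, Π_n)`. -/
def scoreN (S : Design Ω H dx d) (c : Criterion) (n : ℕ) (ω : Ω) : Vec2 d :=
  (n : ℝ)⁻¹ • ∑ i ∈ Finset.range n,
    score c (S.y n i ω) (S.Zi i ω) (S.Y2 n i ω) S.theta0 (S.PiN n)

/-- Derivative in `θ` of the sample score at `(θ₀, Π_n)`. -/
def Gamma1N (S : Design Ω H dx d) (c : Criterion) (n : ℕ) (ω : Ω) : Vec2 d →L[ℝ] Vec2 d :=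
  (n : ℝ)⁻¹ • ∑ i ∈ Finset.range n,
    scoreD1 c (S.y n i ω) (S.Zi i ω) (S.Y2 n i ω) S.theta0 (S.PiN n)

/-- Derivative in the first-stage operator of the sample score at `(θ₀, Π_n)`. -/
def Gamma2N (S : Design Ω H dx d) (c : Criterion) (n : ℕ) (ω : Ω) :
    (H →L[ℝ] Vec d) →L[ℝ] Vec2 d :=
  (n : ℝ)⁻¹ • ∑ i ∈ Finset.range n,
    scoreD2 c (S.y n i ω) (S.Zi i ω) (S.Y2 n i ω) S.theta0 (S.PiN n)

/-- Population counterpart of `Gamma1N`, for the law of the data at sample size `n`. -/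
def Gamma1 [MeasurableSpace Ω] (S : Design Ω H dx d) (P : Measure Ω) (c : Criterion) (n : ℕ)
    (v : Vec2 d) : Vec2 d :=
  ∫ ω, scoreD1 c (S.y n 0 ω) (S.Zi 0 ω) (S.Y2 n 0 ω) S.theta0 (S.PiN n) v ∂P

/-- Population counterpart of `Gamma2N`, for the law of the data at sample size `n`. -/
def Gamma2 [MeasurableSpace Ω] (S : Design Ω H dx d) (P : Measure Ω) (c : Criterion) (n : ℕ)
    (B : H →L[ℝ] Vec d) : Vec2 d :=
  ∫ ω, scoreD2 c (S.y n 0 ω) (S.Zi 0 ω) (S.Y2 n 0 ω) S.theta0 (S.PiN n) B ∂P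

/-- `t` solves the linearized second-stage equation with the sample derivatives. -/
def SolvesSample [CompleteSpace H] (S : Design Ω H dx d) (c : Criterion) (q : ℝ → ℝ → ℝ) (α : ℝ)
    (n : ℕ) (ω : Ω) (t : Vec2 d) : Prop :=
  S.scoreN c n ω + S.Gamma1N c n ω (t - S.theta0)
    + S.Gamma2N c n ω (S.PiHat q α n ω - S.PiN n) = 0

/-- `t` solves the linearized second-stage equation with the population derivatives. -/
def SolvesPopulation [MeasurableSpace Ω] [CompleteSpace H] (S : Design Ω H dx d) (P : Measure Ω)
    (c : Criterion) (q : ℝ → ℝ → ℝ) (α : ℝ) (n : ℕ) (ω : Ω) (t : Vec2 d) : Prop :=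
  S.scoreN c n ω + S.Gamma1 P c n (t - S.theta0)
    + S.Gamma2 P c n (S.PiHat q α n ω - S.PiN n) = 0

/-- The event that all singular values of `S_n⁻¹ Γ_{1n} S_n'⁻¹` are at least `τ`. -/
def wellCond (S : Design Ω H dx d) (c : Criterion) (n : ℕ) (τ : ℝ) : Set Ω :=
  {ω | ∀ v : Vec2 d, τ * ‖S.scaleT n v‖ ≤ ‖S.scaleInv n (S.Gamma1N c n ω v)‖}

/-- Squared scaled estimation error `‖S_n'(t - θ₀)‖²`. -/
def sqErr (S : Design Ω H dx d) (n : ℕ) (t : Vec2 d) : ℝ := ‖S.scaleT n (t - S.theta0)‖ ^ 2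

/-- `m̌_i = E[ṁ_i | x, V]` at sample size `n`. -/
def mcheck [mΩ : MeasurableSpace Ω] (S : Design Ω H dx d) (P : Measure Ω) (c : Criterion)
    (n i : ℕ) : Ω → ℝ :=
  P[fun ω => mdot c (S.y n i ω) (inner ℝ (S.g n i ω) S.theta0) | S.sigmaXV]

end Design

/-- Conditions on the regularization scheme `q`, given the smoothness index `ρ` of `Π₀`. -/
structure IsRegularization (q : ℝ → ℝ → ℝ) (ρ : ℝ) : Prop where
  measurable : ∀ α, Measurable fun κ => q κ α
  mem_unit : ∀ κ α, 0 ≤ κ → 0 < α → q κ α ∈ Set.Icc (0 : ℝ) 1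
  bound_inv : ∃ c : ℝ, ∀ κ α, 0 < κ → 0 < α → α ≤ 1 → α * κ⁻¹ * q κ α ≤ c
  bound_inv_sqrt : ∃ c : ℝ, ∀ κ α, 0 < κ → 0 < α → α ≤ 1 → Real.sqrt α * κ⁻¹ * q κ α ≤ c
  qualification : ∃ r c : ℝ, 1 ≤ r ∧ r ≤ (2 * ρ + 1) / 4 ∧
    ∀ κ α, 0 ≤ κ → 0 < α → α ≤ 1 → κ ^ (2 * r) * (1 - q κ α) ≤ c * α ^ min r 1
  tendsto_one : ∀ κ, 0 < κ → Tendsto (fun α => q κ α) (𝓝[>] 0) (𝓝 1)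

section Assumptions

variable {Ω : Type*} [MeasurableSpace Ω] {H : Type*} [NormedAddCommGroup H]
  [InnerProductSpace ℝ H] {dx d : ℕ}

/-- Conditions on the model: sampling, control function, instrument strength, source condition
and moments. -/
structure ModelConditions [CompleteSpace H] [MeasurableSpace H] (P : Measure Ω)
    [IsProbabilityMeasure P] (S : Design Ω H dx d) (Θ : Set (Vec2 d)) (ρ : ℝ) : Prop where
  -- random elements
  meas_Z : Measurable S.Z
  meas_x : ∀ i, Measurable (S.x i)
  meas_V : ∀ i, Measurable (S.V i)
  meas_u : ∀ i, Measurable (S.u i)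
  -- iid data
  indep : iIndepFun (fun i ω => (S.x i ω, S.V i ω, S.u i ω)) P
  ident : ∀ i, IdentDistrib (fun ω => (S.x i ω, S.V i ω, S.u i ω))
    (fun ω => (S.x 0 ω, S.V 0 ω, S.u 0 ω)) P P
  -- moments of the instrument and of the first-stage error
  moment_Z : ∀ i, MemLp (S.Zi i) 4 P
  moment_V : ∀ i, MemLp (S.V i) 4 P
  mean_V : ∀ i, P[S.V i | MeasurableSpace.comap (S.x i) inferInstance] =ᵐ[P] 0
  var_V : ∀ i, ∀ᵐ ω ∂P, (Matrix.of fun a b : Fin d =>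
    (P[fun ω' => S.V i ω' a * S.V i ω' b
      | MeasurableSpace.comap (S.x i) inferInstance]) ω).PosDef
  var_V_bdd : ∃ C : ℝ, ∀ i, ∀ᵐ ω ∂P,
    (P[fun ω' => ‖S.V i ω'‖ ^ 2 | MeasurableSpace.comap (S.x i) inferInstance]) ω ≤ C
  -- control function: `u_i | (x_i, V_i) ~ N(-ψ₀'V_i, 1)`
  law_u : ∀ i, ∀ᵐ w ∂(P.map fun ω => (S.x i ω, S.V i ω)),
    condDistrib (S.u i) (fun ω => (S.x i ω, S.V i ω)) P w
      = gaussianReal (-(inner ℝ S.psi0 w.2)) 1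
  -- instrument strength
  lam_posDef : (S.Lam * S.Lam.transpose).PosDef
  mu_pos : ∀ j n, 1 ≤ n → 0 < S.mu j n
  mu_rate : ∀ j, (∀ n, 1 ≤ n → S.mu j n = Real.sqrt n) ∨
    Tendsto (fun n => S.mu j n / Real.sqrt n) atTop (𝓝 0)
  mu_tendsto : ∀ j, Tendsto (S.mu j) atTop atTop
  f_nondeg : ∃ C : ℝ, 0 < C ∧ ∀ v : Vec d, C * ‖v‖ ^ 2 ≤ ∫ ω, (inner ℝ v (S.f 0 ω)) ^ 2 ∂P
  f_bdd : ∃ C : ℝ, ∀ᵐ ω ∂P, ∀ i, ‖S.f i ω‖ ≤ C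
  -- source condition `∑_j ⟨φ_j, π_{ℓ,0}⟩² / κ_j^{2ρ} < ∞` with `π_{ℓ,0} = Π₀* e_ℓ`; the first
  -- field is the part of it that concerns the eigenvalue zero
  source_index : 3 / 2 ≤ ρ
  source_ker : ∀ l : Fin d, eigProj (S.cov P) 0 (S.Pi0.adjoint (EuclideanSpace.single l 1)) = 0
  source_sum : ∀ l : Fin d, Summable fun κ : ℝ =>
    ‖eigProj (S.cov P) κ (S.Pi0.adjoint (EuclideanSpace.single l 1))‖ ^ 2 / κ ^ (2 * ρ)
  -- parameter space
  theta_compact : IsCompact Θ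
  theta_mem : S.theta0 ∈ interior Θ
  prob_bdd : ∀ θ ∈ Θ, ∃ ε : ℝ, 0 < ε ∧ ∀ᵐ ω ∂P, ∀ᶠ n : ℕ in atTop, ∀ i < n,
    Phi (inner ℝ (S.g n i ω) θ) ∈ Set.Icc ε (1 - ε)

/-- `E[m̌_i^k | x]`, `E[m̌_i^k V_i | x]` and `E[m̌_i^k V_i V_i' | x]`, `k = 1, 2`, do not depend on
`i` and are bounded. -/
structure WeightConditions (P : Measure Ω) (S : Design Ω H dx d) (c : Criterion) : Prop where
  const : ∀ k ∈ ({1, 2} : Set ℕ), ∀ n, ∀ i < n, ∀ j < n,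
    P[fun ω => S.mcheck P c n i ω ^ k | S.sigmaX]
      =ᵐ[P] P[fun ω => S.mcheck P c n j ω ^ k | S.sigmaX]
  const_V : ∀ k ∈ ({1, 2} : Set ℕ), ∀ n, ∀ i < n, ∀ j < n, ∀ a : Fin d,
    P[fun ω => S.mcheck P c n i ω ^ k * S.V i ω a | S.sigmaX]
      =ᵐ[P] P[fun ω => S.mcheck P c n j ω ^ k * S.V j ω a | S.sigmaX]
  const_VV : ∀ k ∈ ({1, 2} : Set ℕ), ∀ n, ∀ i < n, ∀ j < n, ∀ a b : Fin d,
    P[fun ω => S.mcheck P c n i ω ^ k * (S.V i ω a * S.V i ω b) | S.sigmaX]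
      =ᵐ[P] P[fun ω => S.mcheck P c n j ω ^ k * (S.V j ω a * S.V j ω b) | S.sigmaX]
  bdd : ∃ C : ℝ, ∀ k ∈ ({1, 2} : Set ℕ), ∀ n, ∀ i < n, ∀ᵐ ω ∂P, ∀ a b : Fin d,
    |(P[fun ω => S.mcheck P c n i ω ^ k | S.sigmaX]) ω| ≤ C ∧
    |(P[fun ω => S.mcheck P c n i ω ^ k * S.V i ω a | S.sigmaX]) ω| ≤ C ∧
    |(P[fun ω => S.mcheck P c n i ω ^ k * (S.V i ω a * S.V i ω b) | S.sigmaX]) ω| ≤ C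

end Assumptions

/-- The rate `n⁻¹ α^{-1/2} + α²`, with weights `c₁`, `c₂` on its two parts. -/
def mseRate (c₁ c₂ : ℝ) (n : ℕ) (α : ℝ) : ℝ :=
  c₁ * ((n : ℝ)⁻¹ * α ^ (-(1 / 2) : ℝ)) + c₂ * α ^ 2

end BinaryIV

end

open BinaryIV

set_option linter.unusedSectionVars false

namespace BinaryIV

-- After scaling, the linearized equation reads `(S_n⁻¹ Γ₁ S_n'⁻¹) S_n'(θ̄ - θ₀) = -S_n⁻¹ (M + Γ₂(Π̂
-- - Π_n))`. It therefore suffices to bound the matrix on the left from below and the right side in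
-- mean square.
--
-- Matrix. The scaled regressor `S_n⁻¹ g_i = F_i = (f_i, V_i)` does not depend on `n`. The
-- population matrix is `-E[w F F']`, with a weight `w > 0` that is bounded below because the index
-- `g_i'θ₀` stays in a compact interval (`exists_ae_norm_V_le`, `exists_uniformBound`). `E[F F']` is
-- positive definite because `E[V | x] = 0` makes it block diagonal
-- (`exists_le_integral_inner_F_sq`). The sample matrix is close to this one with high probability
-- (`tendsto_wellCond`).
--
-- Right side. Every score derivative splits into a part without residual and a part proportional to
-- the residual `ε_i = y_i - Φ(g_i'θ₀)`, which has mean zero given `(x, V)`. Since `Π̂` is a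
-- function of `(x, V)`, the residual parts are orthogonal across observations and contribute
-- `O(1/n)`, as long as their coefficients are bounded in `L²`. That holds because the inflation
-- `√(nα)` permitted for the inverse scaling, the size `α^{-1/2}` of the regularized inverse and the
-- size `n^{-1/2}` of the first-stage noise cancel (`exists_sqLe_coef`). What remains are finitely
-- many functionals `⟨ψ₀, (Π̂ - Π_n) v⟩`, with `v` an average of weighted instruments or its mean
-- (`sqLe_inner_err`).
--
-- Such a functional has a noise and a bias part. At a fixed `v`, the noise has conditional variance
-- of order `n⁻¹⟨Rv, K_n R v⟩ ≤ C n⁻¹ α^{-1/2}`, where `R` is the regularized inverse. Replacing the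
-- mean by the average costs a product of two `n^{-1/2}` fluctuations, controlled by fourth moments.
-- The bias is `⟨r(K_n)π, v⟩`, where `r = 1 - q` is the spectral residual and `π = Π₀* D_n* ψ₀`
-- satisfies the source condition. Cauchy-Schwarz over the sample bounds it by `‖K_n^{1/2} r(K_n)
-- π‖` when `v` is an average. The source condition for `K` is transferred to `K_n` one eigenspace
-- at a time, so that only the scalar Lipschitz bound for `κ ↦ κ^s` is needed (`norm_sqrt_resid_le`,
-- `integral_sq_sum_cov_sub_le`). The squared bias is `O(α² + 1/n)`.
--
-- These bounds hold on the `σ(x)`-measurable event that the trace of `K_n` is bounded, which has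
-- probability close to one. Markov's inequality for the conditional mean on this event gives the
-- order in probability (`isBigOp_condExp`).

local instance continuousSMul_vec2 (d : ℕ) : ContinuousSMul ℝ (Vec2 d) :=
  IsBoundedSMul.continuousSMul

/-! ### The standard normal distribution and the score factors -/

lemma Phi_eq_integral (z : ℝ) : Phi z = ∫ x in Set.Iic z, phi x := by
  unfold Phi phi
  rw [cdf_eq_real, measureReal_def, gaussianReal_apply_eq_integral _ one_ne_zero,
    ENNReal.toReal_ofReal]
  exact integral_nonneg fun x => gaussianPDFReal_nonneg _ _ _

lemma phi_pos (z : ℝ) : 0 < phi z := gaussianPDFReal_pos _ _ _ one_ne_zero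

lemma phi_eq (z : ℝ) : phi z = (Real.sqrt (2 * Real.pi))⁻¹ * Real.exp (-(z ^ 2) / 2) := by
  simp [phi, gaussianPDFReal]

lemma hasDerivAt_phi (z : ℝ) : HasDerivAt phi (-z * phi z) z := by
  have h : phi = fun z => (Real.sqrt (2 * Real.pi))⁻¹ * Real.exp (-(z ^ 2) / 2) := funext phi_eq
  rw [h]
  have h1 : HasDerivAt (fun z : ℝ => -(z ^ 2) / 2) (-z) z := by
    have := ((hasDerivAt_pow 2 z).neg).div_const 2
    refine this.congr_deriv ?_
    norm_num
    ring
  refine ((h1.exp).const_mul (Real.sqrt (2 * Real.pi))⁻¹).congr_deriv ?_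
  simp only
  ring

lemma continuous_phi : Continuous phi :=
  continuous_iff_continuousAt.2 fun z => (hasDerivAt_phi z).continuousAt

lemma integrable_phi : Integrable phi := integrable_gaussianPDFReal 0 1

lemma hasDerivAt_Phi (z : ℝ) : HasDerivAt Phi (phi z) z := by
  have h : Phi = fun z => Phi 0 + ∫ x in (0 : ℝ)..z, phi x := by
    funext z
    rw [Phi_eq_integral, Phi_eq_integral,
      ← intervalIntegral.integral_Iic_sub_Iic integrable_phi.integrableOn
        integrable_phi.integrableOn]
    ring
  rw [h]
  exact (intervalIntegral.integral_hasDerivAt_right (integrable_phi.intervalIntegrable)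
    continuous_phi.stronglyMeasurable.stronglyMeasurableAtFilter
    continuous_phi.continuousAt).const_add _

lemma continuous_Phi : Continuous Phi :=
  continuous_iff_continuousAt.2 fun z => (hasDerivAt_Phi z).continuousAt

lemma strictMono_Phi : StrictMono Phi :=
  strictMono_of_hasDerivAt_pos hasDerivAt_Phi phi_pos

lemma Phi_pos (z : ℝ) : 0 < Phi z :=
  (cdf_nonneg _ (z - 1)).trans_lt (strictMono_Phi (by linarith))

lemma Phi_lt_one (z : ℝ) : Phi z < 1 :=
  (strictMono_Phi (by linarith : z < z + 1)).trans_le (cdf_le_one _ _)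

lemma one_sub_Phi_pos (z : ℝ) : 0 < 1 - Phi z := sub_pos.2 (Phi_lt_one z)

/-- Values of `Phi` bounded away from zero and one confine the argument to a bounded set. -/
lemma exists_bound_of_Phi_mem {ε : ℝ} (hε : 0 < ε) :
    ∃ M : ℝ, ∀ z, Phi z ∈ Set.Icc ε (1 - ε) → |z| ≤ M := by
  have h0 : ∀ᶠ z in atBot, Phi z < ε :=
    (tendsto_cdf_atBot (gaussianReal 0 1)).eventually (gt_mem_nhds hε)
  have h1 : ∀ᶠ z in atTop, 1 - ε < Phi z :=
    (tendsto_cdf_atTop (gaussianReal 0 1)).eventually (lt_mem_nhds (by linarith))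
  obtain ⟨a, ha⟩ := h0.exists
  obtain ⟨b, hb⟩ := h1.exists
  refine ⟨max |a| |b|, fun z hz => ?_⟩
  have hza : a < z := strictMono_Phi.lt_iff_lt.1 (ha.trans_le hz.1)
  have hzb : z < b := strictMono_Phi.lt_iff_lt.1 (hz.2.trans_lt hb)
  rw [abs_le]
  constructor
  · have := neg_abs_le a
    have := le_max_left |a| |b|
    linarith
  · have := le_abs_self b
    have := le_max_right |a| |b|
    linarith

/-- The factor `h` in the derivative `(y - Phi z) h(z)` of the criterion. -/
noncomputable def hfac : Criterion → ℝ → ℝ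
  | Criterion.ml, z => phi z / (Phi z * (1 - Phi z))
  | Criterion.nls, z => phi z

/-- The derivative of `hfac`. -/
noncomputable def hfacD : Criterion → ℝ → ℝ
  | Criterion.ml, z => (-z * phi z * (Phi z * (1 - Phi z))
      - phi z * (phi z * (1 - Phi z) + Phi z * (-phi z))) / (Phi z * (1 - Phi z)) ^ 2
  | Criterion.nls, z => -z * phi z

/-- Minus the conditional mean of the second derivative of the criterion. -/
noncomputable def wgt (c : Criterion) (z : ℝ) : ℝ := phi z * hfac c z

lemma hasDerivAt_hfac (c : Criterion) (z : ℝ) : HasDerivAt (hfac c) (hfacD c z) z := by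
  cases c with
  | ml =>
    have h1 := (hasDerivAt_Phi z).mul ((hasDerivAt_Phi z).const_sub 1)
    exact (hasDerivAt_phi z).div h1 (mul_pos (Phi_pos z) (one_sub_Phi_pos z)).ne'
  | nls => exact hasDerivAt_phi z

lemma continuous_hfac (c : Criterion) : Continuous (hfac c) :=
  continuous_iff_continuousAt.2 fun z => (hasDerivAt_hfac c z).continuousAt

lemma continuous_hfacD (c : Criterion) : Continuous (hfacD c) := by
  cases c with
  | ml =>
    have h1 := continuous_Phi
    have h2 := continuous_phi
    refine Continuous.div (f := fun z => -z * phi z * (Phi z * (1 - Phi z))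
      - phi z * (phi z * (1 - Phi z) + Phi z * (-phi z)))
      (g := fun z => (Phi z * (1 - Phi z)) ^ 2) ?_ ?_ ?_
    · exact ((continuous_neg.mul h2).mul (h1.mul (continuous_const.sub h1))).sub
        (h2.mul ((h2.mul (continuous_const.sub h1)).add (h1.mul h2.neg)))
    · exact (h1.mul (continuous_const.sub h1)).pow 2
    · intro z
      exact pow_ne_zero _ (mul_pos (Phi_pos z) (one_sub_Phi_pos z)).ne'
  | nls =>
    exact continuous_neg.mul continuous_phi

lemma continuous_wgt (c : Criterion) : Continuous (wgt c) := continuous_phi.mul (continuous_hfac c)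

lemma hfac_pos (c : Criterion) (z : ℝ) : 0 < hfac c z := by
  cases c with
  | ml => exact div_pos (phi_pos z) (mul_pos (Phi_pos z) (one_sub_Phi_pos z))
  | nls => exact phi_pos z

lemma wgt_pos (c : Criterion) (z : ℝ) : 0 < wgt c z := mul_pos (phi_pos z) (hfac_pos c z)

/-- Both criteria have a derivative of the form residual times a factor depending on the index
alone. Writing it this way lets the rest of the proof treat them together. -/
lemma hasDerivAt_crit (c : Criterion) (y z : ℝ) :
    HasDerivAt (crit c y) ((y - Phi z) * hfac c z) z := by
  have h0 := (Phi_pos z).ne'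
  have h1 := (one_sub_Phi_pos z).ne'
  cases c with
  | ml =>
    have a1 := ((hasDerivAt_Phi z).log h0).const_mul y
    have a2 := (((hasDerivAt_Phi z).const_sub 1).log h1).const_mul (1 - y)
    refine (a1.add a2).congr_deriv ?_
    simp only [hfac]
    field_simp
    ring
  | nls =>
    have a1 := (((hasDerivAt_Phi z).const_sub y).pow 2).const_mul (-(1 / 2) : ℝ)
    refine a1.congr_deriv ?_
    simp only [hfac]
    push_cast
    ring

/-- The second derivative is grouped as a sure negative term plus a multiple of the residual,
because the residual term averages out given `(x, V)`. -/
lemma hasDerivAt_scoreFactor (c : Criterion) (y z : ℝ) :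
    HasDerivAt (fun z => (y - Phi z) * hfac c z)
      (-(wgt c z) + (y - Phi z) * hfacD c z) z := by
  refine (((hasDerivAt_Phi z).const_sub y).mul (hasDerivAt_hfac c z)).congr_deriv ?_
  simp only [wgt]
  ring

/-! ### Explicit scores -/

section Scores

variable {H : Type*} [NormedAddCommGroup H] [InnerProductSpace ℝ H] {d : ℕ}

@[simp] lemma pair_fst (a b : Vec d) : (pair a b).fst = a := rfl
@[simp] lemma pair_snd (a b : Vec d) : (pair a b).snd = b := rfl

lemma inner_pair (a b : Vec d) (v : Vec2 d) :
    inner ℝ (pair a b) v = inner ℝ a v.fst + inner ℝ b v.snd := by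
  rw [WithLp.prod_inner_apply]
  rfl

lemma norm_pair_sq (a b : Vec d) : ‖pair a b‖ ^ 2 = ‖a‖ ^ 2 + ‖b‖ ^ 2 := by
  rw [WithLp.prod_norm_sq_eq_of_L2]
  rfl

/-- `pair` as a continuous linear map. -/
noncomputable def pairL (d : ℕ) : Vec d × Vec d →L[ℝ] Vec2 d :=
  (WithLp.prodContinuousLinearEquiv 2 ℝ (Vec d) (Vec d)).symm.toContinuousLinearMap

lemma continuous_pair : Continuous fun p : Vec d × Vec d => pair p.1 p.2 := (pairL d).continuous

lemma score_eq (c : Criterion) (y : ℝ) (z : H) (Y : Vec d) (θ : Vec2 d) (A : H →L[ℝ] Vec d) :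
    score c y z Y θ A =
      ((y - Phi (inner ℝ (regressor z Y A) θ)) * hfac c (inner ℝ (regressor z Y A) θ)) •
        regressor z Y A := by
  unfold score
  refine HasGradientAt.gradient ?_
  rw [hasGradientAt_iff_hasFDerivAt]
  have h := (hasDerivAt_crit c y (inner ℝ (regressor z Y A) θ)).comp_hasFDerivAt θ
    (innerSL ℝ (regressor z Y A)).hasFDerivAt
  refine h.congr_fderiv ?_
  ext v
  simp

lemma hasFDerivAt_comp_smul {E G : Type*} [NormedAddCommGroup E] [NormedSpace ℝ E]
    [NormedAddCommGroup G] [NormedSpace ℝ G] {f : ℝ → ℝ} {f' : ℝ} {i : E → ℝ} {i' : E →L[ℝ] ℝ}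
    {r : E → G} {r' : E →L[ℝ] G} {x : E} (hf : HasDerivAt f f' (i x)) (hi : HasFDerivAt i i' x)
    (hr : HasFDerivAt r r' x) :
    HasFDerivAt (fun t => f (i t) • r t) (f (i x) • r' + (f' • i').smulRight (r x)) x :=
  (hf.comp_hasFDerivAt x hi).smul hr

lemma fderiv_inner_smul_apply {E : Type*} [NormedAddCommGroup E] [InnerProductSpace ℝ E]
    {f : ℝ → ℝ} {f' : ℝ} {r θ : E} (hf : HasDerivAt f f' (inner ℝ r θ)) (v : E) :
    fderiv ℝ (fun t => f (inner ℝ r t) • r) θ v = (f' * inner ℝ r v) • r := by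
  rw [(hasFDerivAt_comp_smul hf (innerSL ℝ r).hasFDerivAt (hasFDerivAt_const r θ)).fderiv]
  simp

lemma fderiv_inner_smul_apply' {E G : Type*} [NormedAddCommGroup E] [InnerProductSpace ℝ E]
    [NormedAddCommGroup G] [NormedSpace ℝ G] {f : ℝ → ℝ} {f' : ℝ} {r : G → E} {r' : G →L[ℝ] E}
    {θ : E} {x : G} (hf : HasDerivAt f f' (inner ℝ (r x) θ)) (hr : HasFDerivAt r r' x) (v : G) :
    fderiv ℝ (fun t => f (inner ℝ (r t) θ) • r t) x v =
      (f' * inner ℝ (r' v) θ) • r x + f (inner ℝ (r x) θ) • r' v := by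
  have hi : HasFDerivAt (fun t => inner ℝ (r t) θ) ((innerSL ℝ θ).comp r') x := by
    refine ((innerSL ℝ θ).hasFDerivAt.comp x hr).congr_of_eventuallyEq
      (Eventually.of_forall fun B => ?_)
    simp [real_inner_comm]
  rw [(hasFDerivAt_comp_smul (i := fun t => inner ℝ (r t) θ) hf hi hr).fderiv]
  simp [real_inner_comm, add_comm]

lemma scoreD1_apply (c : Criterion) (y : ℝ) (z : H) (Y : Vec d) (θ : Vec2 d)
    (A : H →L[ℝ] Vec d) (v : Vec2 d) :
    scoreD1 c y z Y θ A v =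
      ((-(wgt c (inner ℝ (regressor z Y A) θ)) + (y - Phi (inner ℝ (regressor z Y A) θ)) *
        hfacD c (inner ℝ (regressor z Y A) θ)) * inner ℝ (regressor z Y A) v) •
        regressor z Y A := by
  unfold scoreD1
  simp_rw [score_eq]
  exact fderiv_inner_smul_apply (hasDerivAt_scoreFactor c y (inner ℝ (regressor z Y A) θ)) v

/-- The derivative of the regressor in the first-stage operator. -/
noncomputable def regressorD (z : H) : (H →L[ℝ] Vec d) →L[ℝ] Vec2 d :=
  (pairL d).comp ((ContinuousLinearMap.apply ℝ (Vec d) z).prod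
    (-(ContinuousLinearMap.apply ℝ (Vec d) z)))

lemma regressorD_apply (z : H) (B : H →L[ℝ] Vec d) : regressorD z B = pair (B z) (-B z) := rfl

lemma hasFDerivAt_regressor (z : H) (Y : Vec d) (A : H →L[ℝ] Vec d) :
    HasFDerivAt (fun B : H →L[ℝ] Vec d => regressor z Y B) (regressorD z) A := by
  have h : (fun B : H →L[ℝ] Vec d => regressor z Y B) =
      fun B => pair 0 Y + regressorD z B := by
    funext B
    rw [regressorD_apply]
    simp only [regressor, pair]
    rw [← WithLp.toLp_add]
    simp [sub_eq_add_neg]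
  rw [h]
  exact (regressorD z).hasFDerivAt.const_add _

/-- Because `Y` is held fixed, a change `B` of the first stage moves the two blocks of the regressor
by opposite amounts. The index and the vector factor of the score both depend on the operator, hence
two terms. -/
lemma scoreD2_apply (c : Criterion) (y : ℝ) (z : H) (Y : Vec d) (θ : Vec2 d)
    (A B : H →L[ℝ] Vec d) :
    scoreD2 c y z Y θ A B =
      ((-(wgt c (inner ℝ (regressor z Y A) θ)) + (y - Phi (inner ℝ (regressor z Y A) θ)) *
        hfacD c (inner ℝ (regressor z Y A) θ)) * inner ℝ (pair (B z) (-B z)) θ) •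
        regressor z Y A +
      ((y - Phi (inner ℝ (regressor z Y A) θ)) * hfac c (inner ℝ (regressor z Y A) θ)) •
        pair (B z) (-B z) := by
  unfold scoreD2
  simp_rw [score_eq]
  exact fderiv_inner_smul_apply' (hasDerivAt_scoreFactor c y (inner ℝ (regressor z Y A) θ))
    (hasFDerivAt_regressor z Y A) B

end Scores

/-! ### Eigenprojections of symmetric operators -/

section Spectral

variable {H : Type*} [NormedAddCommGroup H] [InnerProductSpace ℝ H] [CompleteSpace H]
  {T : H →L[ℝ] H}

lemma ker_sub_eq_eigenspace (T : H →L[ℝ] H) (κ : ℝ) :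
    (T - κ • ContinuousLinearMap.id ℝ H).ker = Module.End.eigenspace (T : H →ₗ[ℝ] H) κ := by
  ext v
  simp [sub_eq_zero]

lemma eigProj_mem (T : H →L[ℝ] H) (κ : ℝ) (v : H) :
    eigProj T κ v ∈ Module.End.eigenspace (T : H →ₗ[ℝ] H) κ := by
  rw [← ker_sub_eq_eigenspace]
  exact Submodule.starProjection_apply_mem _ _

lemma apply_eigProj (T : H →L[ℝ] H) (κ : ℝ) (v : H) : T (eigProj T κ v) = κ • eigProj T κ v :=
  Module.End.mem_eigenspace_iff.1 (eigProj_mem T κ v)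

lemma eigProj_of_mem {κ : ℝ} {v : H} (h : T v = κ • v) : eigProj T κ v = v := by
  unfold eigProj
  rw [Submodule.starProjection_eq_self_iff]
  simp [h]

lemma inner_eigProj_left (T : H →L[ℝ] H) (κ : ℝ) (u v : H) :
    inner ℝ (eigProj T κ u) v = inner ℝ u (eigProj T κ v) :=
  Submodule.inner_starProjection_left_eq_right _ _ _

lemma eigProj_idem (T : H →L[ℝ] H) (κ : ℝ) (v : H) :
    eigProj T κ (eigProj T κ v) = eigProj T κ v := eigProj_of_mem (apply_eigProj T κ v)

lemma inner_eigProj_self (T : H →L[ℝ] H) (κ : ℝ) (v : H) :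
    inner ℝ v (eigProj T κ v) = ‖eigProj T κ v‖ ^ 2 := by
  rw [← eigProj_idem, ← inner_eigProj_left, real_inner_self_eq_norm_sq, eigProj_idem]

/-- Projection and operator commute: test against `w`, move the projection and then `T` to the other
side, where `T` acts as a scalar on the eigenspace. -/
lemma eigProj_apply (hT : (T : H →ₗ[ℝ] H).IsSymmetric) (κ : ℝ) (v : H) :
    eigProj T κ (T v) = κ • eigProj T κ v := by
  refine ext_inner_right ℝ fun w => ?_
  have h := hT v (eigProj T κ w)
  simp only [ContinuousLinearMap.coe_coe] at h
  rw [inner_eigProj_left, h, apply_eigProj, inner_smul_left, inner_smul_right, inner_eigProj_left]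
  simp

lemma eigProj_eigProj_of_ne (hT : (T : H →ₗ[ℝ] H).IsSymmetric) {κ κ' : ℝ} (h : κ ≠ κ') (v : H) :
    eigProj T κ (eigProj T κ' v) = 0 := by
  have h1 := eigProj_apply hT κ (eigProj T κ' v)
  rw [apply_eigProj, map_smul] at h1
  have h2 : (κ' - κ) • eigProj T κ (eigProj T κ' v) = 0 := by rw [sub_smul, h1, sub_self]
  exact (smul_eq_zero.1 h2).resolve_left (sub_ne_zero.2 h.symm)

lemma norm_sum_smul_eigProj_sq (hT : (T : H →ₗ[ℝ] H).IsSymmetric) (s : Finset ℝ) (h : ℝ → ℝ)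
    (v : H) :
    ‖∑ κ ∈ s, h κ • eigProj T κ v‖ ^ 2 = ∑ κ ∈ s, h κ ^ 2 * ‖eigProj T κ v‖ ^ 2 := by
  have := hT.orthogonalFamily_eigenspaces.norm_sum
    (fun κ => ⟨h κ • eigProj T κ v, Submodule.smul_mem _ _ (eigProj_mem T κ v)⟩) s
  change ‖∑ κ ∈ s, h κ • eigProj T κ v‖ ^ 2 = ∑ κ ∈ s, ‖h κ • eigProj T κ v‖ ^ 2 at this
  simp only [this, norm_smul, mul_pow, Real.norm_eq_abs, sq_abs]

/-- Bessel's inequality. The pairing of `v` with the sum of its components equals the squared norm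
of that sum, so Cauchy-Schwarz and one cancellation suffice. -/
lemma sum_norm_eigProj_sq_le (hT : (T : H →ₗ[ℝ] H).IsSymmetric) (s : Finset ℝ) (v : H) :
    ∑ κ ∈ s, ‖eigProj T κ v‖ ^ 2 ≤ ‖v‖ ^ 2 := by
  have h1 : ‖∑ κ ∈ s, eigProj T κ v‖ ^ 2 = ∑ κ ∈ s, ‖eigProj T κ v‖ ^ 2 := by
    simpa using norm_sum_smul_eigProj_sq hT s (fun _ => 1) v
  have h2 : inner ℝ v (∑ κ ∈ s, eigProj T κ v) = ∑ κ ∈ s, ‖eigProj T κ v‖ ^ 2 := by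
    rw [inner_sum]
    exact Finset.sum_congr rfl fun κ _ => inner_eigProj_self T κ v
  have h3 := real_inner_le_norm v (∑ κ ∈ s, eigProj T κ v)
  rw [h2, ← h1] at h3
  rw [← h1]
  have h4 := norm_nonneg (∑ κ ∈ s, eigProj T κ v)
  have h5 := norm_nonneg v
  by_cases h : ‖∑ κ ∈ s, eigProj T κ v‖ = 0
  · rw [h, zero_pow two_ne_zero]; positivity
  · have : ‖∑ κ ∈ s, eigProj T κ v‖ ≤ ‖v‖ := by
      have h6 : 0 < ‖∑ κ ∈ s, eigProj T κ v‖ := lt_of_le_of_ne h4 (Ne.symm h)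
      rw [sq] at h3
      exact le_of_mul_le_mul_right h3 h6
    gcongr

/-- A vector annihilated by all eigenprojections of a compact symmetric operator vanishes. -/
lemma eq_zero_of_forall_eigProj_eq_zero (hT : (T : H →ₗ[ℝ] H).IsSymmetric)
    (hc : IsCompactOperator T) {u : H} (hu : ∀ κ, eigProj T κ u = 0) : u = 0 := by
  have h := ContinuousLinearMap.orthogonalComplement_iSup_eigenspaces_eq_bot hc hT
  have : u ∈ (⨆ μ, Module.End.eigenspace (T : Module.End ℝ H) μ)ᗮ := by
    rw [← Submodule.iInf_orthogonal, Submodule.mem_iInf]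
    intro κ
    have h1 := hu κ
    unfold eigProj at h1
    rw [Submodule.starProjection_apply_eq_zero_iff, ker_sub_eq_eigenspace] at h1
    exact h1
  rw [h] at this
  simpa using this

/-- Bessel makes the orthogonal components summable. The difference between `v` and their sum is
annihilated by every eigenprojection, so compactness forces it to vanish. -/
lemma hasSum_eigProj (hT : (T : H →ₗ[ℝ] H).IsSymmetric) (hc : IsCompactOperator T) (v : H) :
    HasSum (fun κ => eigProj T κ v) v := by
  have hs : Summable fun κ => ‖eigProj T κ v‖ ^ 2 :=
    summable_of_sum_le (fun κ => by positivity) (fun s => sum_norm_eigProj_sq_le hT s v)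
  have hs2 : Summable fun κ => eigProj T κ v := by
    have := (hT.orthogonalFamily_eigenspaces.summable_iff_norm_sq_summable
      (fun κ => ⟨eigProj T κ v, eigProj_mem T κ v⟩)).2 hs
    simpa using this
  have h0 : v - ∑' κ, eigProj T κ v = 0 := by
    refine eq_zero_of_forall_eigProj_eq_zero hT hc fun κ => ?_
    rw [map_sub, (eigProj T κ).map_tsum hs2, tsum_eq_single κ
      (fun κ' h => eigProj_eigProj_of_ne hT h.symm v), eigProj_idem, sub_self]
  have := hs2.hasSum
  rwa [← sub_eq_zero.1 h0] at this

/-- `T` is symmetric and its eigenprojections for the finite set `s` sum to the identity. -/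
structure IsFiniteSpec (T : H →L[ℝ] H) (s : Finset ℝ) : Prop where
  symm : (T : H →ₗ[ℝ] H).IsSymmetric
  zero : ∀ κ, κ ∉ s → eigProj T κ = 0
  sum : ∀ v, ∑ κ ∈ s, eigProj T κ v = v

/-- An eigenvector for a nonzero eigenvalue lies in the range, hence in `W`, so the nonzero spectrum
is that of an endomorphism of a finite-dimensional space. The value `0` is added by hand. -/
lemma exists_isFiniteSpec (hT : (T : H →ₗ[ℝ] H).IsSymmetric) (W : Submodule ℝ H)
    [FiniteDimensional ℝ W] (hW : ∀ v, T v ∈ W) : ∃ s, IsFiniteSpec T s := by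
  have hc : IsCompactOperator T := by
    have : ProperSpace W := FiniteDimensional.proper ℝ W
    exact (isCompactOperator_of_locallyCompactSpace_rng W.subtypeL).comp_clm (T.codRestrict W hW)
  let T' : Module.End ℝ W := ((T : H →ₗ[ℝ] H).restrict (p := W) (q := W) fun v _ => hW v)
  have hfin : {κ : ℝ | eigProj T κ ≠ 0}.Finite := by
    refine ((T'.finite_hasEigenvalue).insert 0).subset fun κ hκ => ?_
    by_cases h0 : κ = 0
    · exact Or.inl h0
    right
    obtain ⟨v, hv⟩ := DFunLike.ne_iff.1 hκ
    set e := eigProj T κ v with he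
    have h1 : T e = κ • e := apply_eigProj T κ v
    have h2 : e ∈ W := by
      have : e = κ⁻¹ • T e := by rw [h1, smul_smul, inv_mul_cancel₀ h0, one_smul]
      rw [this]
      exact W.smul_mem _ (hW e)
    refine Module.End.hasEigenvalue_of_hasEigenvector (x := ⟨e, h2⟩) ⟨?_, ?_⟩
    · rw [Module.End.mem_eigenspace_iff]
      exact Subtype.ext h1
    · intro h
      exact hv (congrArg Subtype.val h)
  refine ⟨hfin.toFinset, hT, fun κ h => ?_, fun v => ?_⟩
  · by_contra h'
    exact h (by simpa using h')
  · refine (hasSum_sum_of_ne_finset_zero fun κ h => ?_).unique (hasSum_eigProj hT hc v)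
    have : eigProj T κ = 0 := by
      by_contra h'
      exact h (by simpa using h')
    simp [this]

/-- Functional calculus `∑_κ h(κ) P_κ` of an operator of finite rank. -/
noncomputable def fc (h : ℝ → ℝ) (T : H →L[ℝ] H) : H →L[ℝ] H := ∑ᶠ κ : ℝ, h κ • eigProj T κ

lemma regInv_eq_fc (q : ℝ → ℝ → ℝ) (α : ℝ) (T : H →L[ℝ] H) :
    regInv q α T = fc (fun κ => κ⁻¹ * q κ α) T := rfl

namespace IsFiniteSpec

variable {s : Finset ℝ} (hs : IsFiniteSpec T s)
include hs

lemma fc_apply (h : ℝ → ℝ) (v : H) : fc h T v = ∑ κ ∈ s, h κ • eigProj T κ v := by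
  unfold fc
  rw [finsum_eq_sum_of_support_subset (s := s)]
  · simp
  · intro κ hκ
    by_contra h'
    exact hκ (by simp [hs.zero κ h'])

lemma eigProj_fc (h : ℝ → ℝ) (κ : ℝ) (v : H) : eigProj T κ (fc h T v) = h κ • eigProj T κ v := by
  rw [hs.fc_apply, map_sum]
  by_cases hκ : κ ∈ s
  · rw [Finset.sum_eq_single κ]
    · rw [map_smul, eigProj_idem]
    · intro κ' _ hne
      rw [map_smul, eigProj_eigProj_of_ne hs.symm hne.symm, smul_zero]
    · exact fun h => absurd hκ h
  · simp [hs.zero κ hκ]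

lemma fc_fc (h g : ℝ → ℝ) (v : H) : fc h T (fc g T v) = fc (fun κ => h κ * g κ) T v := by
  rw [hs.fc_apply h, hs.fc_apply fun κ => h κ * g κ]
  exact Finset.sum_congr rfl fun κ _ => by rw [hs.eigProj_fc, smul_smul]

lemma fc_const (a : ℝ) (v : H) : fc (fun _ => a) T v = a • v := by
  rw [hs.fc_apply, ← Finset.smul_sum, hs.sum]

lemma fc_id (v : H) : fc (fun κ => κ) T v = T v := by
  rw [hs.fc_apply]
  conv_rhs => rw [← hs.sum v, map_sum]
  exact Finset.sum_congr rfl fun κ _ => (apply_eigProj T κ v).symm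

lemma fc_add (h g : ℝ → ℝ) (v : H) : fc (fun κ => h κ + g κ) T v = fc h T v + fc g T v := by
  simp only [hs.fc_apply, add_smul, Finset.sum_add_distrib]

lemma fc_sub (h g : ℝ → ℝ) (v : H) : fc (fun κ => h κ - g κ) T v = fc h T v - fc g T v := by
  simp only [hs.fc_apply, sub_smul, Finset.sum_sub_distrib]

lemma inner_fc (h : ℝ → ℝ) (u v : H) : inner ℝ (fc h T u) v = inner ℝ u (fc h T v) := by
  simp only [hs.fc_apply, sum_inner, inner_sum, inner_smul_left, inner_smul_right,
    inner_eigProj_left]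
  simp

lemma norm_fc_sq (h : ℝ → ℝ) (v : H) :
    ‖fc h T v‖ ^ 2 = ∑ κ ∈ s, h κ ^ 2 * ‖eigProj T κ v‖ ^ 2 := by
  rw [hs.fc_apply, norm_sum_smul_eigProj_sq hs.symm]

/-- The norm is a sum over orthogonal components, and a value `κ` with a nonzero component is an
eigenvalue in `[0, ‖T‖]`. The two functions need to be compared only there. -/
lemma norm_fc_le_norm_fc (hpos : ∀ v, 0 ≤ inner ℝ (T v) v) {h g : ℝ → ℝ}
    (hg : ∀ κ, 0 ≤ κ → κ ≤ ‖T‖ → |h κ| ≤ |g κ|) (v : H) : ‖fc h T v‖ ≤ ‖fc g T v‖ := by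
  refine (sq_le_sq₀ (norm_nonneg _) (norm_nonneg _)).1 ?_
  rw [hs.norm_fc_sq, hs.norm_fc_sq]
  refine Finset.sum_le_sum fun κ _ => ?_
  by_cases h0 : eigProj T κ v = 0
  · simp [h0]
  have hn : 0 < ‖eigProj T κ v‖ := norm_pos_iff.2 h0
  have h1 := hpos (eigProj T κ v)
  rw [apply_eigProj, inner_smul_left, real_inner_self_eq_norm_sq] at h1
  have h2 : 0 ≤ κ := by
    simp only [conj_trivial] at h1
    exact nonneg_of_mul_nonneg_left h1 (by positivity)
  have h3 : κ ≤ ‖T‖ := by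
    have := T.le_opNorm (eigProj T κ v)
    rw [apply_eigProj, norm_smul, Real.norm_eq_abs, abs_of_nonneg h2] at this
    exact le_of_mul_le_mul_right this hn
  have := sq_le_sq.2 (hg κ h2 h3)
  gcongr

lemma norm_fc_le (hpos : ∀ v, 0 ≤ inner ℝ (T v) v) {h : ℝ → ℝ} {C : ℝ}
    (hC : ∀ κ, 0 ≤ κ → κ ≤ ‖T‖ → |h κ| ≤ C) (hC0 : 0 ≤ C) (v : H) : ‖fc h T v‖ ≤ C * ‖v‖ := by
  have := hs.norm_fc_le_norm_fc hpos (h := h) (g := fun _ => C)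
    (fun κ h1 h2 => (hC κ h1 h2).trans (le_abs_self C)) v
  rwa [hs.fc_const, norm_smul, Real.norm_eq_abs, abs_of_nonneg hC0] at this

/-- `⟨u, T u⟩ = ‖T^{1/2} u‖²` for `u = h(T) v`. -/
lemma inner_fc_apply_fc (hpos : ∀ v, 0 ≤ inner ℝ (T v) v) (h : ℝ → ℝ) (v : H) :
    inner ℝ (fc h T v) (T (fc h T v)) = ‖fc (fun κ => Real.sqrt κ * h κ) T v‖ ^ 2 := by
  rw [← hs.fc_id, hs.fc_fc, hs.inner_fc, hs.fc_fc, hs.fc_apply, hs.norm_fc_sq, inner_sum]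
  refine Finset.sum_congr rfl fun κ _ => ?_
  rw [inner_smul_right, inner_eigProj_self]
  by_cases h0 : eigProj T κ v = 0
  · simp [h0]
  have hn : 0 < ‖eigProj T κ v‖ := norm_pos_iff.2 h0
  have h1 := hpos (eigProj T κ v)
  rw [apply_eigProj, inner_smul_left, real_inner_self_eq_norm_sq] at h1
  have h2 : 0 ≤ κ := by
    simp only [conj_trivial] at h1
    exact nonneg_of_mul_nonneg_left h1 (by positivity)
  rw [mul_pow, Real.sq_sqrt h2]
  ring

/-- `‖(f(k) - f(T)) e‖ ≤ L ‖(k - T) e‖` if `f` is `L`-Lipschitz at `k` on the spectrum. -/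
lemma norm_smul_sub_fc_le (hpos : ∀ v, 0 ≤ inner ℝ (T v) v) {f : ℝ → ℝ} {k L : ℝ} (hL : 0 ≤ L)
    (hf : ∀ κ, 0 ≤ κ → κ ≤ ‖T‖ → |f k - f κ| ≤ L * |k - κ|) (e : H) :
    ‖f k • e - fc f T e‖ ≤ L * ‖k • e - T e‖ := by
  -- The scalar `k` enters as a constant function in the calculus of the single operator `T`. No
  -- commutation with a second operator is involved, and a scalar Lipschitz bound is enough.
  have h1 := hs.norm_fc_le_norm_fc hpos (h := fun κ => f k - f κ) (g := fun κ => L * (k - κ))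
    (fun κ h1 h2 => by simpa [abs_mul, abs_of_nonneg hL] using hf κ h1 h2) e
  rw [hs.fc_sub (fun _ => f k) f, hs.fc_const] at h1
  have h2 : fc (fun κ => L * (k - κ)) T e = L • (k • e - T e) := by
    rw [← hs.fc_const L, ← hs.fc_const k, ← hs.fc_id, ← hs.fc_sub, hs.fc_fc]
  rwa [h2, norm_smul, Real.norm_eq_abs, abs_of_nonneg hL] at h1

end IsFiniteSpec

/-! ### Measurability of the functional calculus of a random operator -/

section Measurability

variable [SecondCountableTopology H] [MeasurableSpace H] [BorelSpace H]
  {Ω : Type*} [MeasurableSpace Ω] {T : Ω → H →L[ℝ] H}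

/-- For each `ω` the calculus is a finite sum, so pointwise convergence of the functions suffices
although the spectrum moves with `ω`. -/
lemma measurable_fc_of_tendsto (hs : ∀ ω, ∃ s, IsFiniteSpec (T ω) s) {h : ℝ → ℝ} {g : ℕ → ℝ → ℝ}
    (hg : ∀ k b, Measurable b → Measurable fun ω => fc (g k) (T ω) (b ω))
    (hl : ∀ κ, Tendsto (fun k => g k κ) atTop (𝓝 (h κ))) (b : Ω → H) (hb : Measurable b) :
    Measurable fun ω => fc h (T ω) (b ω) := by
  refine measurable_of_tendsto_metrizable (fun k => hg k b hb) ?_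
  rw [tendsto_pi_nhds]
  intro ω
  obtain ⟨s, h⟩ := hs ω
  simp only [h.fc_apply]
  exact tendsto_finsetSum _ fun κ _ => (hl κ).smul_const _

/-- The eigenprojections are never shown to be measurable themselves. Measurability is built up in
the function `h`: polynomials need only repeated application of `T`, continuous functions are limits
of polynomials, indicators of half-lines are limits of continuous functions, then come Borel sets,
simple functions and measurable functions. -/
lemma measurable_fc (hs : ∀ ω, ∃ s, IsFiniteSpec (T ω) s)
    (hT : ∀ b : Ω → H, Measurable b → Measurable fun ω => T ω (b ω)) {h : ℝ → ℝ}
    (hh : Measurable h) (b : Ω → H) (hb : Measurable b) :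
    Measurable fun ω => fc h (T ω) (b ω) := by
  have hadd : ∀ f g : ℝ → ℝ, (∀ b, Measurable b → Measurable fun ω => fc f (T ω) (b ω)) →
      (∀ b, Measurable b → Measurable fun ω => fc g (T ω) (b ω)) →
      ∀ b, Measurable b → Measurable fun ω => fc (fun κ => f κ + g κ) (T ω) (b ω) := by
    intro f g hf hg b hb
    convert (hf b hb).add (hg b hb) using 2 with ω
    obtain ⟨s, h⟩ := hs ω
    simp [h.fc_add]
  have hconst : ∀ a : ℝ, ∀ b, Measurable b → Measurable fun ω => fc (fun _ => a) (T ω) (b ω) := by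
    intro a b hb
    convert hb.const_smul a using 2 with ω
    obtain ⟨s, h⟩ := hs ω
    simp [h.fc_const]
  have hsmul : ∀ (a : ℝ) (f : ℝ → ℝ), (∀ b, Measurable b → Measurable fun ω => fc f (T ω) (b ω)) →
      ∀ b, Measurable b → Measurable fun ω => fc (fun κ => a * f κ) (T ω) (b ω) := by
    intro a f hf b hb
    convert (hf b hb).const_smul a using 2 with ω
    obtain ⟨s, h⟩ := hs ω
    simp [← h.fc_const, h.fc_fc]
  have hpoly : ∀ p : Polynomial ℝ, ∀ b, Measurable b →
      Measurable fun ω => fc (fun κ => p.eval κ) (T ω) (b ω) := by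
    intro p
    induction p using Polynomial.induction_on with
    | C a => simpa using hconst a
    | add p q hp hq => simpa using hadd _ _ hp hq
    | monomial n a ih =>
      intro b hb
      -- One more power of `κ` amounts to feeding `T b` in place of `b`, which is why the induction
      -- hypothesis is kept for all measurable `b`.
      convert ih _ (hT b hb) using 2 with ω
      obtain ⟨s, h⟩ := hs ω
      rw [← h.fc_id, h.fc_fc]
      congr 2
      funext κ
      simp [pow_succ, mul_assoc]
  have hcont : ∀ f : ℝ → ℝ, Continuous f → ∀ b, Measurable b →
      Measurable fun ω => fc f (T ω) (b ω) := by
    intro f hf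
    -- The `k`-th polynomial is accurate on `[-k, k]` up to `1/(k+1)`, so every fixed `κ` is
    -- eventually covered.
    choose p hp using fun k : ℕ => exists_polynomial_near_of_continuousOn (-(k : ℝ)) k f
      hf.continuousOn (1 / ((k : ℝ) + 1)) (by positivity)
    refine measurable_fc_of_tendsto hs (fun k => hpoly (p k)) fun κ => ?_
    rw [tendsto_iff_dist_tendsto_zero]
    refine squeeze_zero' (Eventually.of_forall fun _ => dist_nonneg) ?_
      tendsto_one_div_add_atTop_nhds_zero_nat
    filter_upwards [eventually_ge_atTop ⌈|κ|⌉₊] with k hk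
    have : |κ| ≤ k := (Nat.le_ceil _).trans (by exact_mod_cast hk)
    exact (hp k κ (abs_le.1 this)).le
  have hind : ∀ A : Set ℝ, MeasurableSet A → ∀ b, Measurable b →
      Measurable fun ω => fc (A.indicator fun _ => 1) (T ω) (b ω) := by
    intro A hA
    induction A, hA using MeasurableSpace.induction_on_inter
      (BorelSpace.measurable_eq.trans (borel_eq_generateFrom_Iic ℝ)) isPiSystem_Iic with
    | empty => simpa using hconst 0
    | basic A hA =>
      obtain ⟨a, rfl⟩ := hA
      -- A continuous ramp that equals one up to `a` and falls to zero over a length `1/k`.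
      refine measurable_fc_of_tendsto hs (g := fun k x => max 0 (1 - k * max 0 (x - a)))
        (fun k => hcont _ (by fun_prop)) fun κ => ?_
      by_cases hκ : κ ≤ a
      · have h1 : ∀ k : ℕ, max 0 (1 - (k : ℝ) * max 0 (κ - a)) = 1 := fun k => by
          rw [max_eq_left (by linarith : κ - a ≤ 0)]
          simp
        simp [hκ]
      · rw [Set.indicator_of_notMem (by simpa using hκ)]
        refine tendsto_const_nhds.congr' ?_
        obtain ⟨m, hm⟩ := exists_nat_gt (κ - a)⁻¹
        filter_upwards [eventually_ge_atTop m] with k hk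
        have h1 : 0 < κ - a := by linarith
        have h2 : (κ - a)⁻¹ ≤ k := hm.le.trans (by exact_mod_cast hk)
        have h3 : 1 ≤ k * (κ - a) := by
          have := mul_le_mul_of_nonneg_right h2 h1.le
          rwa [inv_mul_cancel₀ h1.ne'] at this
        rw [max_eq_right h1.le, max_eq_left (by linarith)]
    | compl A hA ih =>
      have h1 : (Aᶜ.indicator fun _ => (1 : ℝ)) =
          fun κ => 1 + (-1) * A.indicator (fun _ => (1 : ℝ)) κ := by
        funext κ
        by_cases hκ : κ ∈ A <;> simp [hκ]
      rw [h1]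
      exact hadd _ _ (hconst 1) (hsmul (-1) _ ih)
    | iUnion f hd hm ih =>
      have hk : ∀ k : ℕ, ∀ b, Measurable b → Measurable fun ω =>
          fc (fun κ => ∑ i ∈ Finset.range k, (f i).indicator (fun _ => (1 : ℝ)) κ) (T ω) (b ω) := by
        intro k
        induction k with
        | zero => simpa using hconst 0
        | succ k ihk =>
          simp only [Finset.sum_range_succ]
          exact hadd _ _ ihk (ih k)
      refine measurable_fc_of_tendsto hs hk fun κ => ?_
      by_cases hκ : κ ∈ ⋃ i, f i
      · obtain ⟨i, hi⟩ := Set.mem_iUnion.1 hκ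
        have h1 : ∀ j, j ≠ i → (f j).indicator (fun _ => (1 : ℝ)) κ = 0 := fun j hj =>
          Set.indicator_of_notMem (fun h => (hd hj).le_bot ⟨h, hi⟩) _
        have h2 := (hasSum_single i h1).tendsto_sum_nat
        rw [Set.indicator_of_mem hi] at h2
        rwa [Set.indicator_of_mem hκ]
      · have h1 : ∀ j, (f j).indicator (fun _ => (1 : ℝ)) κ = 0 := fun j =>
          Set.indicator_of_notMem (fun h => hκ (Set.mem_iUnion.2 ⟨j, h⟩)) _
        simp [h1, Set.indicator_of_notMem hκ]
  have hsimple : ∀ f : SimpleFunc ℝ ℝ, ∀ b, Measurable b →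
      Measurable fun ω => fc f (T ω) (b ω) := by
    intro f
    induction f using SimpleFunc.induction with
    | @const c A hA =>
      have h1 : ⇑((SimpleFunc.const ℝ c).piecewise A hA (SimpleFunc.const ℝ 0)) =
          fun κ => c * A.indicator (fun _ => (1 : ℝ)) κ := by
        funext κ
        by_cases hκ : κ ∈ A <;> simp [hκ]
      rw [h1]
      exact hsmul c _ (hind _ hA)
    | @add f g _ hf hg => exact hadd _ _ hf hg
  exact measurable_fc_of_tendsto hs (fun k => hsimple (hh.stronglyMeasurable.approx k))
    (fun κ => hh.stronglyMeasurable.tendsto_approx κ) b hb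

end Measurability

end Spectral

/-! ### Orthogonality and moments of sums -/

section Probability

variable {Ω : Type*} {mΩ : MeasurableSpace Ω} {μ : Measure Ω}

/-- Intersections form a π-system generating the join, as required for the induction over measurable
sets below. -/
lemma sup_eq_generateFrom_inter (m₁ m₂ : MeasurableSpace Ω) :
    m₁ ⊔ m₂ = MeasurableSpace.generateFrom
      {s | ∃ A B, MeasurableSet[m₁] A ∧ MeasurableSet[m₂] B ∧ s = A ∩ B} := by
  refine le_antisymm (sup_le ?_ ?_) (MeasurableSpace.generateFrom_le ?_)
  · intro A hA
    exact MeasurableSpace.measurableSet_generateFrom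
      ⟨A, Set.univ, hA, MeasurableSet.univ, (Set.inter_univ A).symm⟩
  · intro B hB
    exact MeasurableSpace.measurableSet_generateFrom
      ⟨Set.univ, B, MeasurableSet.univ, hB, (Set.univ_inter B).symm⟩
  · rintro s ⟨A, B, hA, hB, rfl⟩
    have h1 : m₁ ≤ m₁ ⊔ m₂ := le_sup_left
    have h2 : m₂ ≤ m₁ ⊔ m₂ := le_sup_right
    exact MeasurableSet.inter (h1 A hA) (h2 B hB)

/-- If `X` has conditional mean zero given `m₁` and `σ(X) ∨ m₁` is independent of `m₂`, then `X` is
orthogonal to every variable measurable with respect to `m₁ ∨ m₂`. -/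
lemma integral_mul_eq_zero_of_condExp_eq_zero [IsProbabilityMeasure μ]
    {m₁ m₂ m' : MeasurableSpace Ω} (h₁ : m₁ ≤ m') (h' : m' ≤ mΩ) (h₂ : m₂ ≤ mΩ)
    (hind : Indep m' m₂ μ) {X G : Ω → ℝ} (hX : StronglyMeasurable[m'] X) (hXi : Integrable X μ)
    (h0 : μ[X | m₁] =ᵐ[μ] 0) (hG : StronglyMeasurable[m₁ ⊔ m₂] G)
    (hXG : Integrable (fun ω => X ω * G ω) μ) : ∫ ω, X ω * G ω ∂μ = 0 := by
  have hle : m₁ ⊔ m₂ ≤ mΩ := sup_le (h₁.trans h') h₂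
  have hA : ∀ A, MeasurableSet[m₁] A → ∫ ω in A, X ω ∂μ = 0 := by
    intro A hA
    rw [← setIntegral_condExp (h₁.trans h') hXi hA]
    rw [setIntegral_congr_ae (g := fun _ => (0 : ℝ)) (h₁.trans h' A hA)
      (h0.mono fun ω h _ => h)]
    simp
  have huniv : ∫ ω, X ω ∂μ = 0 := by
    have := hA Set.univ MeasurableSet.univ
    rwa [setIntegral_univ] at this
  have hS : ∀ s, MeasurableSet[m₁ ⊔ m₂] s → ∫ ω in s, X ω ∂μ = 0 := by
    intro s hs
    induction s, hs using MeasurableSpace.induction_on_inter (sup_eq_generateFrom_inter m₁ m₂) with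
    | h_inter =>
      rintro _ ⟨A, B, hA, hB, rfl⟩ _ ⟨A', B', hA', hB', rfl⟩ _
      exact ⟨A ∩ A', B ∩ B', hA.inter hA', hB.inter hB', Set.inter_inter_inter_comm _ _ _ _⟩
    | empty => simp
    | basic s hs =>
      obtain ⟨A, B, hA', hB, rfl⟩ := hs
      have hAm := h₁.trans h' A hA'
      have hBm := h₂ B hB
      -- On a set `A ∩ B` the integral factors: `1_A X` is `m'`-measurable because `m₁ ≤ m'`, hence
      -- independent of `1_B`, and its mean is zero by the hypothesis on `X`.
      have hi : IndepFun (A.indicator X) (B.indicator fun _ => (1 : ℝ)) μ := by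
        rw [IndepFun_iff_Indep]
        refine indep_of_indep_of_le_left (indep_of_indep_of_le_right hind ?_) ?_
        · exact Measurable.comap_le (measurable_const.indicator hB)
        · exact Measurable.comap_le (hX.measurable.indicator (h₁ A hA'))
      have h3 := hi.integral_fun_mul_eq_mul_integral
        (hXi.indicator hAm).aestronglyMeasurable
        (measurable_const.indicator hBm).aestronglyMeasurable
      rw [integral_indicator hAm, hA A hA', zero_mul] at h3
      rw [← integral_indicator (hAm.inter hBm), ← h3]
      refine integral_congr_ae (Eventually.of_forall fun ω => ?_)
      by_cases h1 : ω ∈ A <;> by_cases h2 : ω ∈ B <;> simp [h1, h2]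
    | compl s hs ih =>
      have := integral_add_compl (hle s hs) hXi
      rw [ih, huniv, zero_add] at this
      exact this
    | iUnion f hd hm ih =>
      rw [integral_iUnion (fun i => hle _ (hm i)) hd hXi.integrableOn]
      simp [ih]
  have hc : μ[X | m₁ ⊔ m₂] =ᵐ[μ] 0 := by
    refine (ae_eq_condExp_of_forall_setIntegral_eq hle hXi (fun s _ _ => integrableOn_zero)
      (fun s hs _ => ?_) aestronglyMeasurable_zero).symm
    rw [hS s hs]
    simp
  have h4 := condExp_mul_of_stronglyMeasurable_right hG hXG hXi
  rw [← integral_condExp hle (f := fun ω => X ω * G ω)]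
  refine (integral_congr_ae (h4.trans ?_)).trans (integral_zero Ω ℝ)
  filter_upwards [hc] with ω hω
  simp [hω]

variable {E : Type*} [NormedAddCommGroup E] [InnerProductSpace ℝ E]

lemma _root_.MeasureTheory.MemLp.integrable_inner' {X Y : Ω → E} (hX : MemLp X 2 μ)
    (hY : MemLp Y 2 μ) : Integrable (fun ω => inner ℝ (X ω) (Y ω)) μ := by
  refine (hX.integrable_norm_pow two_ne_zero |>.add
    (hY.integrable_norm_pow two_ne_zero)).mono' (hX.1.inner hY.1) (Eventually.of_forall fun ω => ?_)
  have h1 := abs_real_inner_le_norm (X ω) (Y ω)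
  simp only [Real.norm_eq_abs, Pi.add_apply]
  nlinarith [sq_nonneg (‖X ω‖ - ‖Y ω‖), sq_nonneg (‖X ω‖), sq_nonneg ‖Y ω‖]

lemma integral_norm_sq_sum_of_orthogonal {X : ℕ → Ω → E} (n : ℕ) (hX : ∀ i < n, MemLp (X i) 2 μ)
    (h0 : ∀ i < n, ∀ j < n, i ≠ j → ∫ ω, inner ℝ (X i ω) (X j ω) ∂μ = 0) :
    ∫ ω, ‖∑ i ∈ Finset.range n, X i ω‖ ^ 2 ∂μ
      = ∑ i ∈ Finset.range n, ∫ ω, ‖X i ω‖ ^ 2 ∂μ := by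
  have h1 : ∀ ω, ‖∑ i ∈ Finset.range n, X i ω‖ ^ 2 =
      ∑ i ∈ Finset.range n, ∑ j ∈ Finset.range n, inner ℝ (X i ω) (X j ω) := fun ω => by
    rw [← real_inner_self_eq_norm_sq, sum_inner]
    simp_rw [inner_sum]
  simp_rw [h1]
  rw [integral_finsetSum _ fun i hi => integrable_finsetSum _ fun j hj =>
    (hX i (Finset.mem_range.1 hi)).integrable_inner' (hX j (Finset.mem_range.1 hj))]
  refine Finset.sum_congr rfl fun i hi => ?_
  rw [integral_finsetSum _ fun j hj =>
    (hX i (Finset.mem_range.1 hi)).integrable_inner' (hX j (Finset.mem_range.1 hj)),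
    Finset.sum_eq_single_of_mem i hi fun j hj hji =>
      h0 i (Finset.mem_range.1 hi) j (Finset.mem_range.1 hj) hji.symm]
  simp_rw [real_inner_self_eq_norm_sq]

variable [CompleteSpace E] [SecondCountableTopology E] [MeasurableSpace E] [BorelSpace E]

lemma integral_inner_eq_zero_of_indepFun [IsProbabilityMeasure μ] {X Y : Ω → E}
    (h : IndepFun X Y μ) (hX : Integrable X μ) (hY : Integrable Y μ) (h0 : ∫ ω, Y ω ∂μ = 0) :
    ∫ ω, inner ℝ (X ω) (Y ω) ∂μ = 0 := by
  have := h.integral_bilin hX hY (innerSL ℝ)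
  rw [h0, map_zero] at this
  exact this

lemma integral_norm_sq_sum_le_of_iIndepFun [IsProbabilityMeasure μ] {X : ℕ → Ω → E}
    (hX : ∀ i, MemLp (X i) 2 μ) (hind : iIndepFun X μ) (h0 : ∀ i, ∫ ω, X i ω ∂μ = 0) {b : ℝ}
    (hb : ∀ i, ∫ ω, ‖X i ω‖ ^ 2 ∂μ ≤ b) (n : ℕ) :
    ∫ ω, ‖∑ i ∈ Finset.range n, X i ω‖ ^ 2 ∂μ ≤ n * b := by
  rw [integral_norm_sq_sum_of_orthogonal n (fun i _ => hX i) fun i _ j _ hij =>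
    integral_inner_eq_zero_of_indepFun (hind.indepFun hij) ((hX i).integrable (by norm_num))
      ((hX j).integrable (by norm_num)) (h0 j)]
  refine (Finset.sum_le_sum fun i _ => hb i).trans ?_
  simp

/-- Expand the square of `‖s‖² + 2⟨s,x⟩ + ‖x‖²`. The term linear in `x` is kept exactly, since it
integrates to zero under independence. The others are absorbed by Cauchy-Schwarz and `2⟨s,x⟩‖x‖² ≤
⟨s,x⟩² + ‖x‖⁴`. -/
lemma norm_add_pow_four_le (s x : E) :
    ‖s + x‖ ^ 4 ≤ ‖s‖ ^ 4 + 4 * inner ℝ (‖s‖ ^ 2 • s) x + 8 * (‖s‖ ^ 2 * ‖x‖ ^ 2)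
      + 3 * ‖x‖ ^ 4 := by
  have h1 := norm_add_sq_real s x
  have h2 := abs_real_inner_le_norm s x
  have h3 : inner ℝ s x ^ 2 ≤ ‖s‖ ^ 2 * ‖x‖ ^ 2 := by
    rw [← mul_pow, ← sq_abs]
    gcongr
  rw [inner_smul_left]
  simp only [conj_trivial]
  have h4 : ‖s + x‖ ^ 4 = (‖s + x‖ ^ 2) ^ 2 := by ring
  rw [h4, h1]
  nlinarith [sq_nonneg (inner ℝ s x - ‖x‖ ^ 2)]

/-- Induction on the number of terms. The partial sum is independent of the next summand, so the
linear term vanishes and one step adds at most `8n(1+B)² + 3B`. This fits into the increment of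
`11n²(1+B)²`, with `11 = 8 + 3`. -/
lemma integral_norm_pow_four_sum_le [IsProbabilityMeasure μ] {X : ℕ → Ω → E}
    (hm : ∀ i, Measurable (X i)) (hX : ∀ i, MemLp (X i) 4 μ) (hind : iIndepFun X μ)
    (h0 : ∀ i, ∫ ω, X i ω ∂μ = 0) {B : ℝ} (hB : ∀ i, ∫ ω, ‖X i ω‖ ^ 4 ∂μ ≤ B) (n : ℕ) :
    ∫ ω, ‖∑ i ∈ Finset.range n, X i ω‖ ^ 4 ∂μ ≤ 11 * n ^ 2 * (1 + B) ^ 2 := by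
  have hX2 : ∀ i, MemLp (X i) 2 μ := fun i => (hX i).mono_exponent (by norm_num)
  have i4 : ∀ {Y : Ω → E}, MemLp Y 4 μ → Integrable (fun ω => ‖Y ω‖ ^ 4) μ := fun {Y} hY =>
    MemLp.integrable_norm_pow (p := 4) (by exact_mod_cast hY) (by norm_num)
  have i2 : ∀ {Y : Ω → E}, MemLp Y 4 μ → Integrable (fun ω => ‖Y ω‖ ^ 2) μ := fun {Y} hY =>
    MemLp.integrable_norm_pow (p := 2) (by exact_mod_cast hY.mono_exponent (by norm_num))
      (by norm_num)
  have hB0 : 0 ≤ B := (integral_nonneg fun ω => by positivity).trans (hB 0)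
  have hb : ∀ i, ∫ ω, ‖X i ω‖ ^ 2 ∂μ ≤ 1 + B := by
    intro i
    calc ∫ ω, ‖X i ω‖ ^ 2 ∂μ ≤ ∫ ω, (1 + ‖X i ω‖ ^ 4) ∂μ := by
          refine integral_mono (i2 (hX i)) ((integrable_const 1).add (i4 (hX i))) fun ω => ?_
          simp only
          nlinarith [sq_nonneg (‖X i ω‖ ^ 2 - 1), sq_nonneg (‖X i ω‖ ^ 2)]
      _ ≤ 1 + B := by
          rw [integral_add (integrable_const 1) (i4 (hX i))]
          simpa using hB i
  have hS : ∀ n, MemLp (fun ω => ∑ i ∈ Finset.range n, X i ω) 4 μ := fun n =>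
    memLp_finsetSum _ fun i _ => hX i
  induction n with
  | zero => simp
  | succ n ih =>
    set S : Ω → E := fun ω => ∑ i ∈ Finset.range n, X i ω with hSdef
    have hSX : IndepFun S (X n) μ := by
      have := hind.indepFun_finsetSum_of_notMem hm (s := Finset.range n) (i := n) (by simp)
      convert this using 1
      funext ω
      simp [hSdef]
    have hSm : Measurable S := Finset.measurable_sum _ fun i _ => hm i
    have hS4 := hS n
    have hcube : Integrable (fun ω => ‖S ω‖ ^ 2 • S ω) μ := by
      refine ((integrable_const (1 : ℝ)).add (i4 hS4)).mono'
        (((hSm.norm.pow_const 2).smul hSm).aestronglyMeasurable)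
        (Eventually.of_forall fun ω => ?_)
      simp only [norm_smul, norm_pow, norm_norm, Pi.add_apply]
      have := norm_nonneg (S ω)
      nlinarith [sq_nonneg (‖S ω‖ ^ 2 - ‖S ω‖), sq_nonneg (‖S ω‖ - 1), sq_nonneg (‖S ω‖ ^ 2 - 1),
        sq_nonneg (‖S ω‖ ^ 2)]
    have hin : IndepFun (fun ω => ‖S ω‖ ^ 2 • S ω) (X n) μ :=
      hSX.comp (φ := fun s => ‖s‖ ^ 2 • s) (ψ := id)
        ((measurable_norm.pow_const 2).smul measurable_id) measurable_id
    have e1 : ∫ ω, inner ℝ (‖S ω‖ ^ 2 • S ω) (X n ω) ∂μ = 0 :=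
      integral_inner_eq_zero_of_indepFun hin hcube ((hX n).integrable (by norm_num)) (h0 n)
    have hsq : IndepFun (fun ω => ‖S ω‖ ^ 2) (fun ω => ‖X n ω‖ ^ 2) μ :=
      hSX.comp (φ := fun s => ‖s‖ ^ 2) (ψ := fun s => ‖s‖ ^ 2) (measurable_norm.pow_const 2)
        (measurable_norm.pow_const 2)
    have e2 : ∫ ω, ‖S ω‖ ^ 2 * ‖X n ω‖ ^ 2 ∂μ = (∫ ω, ‖S ω‖ ^ 2 ∂μ) * ∫ ω, ‖X n ω‖ ^ 2 ∂μ :=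
      hsq.integral_fun_mul_eq_mul_integral (i2 hS4).1 (i2 (hX n)).1
    have hS2 : ∫ ω, ‖S ω‖ ^ 2 ∂μ ≤ n * (1 + B) :=
      integral_norm_sq_sum_le_of_iIndepFun hX2 hind h0 hb n
    have j1 : Integrable (fun ω => inner ℝ (‖S ω‖ ^ 2 • S ω) (X n ω)) μ :=
      hin.integrable_bilin hcube ((hX n).integrable (by norm_num)) (innerSL ℝ)
    have j2 : Integrable (fun ω => ‖S ω‖ ^ 2 * ‖X n ω‖ ^ 2) μ :=
      hsq.integrable_mul (i2 hS4) (i2 (hX n))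
    have j3 : Integrable (fun ω => ‖S ω‖ ^ 4) μ := i4 hS4
    have j4 := i4 (hX n)
    have key : ∫ ω, ‖∑ i ∈ Finset.range (n + 1), X i ω‖ ^ 4 ∂μ ≤
        ∫ ω, (‖S ω‖ ^ 4 + 4 * inner ℝ (‖S ω‖ ^ 2 • S ω) (X n ω)
          + 8 * (‖S ω‖ ^ 2 * ‖X n ω‖ ^ 2) + 3 * ‖X n ω‖ ^ 4) ∂μ := by
      refine integral_mono (i4 (hS (n + 1)))
        (((j3.add (j1.const_mul 4)).add (j2.const_mul 8)).add (j4.const_mul 3)) fun ω => ?_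
      simp only [Finset.sum_range_succ]
      exact norm_add_pow_four_le _ _
    have l1 : Integrable (fun ω => ‖S ω‖ ^ 4 + 4 * inner ℝ (‖S ω‖ ^ 2 • S ω) (X n ω)) μ :=
      j3.add (j1.const_mul 4)
    have l2 : Integrable (fun ω => ‖S ω‖ ^ 4 + 4 * inner ℝ (‖S ω‖ ^ 2 • S ω) (X n ω)
        + 8 * (‖S ω‖ ^ 2 * ‖X n ω‖ ^ 2)) μ := l1.add (j2.const_mul 8)
    rw [integral_add l2 (j4.const_mul 3), integral_add l1 (j2.const_mul 8),
      integral_add j3 (j1.const_mul 4), integral_const_mul, integral_const_mul,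
      integral_const_mul, e1, e2] at key
    have k1 : (∫ ω, ‖S ω‖ ^ 2 ∂μ) * ∫ ω, ‖X n ω‖ ^ 2 ∂μ ≤ n * (1 + B) * (1 + B) :=
      mul_le_mul hS2 (hb n) (integral_nonneg fun ω => by positivity) (by positivity)
    have k2 := hB n
    push_cast
    have k3 : 0 ≤ (n : ℝ) := n.cast_nonneg
    nlinarith [mul_nonneg k3 (mul_nonneg hB0 hB0), mul_nonneg k3 hB0]

/-- A variable is bounded in probability, conditionally on `m`, if its truncated means are. -/
lemma isBigOp_condExp {m mΩ : MeasurableSpace Ω} {μ : Measure Ω} [IsProbabilityMeasure μ]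
    (hm : m ≤ mΩ)
    {Y : ℕ → Ω → ℝ} {r : ℕ → ℝ} (hr : ∀ᶠ n in atTop, 0 < r n) (hY0 : ∀ n, 0 ≤ᵐ[μ] Y n)
    (hYi : ∀ᶠ n in atTop, Integrable[mΩ] (Y n) μ)
    (h : ∀ ε : ℝ, 0 < ε → ∃ (C : ℝ) (A : ℕ → Set Ω), (∀ n, MeasurableSet[m] (A n)) ∧
      ∀ᶠ n in atTop, μ (A n)ᶜ ≤ ENNReal.ofReal ε ∧ ∫ ω in A n, Y n ω ∂μ ≤ C * r n) :
    IsBigOp μ (fun n => μ[Y n | m]) r := by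
  intro ε hε
  obtain ⟨C, A, hA, h⟩ := h (ε / 2) (by positivity)
  -- The constant is made positive so that the threshold in Markov's inequality is positive.
  set C' : ℝ := max C 1 with hC'
  have hC'0 : 0 < C' := lt_of_lt_of_le one_pos (le_max_right _ _)
  refine ⟨2 * C' / ε, ?_⟩
  filter_upwards [hr, hYi, h] with n hr hYi ⟨h1, h2⟩
  have hAm := hm _ (hA n)
  have hpos : 0 ≤ᵐ[μ] μ[Y n | m] := condExp_nonneg (hY0 n)
  -- The event belongs to the conditioning σ-algebra, so integrating the conditional mean over it is
  -- the same as integrating the variable.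
  have hint : ∫ ω in A n, (μ[Y n | m]) ω ∂μ ≤ C' * r n := by
    rw [setIntegral_condExp hm hYi (hA n)]
    exact h2.trans (by gcongr; exact le_max_left _ _)
  have hmark : μ ({ω | 2 * C' / ε * r n < |(μ[Y n | m]) ω|} ∩ A n) ≤ ENNReal.ofReal (ε / 2) := by
    have ht : 0 < 2 * C' / ε * r n := by positivity
    have hmk := mul_meas_ge_le_integral_of_nonneg (μ := μ.restrict (A n)) (f := μ[Y n | m])
      (ae_restrict_of_ae hpos) integrable_condExp.integrableOn (2 * C' / ε * r n)
    have h3 : (μ.restrict (A n)).real {ω | 2 * C' / ε * r n ≤ (μ[Y n | m]) ω} ≤ ε / 2 := by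
      have h4 : 2 * C' / ε * r n * (μ.restrict (A n)).real
          {ω | 2 * C' / ε * r n ≤ (μ[Y n | m]) ω} ≤ 2 * C' / ε * r n * (ε / 2) := by
        refine hmk.trans (hint.trans_eq ?_)
        field_simp
      exact le_of_mul_le_mul_left h4 ht
    have h5 : μ ({ω | 2 * C' / ε * r n < |(μ[Y n | m]) ω|} ∩ A n) ≤
        (μ.restrict (A n)) {ω | 2 * C' / ε * r n ≤ (μ[Y n | m]) ω} := by
      rw [← Measure.restrict_apply' hAm]
      refine measure_mono_ae ?_
      filter_upwards [ae_restrict_of_ae hpos] with ω hω hlt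
      have hlt' : 2 * C' / ε * r n < |(μ[Y n | m]) ω| := hlt
      rw [abs_of_nonneg hω] at hlt'
      exact hlt'.le
    refine h5.trans ?_
    rw [← ENNReal.ofReal_toReal (measure_ne_top (μ.restrict (A n)) _)]
    exact ENNReal.ofReal_le_ofReal h3
  calc μ {ω | 2 * C' / ε * r n < |(μ[Y n | m]) ω|}
      ≤ μ (({ω | 2 * C' / ε * r n < |(μ[Y n | m]) ω|} ∩ A n) ∪ (A n)ᶜ) := by
        refine measure_mono fun ω hω => ?_
        by_cases h : ω ∈ A n
        · exact Or.inl ⟨hω, h⟩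
        · exact Or.inr h
    _ ≤ ENNReal.ofReal (ε / 2) + ENNReal.ofReal (ε / 2) :=
        (measure_union_le _ _).trans (add_le_add hmark h1)
    _ = ENNReal.ofReal ε := by
        rw [← ENNReal.ofReal_add (by positivity) (by positivity), add_halves]

end Probability

/-! ### Scaling matrices -/

section Matrices

variable {d : ℕ}

lemma matMap_mul (A B : Matrix (Fin d) (Fin d) ℝ) : matMap (A * B) = (matMap A).comp (matMap B) :=
  map_mul (Matrix.toEuclideanCLM (n := Fin d) (𝕜 := ℝ)) A B

lemma matMap_one : matMap (1 : Matrix (Fin d) (Fin d) ℝ) = ContinuousLinearMap.id ℝ (Vec d) :=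
  map_one (Matrix.toEuclideanCLM (n := Fin d) (𝕜 := ℝ))

lemma matMap_transpose (A : Matrix (Fin d) (Fin d) ℝ) :
    matMap A.transpose = (matMap A).adjoint := by
  unfold matMap
  rw [← Matrix.conjTranspose_eq_transpose_of_trivial, ← Matrix.star_eq_conjTranspose, map_star]
  rfl

lemma norm_matMap_diagonal_le {c : Fin d → ℝ} {M : ℝ} (hM : 0 ≤ M) (hc : ∀ j, |c j| ≤ M) :
    ‖matMap (Matrix.diagonal c)‖ ≤ M := by
  refine ContinuousLinearMap.opNorm_le_bound _ hM fun v => ?_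
  refine (sq_le_sq₀ (norm_nonneg _) (by positivity)).1 ?_
  rw [mul_pow, EuclideanSpace.norm_sq_eq, EuclideanSpace.norm_sq_eq, Finset.mul_sum]
  refine Finset.sum_le_sum fun j _ => ?_
  have : (matMap (Matrix.diagonal c) v).ofLp j = c j * v.ofLp j := by
    simp [matMap, Matrix.ofLp_toEuclideanCLM, Matrix.mulVec_diagonal]
  rw [this, norm_mul, mul_pow, Real.norm_eq_abs]
  gcongr
  exact hc j

end Matrices

namespace Design

variable {Ω : Type*} {H : Type*} [NormedAddCommGroup H] [InnerProductSpace ℝ H] {dx d : ℕ}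
  (S : Design Ω H dx d)

/-- `D_n = Λ_n / √n`. -/
noncomputable def D (n : ℕ) : Vec d →L[ℝ] Vec d := (Real.sqrt n)⁻¹ • matMap (S.LamN n)

/-- `D_n⁻¹ = √n Λ_n⁻¹`. -/
noncomputable def DInv (n : ℕ) : Vec d →L[ℝ] Vec d := Real.sqrt n • matMap (S.LamN n)⁻¹

lemma PiN_apply (n : ℕ) (z : H) : S.PiN n z = S.D n (S.Pi0 z) := rfl

lemma adjoint_D (n : ℕ) :
    (S.D n).adjoint = (Real.sqrt n)⁻¹ • matMap (S.LamN n).transpose := by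
  rw [matMap_transpose, D, map_smulₛₗ]
  simp

lemma scaleT_eq (n : ℕ) (v : Vec2 d) : S.scaleT n v = pair ((S.D n).adjoint v.fst) v.snd := by
  rw [adjoint_D]
  rfl

lemma scaleInv_eq (n : ℕ) (v : Vec2 d) : S.scaleInv n v = pair (S.DInv n v.fst) v.snd := rfl

/-- The scaled regressor `(f_i', V_i')'`. -/
noncomputable def F (i : ℕ) (ω : Ω) : Vec2 d := pair (S.f i ω) (S.V i ω)

lemma g_eq (n i : ℕ) (ω : Ω) : S.g n i ω = pair (S.D n (S.f i ω)) (S.V i ω) := by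
  unfold g regressor Y2
  rw [add_sub_cancel_left]
  rfl

/-- The scaling is moved from the regressor to the parameter. The data then enter through `F`, which
does not depend on `n`. -/
lemma inner_g (n i : ℕ) (ω : Ω) (v : Vec2 d) :
    inner ℝ (S.g n i ω) v = inner ℝ (S.F i ω) (S.scaleT n v) := by
  rw [g_eq, scaleT_eq, F, inner_pair, inner_pair, pair_fst, pair_snd,
    ContinuousLinearMap.adjoint_inner_right]

/-- The index `g_i'θ₀`. -/
noncomputable def idx (n i : ℕ) (ω : Ω) : ℝ := inner ℝ (S.g n i ω) S.theta0

/-- `scaleInv` as a continuous linear map. -/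
noncomputable def scaleInvL (n : ℕ) : Vec2 d →L[ℝ] Vec2 d :=
  (pairL d).comp (((S.DInv n).comp (WithLp.fstL 2 ℝ (Vec d) (Vec d))).prod
    (WithLp.sndL 2 ℝ (Vec d) (Vec d)))

lemma scaleInvL_apply (n : ℕ) (v : Vec2 d) : S.scaleInvL n v = S.scaleInv n v := rfl

/-- `scaleT` as a continuous linear map. -/
noncomputable def scaleTL (n : ℕ) : Vec2 d →L[ℝ] Vec2 d :=
  (pairL d).comp (((S.D n).adjoint.comp (WithLp.fstL 2 ℝ (Vec d) (Vec d))).prod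
    (WithLp.sndL 2 ℝ (Vec d) (Vec d)))

lemma scaleTL_apply (n : ℕ) (v : Vec2 d) : S.scaleTL n v = S.scaleT n v := (S.scaleT_eq n v).symm

end Design

namespace ModelConditions

open Design

variable {Ω : Type*} [MeasurableSpace Ω] {P : Measure Ω} [IsProbabilityMeasure P]
  {H : Type*} [NormedAddCommGroup H] [InnerProductSpace ℝ H] [CompleteSpace H]
  [MeasurableSpace H] {dx d : ℕ}
  {S : Design Ω H dx d} {Θ : Set (Vec2 d)} {ρ : ℝ} (hS : ModelConditions P S Θ ρ)
include hS

lemma isUnit_det_Lam : IsUnit S.Lam.det := by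
  have h := hS.lam_posDef.det_pos
  rw [Matrix.det_mul, Matrix.det_transpose] at h
  exact isUnit_iff_ne_zero.2 fun h0 => by simp [h0] at h

lemma LamN_inv {n : ℕ} (hn : 1 ≤ n) :
    (S.LamN n)⁻¹ = Matrix.diagonal (fun j => (S.mu j n)⁻¹) * S.Lam⁻¹ := by
  refine Matrix.inv_eq_left_inv ?_
  have h1 : S.Lam⁻¹ * S.Lam = 1 := Matrix.nonsing_inv_mul _ hS.isUnit_det_Lam
  calc Matrix.diagonal (fun j => (S.mu j n)⁻¹) * S.Lam⁻¹ * S.LamN n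
      = Matrix.diagonal (fun j => (S.mu j n)⁻¹) * (S.Lam⁻¹ * S.Lam)
          * Matrix.diagonal (fun j => S.mu j n) := by
        simp only [Design.LamN, Matrix.mul_assoc]
    _ = 1 := by
        rw [h1, Matrix.mul_one, Matrix.diagonal_mul_diagonal]
        rw [← Matrix.diagonal_one]
        congr 1
        funext j
        exact inv_mul_cancel₀ (hS.mu_pos j n hn).ne'

lemma LamN_inv_mul {n : ℕ} (hn : 1 ≤ n) : (S.LamN n)⁻¹ * S.LamN n = 1 := by
  refine Matrix.nonsing_inv_mul _ ?_
  rw [Design.LamN, Matrix.det_mul, Matrix.det_diagonal]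
  exact hS.isUnit_det_Lam.mul
    (isUnit_iff_ne_zero.2 (Finset.prod_ne_zero_iff.2 fun j _ => (hS.mu_pos j n hn).ne'))

lemma DInv_D {n : ℕ} (hn : 1 ≤ n) (v : Vec d) : S.DInv n (S.D n v) = v := by
  have h0 : Real.sqrt n ≠ 0 := Real.sqrt_ne_zero'.2 (by exact_mod_cast hn)
  have h1 := congrArg matMap (hS.LamN_inv_mul hn)
  rw [matMap_mul, matMap_one] at h1
  have h2 := congrArg (fun L : Vec d →L[ℝ] Vec d => L v) h1
  simp only [ContinuousLinearMap.comp_apply, ContinuousLinearMap.id_apply] at h2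
  simp only [Design.DInv, Design.D, _root_.smul_apply, map_smul, smul_smul, h2,
    inv_mul_cancel₀ h0, one_smul]

lemma D_DInv {n : ℕ} (hn : 1 ≤ n) (v : Vec d) : S.D n (S.DInv n v) = v := by
  have h0 : Real.sqrt n ≠ 0 := Real.sqrt_ne_zero'.2 (by exact_mod_cast hn)
  have h1 := congrArg matMap (mul_eq_one_comm.1 (hS.LamN_inv_mul hn))
  rw [matMap_mul, matMap_one] at h1
  have h2 := congrArg (fun L : Vec d →L[ℝ] Vec d => L v) h1
  simp only [ContinuousLinearMap.comp_apply, ContinuousLinearMap.id_apply] at h2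
  simp only [Design.DInv, Design.D, _root_.smul_apply, map_smul, smul_smul, h2,
    mul_inv_cancel₀ h0, one_smul]

lemma scaleInv_g {n : ℕ} (hn : 1 ≤ n) (i : ℕ) (ω : Ω) : S.scaleInv n (S.g n i ω) = S.F i ω := by
  rw [Design.g_eq, Design.scaleInv_eq, pair_fst, pair_snd, hS.DInv_D hn]
  rfl

lemma scaleT_injective {n : ℕ} (hn : 1 ≤ n) {v : Vec2 d} (hv : S.scaleT n v = 0) : v = 0 := by
  rw [Design.scaleT_eq] at hv
  have h1 : (S.D n).adjoint v.fst = 0 := congrArg WithLp.fst hv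
  have h2 : v.snd = 0 := congrArg WithLp.snd hv
  have h3 : v.fst = 0 := by
    refine ext_inner_right ℝ fun w => ?_
    rw [← hS.D_DInv hn w, ← ContinuousLinearMap.adjoint_inner_left, h1, inner_zero_left,
      inner_zero_left]
  have : v = pair v.fst v.snd := rfl
  rw [this, h2, h3]
  rfl

/-- `⟨S_n⁻¹ u, S_n' v⟩ = ⟨u, v⟩`. -/
lemma inner_scaleInv_scaleT {n : ℕ} (hn : 1 ≤ n) (u v : Vec2 d) :
    inner ℝ (S.scaleInv n u) (S.scaleT n v) = inner ℝ u v := by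
  have : u = pair u.fst u.snd := rfl
  rw [Design.scaleInv_eq, Design.scaleT_eq, inner_pair, pair_fst, pair_snd,
    ContinuousLinearMap.adjoint_inner_right, hS.D_DInv hn]
  conv_rhs => rw [this]
  rw [inner_pair]

lemma exists_mu_bound : ∃ M : ℝ, 0 < M ∧ ∀ j n, 1 ≤ n → S.mu j n ≤ M * Real.sqrt n := by
  have h : ∀ j, ∃ M : ℝ, ∀ n, 1 ≤ n → S.mu j n ≤ M * Real.sqrt n := by
    intro j
    rcases hS.mu_rate j with h | h
    · exact ⟨1, fun n hn => by rw [h n hn, one_mul]⟩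
    · obtain ⟨M, hM⟩ := h.bddAbove_range
      refine ⟨M, fun n hn => ?_⟩
      have := hM ⟨n, rfl⟩
      rwa [div_le_iff₀ (Real.sqrt_pos.2 (by exact_mod_cast hn))] at this
  choose M hM using h
  refine ⟨1 + ∑ j, |M j|, by positivity, fun j n hn => (hM j n hn).trans ?_⟩
  gcongr
  have := Finset.single_le_sum (f := fun j => |M j|) (fun _ _ => abs_nonneg _) (Finset.mem_univ j)
  have h2 := le_abs_self (M j)
  linarith

lemma exists_norm_D_le : ∃ C : ℝ, 0 < C ∧ ∀ n, ‖S.D n‖ ≤ C := by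
  obtain ⟨M, hM0, hM⟩ := hS.exists_mu_bound
  refine ⟨‖matMap S.Lam‖ * M + 1, by positivity, fun n => ?_⟩
  suffices h : ‖S.D n‖ ≤ ‖matMap S.Lam‖ * M by linarith
  -- At `n = 0` the factor `(√0)⁻¹` is zero by convention, so the bound holds without a restriction
  -- on `n`.
  rcases Nat.eq_zero_or_pos n with rfl | hn
  · rw [Design.D, norm_smul, Nat.cast_zero, Real.sqrt_zero, inv_zero, norm_zero, zero_mul]
    positivity
  have hn0 : 0 < Real.sqrt n := Real.sqrt_pos.2 (by exact_mod_cast hn)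
  rw [Design.D, norm_smul, Design.LamN, matMap_mul, norm_inv, Real.norm_eq_abs, abs_of_pos hn0,
    inv_mul_le_iff₀ hn0]
  calc _ ≤ ‖matMap S.Lam‖ * ‖matMap (Matrix.diagonal fun j => S.mu j n)‖ :=
        ContinuousLinearMap.opNorm_comp_le _ _
    _ ≤ ‖matMap S.Lam‖ * (M * Real.sqrt n) := by
        gcongr
        refine norm_matMap_diagonal_le (by positivity) fun j => ?_
        rw [abs_of_pos (hS.mu_pos j n hn)]
        exact hM j n hn
    _ = _ := by ring

/-- Undoing the scaling inflates coordinate `j` by `√n / μ_{jn}`. Eventually `μ_{jn}² α ≥ 1`, so the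
inflation is at most of order `√(nα)`. This is how strength and regularization interact in the
residual part. -/
lemma exists_norm_DInv_sq_le {α : ℕ → ℝ} (hα_pos : ∀ n, 0 < α n)
    (hμα : ∀ j, Tendsto (fun n => S.mu j n ^ 2 * α n) atTop atTop) :
    ∃ C : ℝ, 0 < C ∧ ∀ᶠ n in atTop, ‖S.DInv n‖ ^ 2 ≤ C * (n * α n) := by
  refine ⟨‖matMap S.Lam⁻¹‖ ^ 2 + 1, by positivity, ?_⟩
  have h1 : ∀ᶠ n in atTop, ∀ j, 1 ≤ S.mu j n ^ 2 * α n :=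
    eventually_all.2 fun j => (hμα j).eventually_ge_atTop 1
  filter_upwards [h1, eventually_ge_atTop 1] with n h1 hn
  have hα := hα_pos n
  have hb : ‖S.DInv n‖ ≤ Real.sqrt n * (Real.sqrt (α n) * ‖matMap S.Lam⁻¹‖) := by
    rw [Design.DInv, norm_smul, hS.LamN_inv hn, matMap_mul, Real.norm_eq_abs,
      abs_of_nonneg (Real.sqrt_nonneg _)]
    gcongr
    refine (ContinuousLinearMap.opNorm_comp_le _ _).trans ?_
    gcongr
    refine norm_matMap_diagonal_le (Real.sqrt_nonneg _) fun j => ?_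
    have hm := hS.mu_pos j n hn
    rw [abs_of_pos (inv_pos.2 hm)]
    refine Real.le_sqrt_of_sq_le ?_
    rw [inv_pow, inv_le_iff_one_le_mul₀ (by positivity), mul_comm]
    exact h1 j
  calc ‖S.DInv n‖ ^ 2 ≤ (Real.sqrt n * (Real.sqrt (α n) * ‖matMap S.Lam⁻¹‖)) ^ 2 := by gcongr
    _ = ‖matMap S.Lam⁻¹‖ ^ 2 * (n * α n) := by
        rw [mul_pow, mul_pow, Real.sq_sqrt n.cast_nonneg, Real.sq_sqrt hα.le]
        ring
    _ ≤ _ := by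
        have : 0 ≤ (n : ℝ) * α n := by positivity
        nlinarith

/-- Strength never exceeds the order `√n`, so `μ² α → ∞` forces `nα` to be eventually at least one.
At least one coordinate is needed to draw this conclusion. -/
lemma eventually_one_le_mul [NeZero d] {α : ℕ → ℝ} (hα_pos : ∀ n, 0 < α n)
    (hμα : ∀ j, Tendsto (fun n => S.mu j n ^ 2 * α n) atTop atTop) :
    ∀ᶠ n : ℕ in atTop, 1 ≤ n * α n := by
  obtain ⟨M, hM0, hM⟩ := hS.exists_mu_bound
  filter_upwards [(hμα 0).eventually_ge_atTop (M ^ 2), eventually_ge_atTop 1] with n h1 hn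
  have h2 := hM 0 n hn
  have h3 := hS.mu_pos 0 n hn
  have h4 : S.mu 0 n ^ 2 ≤ M ^ 2 * n := by
    calc S.mu 0 n ^ 2 ≤ (M * Real.sqrt n) ^ 2 := by gcongr
      _ = M ^ 2 * n := by rw [mul_pow, Real.sq_sqrt n.cast_nonneg]
  have h5 : M ^ 2 ≤ M ^ 2 * (n * α n) :=
    h1.trans ((mul_le_mul_of_nonneg_right h4 (hα_pos n).le).trans_eq (mul_assoc _ _ _))
  have : 0 < M ^ 2 := by positivity
  nlinarith

/-! ### Almost sure bounds -/

/-- Probabilities away from zero and one confine the index `g_i'θ`. Removing the bounded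
contribution of `f_i` confines `V_i'θ₂`, where `θ₂` is the second block of `θ`. Comparing `θ₀` with
a point shifted along one coordinate of this block, still in `Θ` because `θ₀` is interior, isolates
a coordinate of `V_i`. -/
lemma exists_ae_norm_V_le : ∃ C : ℝ, ∀ᵐ ω ∂P, ∀ i, ‖S.V i ω‖ ≤ C := by
  obtain ⟨Cf, hCf⟩ := hS.f_bdd
  obtain ⟨CD, hCD0, hCD⟩ := hS.exists_norm_D_le
  have hCf0 : ∀ᵐ ω ∂P, ∀ i, ‖S.f i ω‖ ≤ |Cf| := by
    filter_upwards [hCf] with ω h i using (h i).trans (le_abs_self _)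
  have hθ : ∀ θ ∈ Θ, ∃ M : ℝ, ∀ᵐ ω ∂P, ∀ i, |inner ℝ (S.V i ω) θ.snd| ≤ M := by
    intro θ hθ
    obtain ⟨ε, hε, h⟩ := hS.prob_bdd θ hθ
    obtain ⟨M, hM⟩ := exists_bound_of_Phi_mem hε
    refine ⟨M + CD * |Cf| * ‖θ.fst‖, ?_⟩
    filter_upwards [h, hCf0] with ω h hf i
    -- The bound on the index holds only for large `n` and `i < n`, but its constant is free of `n`.
    -- Any such `n` beyond `i` therefore gives a bound on `V_i`, which does not involve `n`.
    obtain ⟨n, hn, hin⟩ := (h.and (eventually_gt_atTop i)).exists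
    have h1 := hM _ (hn i hin)
    rw [Design.g_eq, inner_pair] at h1
    have h2 : |inner ℝ (S.D n (S.f i ω)) θ.fst| ≤ CD * |Cf| * ‖θ.fst‖ := by
      refine (abs_real_inner_le_norm _ _).trans ?_
      gcongr
      refine ((S.D n).le_opNorm _).trans ?_
      gcongr
      · exact hCD n
      · exact hf i
    have h3 := abs_sub (inner ℝ (S.D n (S.f i ω)) θ.fst + inner ℝ (S.V i ω) θ.snd)
      (inner ℝ (S.D n (S.f i ω)) θ.fst)
    rw [add_sub_cancel_left] at h3
    linarith
  have hl : ∀ l : Fin d, ∃ M : ℝ, ∀ᵐ ω ∂P, ∀ i, |S.V i ω l| ≤ M := by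
    intro l
    let e : Vec2 d := pair 0 (EuclideanSpace.single l 1)
    have hcont : Tendsto (fun t : ℝ => S.theta0 + t • e) (𝓝[>] 0) (𝓝 S.theta0) := by
      have : Continuous fun t : ℝ => S.theta0 + t • e := by fun_prop
      have h2 := this.tendsto 0
      rw [zero_smul, add_zero] at h2
      exact h2.mono_left nhdsWithin_le_nhds
    have hev := hcont.eventually (mem_interior_iff_mem_nhds.1 hS.theta_mem)
    obtain ⟨t, ht, ht0⟩ := (hev.and self_mem_nhdsWithin).exists
    have ht0' : 0 < t := ht0
    obtain ⟨M0, h0⟩ := hθ _ (interior_subset hS.theta_mem)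
    obtain ⟨M1, h1⟩ := hθ _ ht
    refine ⟨(M0 + M1) / t, ?_⟩
    filter_upwards [h0, h1] with ω h0 h1 i
    have h2 : (S.theta0 + t • e).snd = S.theta0.snd + t • EuclideanSpace.single l (1 : ℝ) := rfl
    have h3 : t * S.V i ω l = inner ℝ (S.V i ω) (S.theta0 + t • e).snd
        - inner ℝ (S.V i ω) S.theta0.snd := by
      rw [h2, inner_add_right, inner_smul_right, EuclideanSpace.inner_single_right]
      simp
    rw [le_div_iff₀ ht0', mul_comm]
    nth_rewrite 1 [← abs_of_pos ht0']
    rw [← abs_mul, h3]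
    have := abs_sub (inner ℝ (S.V i ω) (S.theta0 + t • e).snd) (inner ℝ (S.V i ω) S.theta0.snd)
    linarith [h0 i, h1 i]
  choose M hM using hl
  refine ⟨Real.sqrt (∑ l, M l ^ 2), ?_⟩
  filter_upwards [ae_all_iff.2 hM] with ω h i
  refine Real.le_sqrt_of_sq_le ?_
  rw [EuclideanSpace.norm_sq_eq]
  refine Finset.sum_le_sum fun l _ => ?_
  rw [Real.norm_eq_abs]
  gcongr
  exact h l i

end ModelConditions

/-- Uniform bounds on the scaled regressor and on the weights at the true index. -/
structure UniformBound {Ω : Type*} {H : Type*} [NormedAddCommGroup H] [InnerProductSpace ℝ H]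
    {dx d : ℕ} (S : Design Ω H dx d) (c : Criterion) (C c₀ : ℝ) (ω : Ω) : Prop where
  norm_F : ∀ i, ‖S.F i ω‖ ≤ C
  norm_V : ∀ i, ‖S.V i ω‖ ≤ C
  abs_hfac : ∀ n i, |hfac c (S.idx n i ω)| ≤ C
  abs_hfacD : ∀ n i, |hfacD c (S.idx n i ω)| ≤ C
  abs_wgt : ∀ n i, |wgt c (S.idx n i ω)| ≤ C
  le_wgt : ∀ n i, c₀ ≤ wgt c (S.idx n i ω)

/-- The index lies in one compact interval for all `n` and `i`. The continuous factors are bounded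
there, and the positive continuous weight has a positive minimum. -/
lemma ModelConditions.exists_uniformBound {Ω : Type*} [MeasurableSpace Ω] {P : Measure Ω}
    [IsProbabilityMeasure P] {H : Type*} [NormedAddCommGroup H] [InnerProductSpace ℝ H]
    [CompleteSpace H] [MeasurableSpace H] {dx d : ℕ}
    {S : Design Ω H dx d} {Θ : Set (Vec2 d)} {ρ : ℝ} (hS : ModelConditions P S Θ ρ)
    (c : Criterion) :
    ∃ C c₀ : ℝ, 0 < C ∧ 0 < c₀ ∧ ∀ᵐ ω ∂P, UniformBound S c C c₀ ω := by
  obtain ⟨Cf, hCf⟩ := hS.f_bdd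
  obtain ⟨CV, hCV⟩ := hS.exists_ae_norm_V_le
  obtain ⟨CD, hCD0, hCD⟩ := hS.exists_norm_D_le
  set M : ℝ := (CD * |Cf| + |CV|) * ‖S.theta0‖ with hM
  have hM0 : 0 ≤ M := by positivity
  have hK : IsCompact (Set.Icc (-M) M) := isCompact_Icc
  obtain ⟨C1, h1⟩ := hK.exists_bound_of_continuousOn (continuous_hfac c).continuousOn
  obtain ⟨C2, h2⟩ := hK.exists_bound_of_continuousOn (continuous_hfacD c).continuousOn
  obtain ⟨C3, h3⟩ := hK.exists_bound_of_continuousOn (continuous_wgt c).continuousOn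
  obtain ⟨z0, -, hz0⟩ := hK.exists_isMinOn ⟨0, by simpa using hM0⟩
    (continuous_wgt c).continuousOn
  refine ⟨1 + (|Cf| + |CV|) + |C1| + |C2| + |C3|, wgt c z0, by positivity, wgt_pos c z0, ?_⟩
  filter_upwards [hCf, hCV] with ω hf hV
  have hf' : ∀ i, ‖S.f i ω‖ ≤ |Cf| := fun i => (hf i).trans (le_abs_self _)
  have hV' : ∀ i, ‖S.V i ω‖ ≤ |CV| := fun i => (hV i).trans (le_abs_self _)
  have hpair : ∀ a b : Vec d, ‖pair a b‖ ≤ ‖a‖ + ‖b‖ := fun a b => by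
    refine (sq_le_sq₀ (norm_nonneg _) (by positivity)).1 ?_
    rw [norm_pair_sq]
    nlinarith [norm_nonneg a, norm_nonneg b]
  have hidx : ∀ n i, S.idx n i ω ∈ Set.Icc (-M) M := by
    intro n i
    rw [Set.mem_Icc, ← abs_le]
    refine (abs_real_inner_le_norm _ _).trans ?_
    rw [hM]
    gcongr
    rw [Design.g_eq]
    refine (hpair _ _).trans ?_
    gcongr
    · refine ((S.D n).le_opNorm _).trans ?_
      gcongr
      · exact hCD n
      · exact hf' i
    · exact hV' i
  have a1 := abs_nonneg C1
  have a2 := abs_nonneg C2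
  have a3 := abs_nonneg C3
  have a4 := abs_nonneg Cf
  have a5 := abs_nonneg CV
  refine ⟨fun i => ?_, fun i => ?_, fun n i => ?_, fun n i => ?_, fun n i => ?_,
    fun n i => isMinOn_iff.1 hz0 _ (hidx n i)⟩
  · have := (hpair (S.f i ω) (S.V i ω)).trans (add_le_add (hf' i) (hV' i))
    exact this.trans (by linarith)
  · have := hV' i
    linarith
  · have := (h1 _ (hidx n i)).trans (le_abs_self _)
    rw [Real.norm_eq_abs] at this
    linarith
  · have := (h2 _ (hidx n i)).trans (le_abs_self _)
    rw [Real.norm_eq_abs] at this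
    linarith
  · have := (h3 _ (hidx n i)).trans (le_abs_self _)
    rw [Real.norm_eq_abs] at this
    linarith

lemma gaussianReal_one_Iic (m t : ℝ) : (gaussianReal m 1).real (Set.Iic t) = Phi (t - m) := by
  have h : gaussianReal m 1 = (gaussianReal 0 1).map (· + m) := by
    rw [gaussianReal_map_add_const, zero_add]
  rw [h, measureReal_def, Measure.map_apply (by fun_prop) measurableSet_Iic, ← measureReal_def, Phi,
    cdf_eq_real]
  congr 1
  ext x
  simp [le_sub_iff_add_le]

/-! ### The σ-algebras of the sample and the conditionally centred residuals. -/

namespace Design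

variable {Ω : Type*} {H : Type*} [NormedAddCommGroup H] [InnerProductSpace ℝ H] {dx d : ℕ}
  (S : Design Ω H dx d)

/-- The observation `(x_i, V_i, u_i)`. -/
def obs (i : ℕ) (ω : Ω) : (Fin dx → ℝ) × Vec d × ℝ := (S.x i ω, S.V i ω, S.u i ω)

/-- The residual `y_i - Φ(g_i'θ₀)`. -/
noncomputable def eps (n i : ℕ) (ω : Ω) : ℝ := S.y n i ω - Phi (S.idx n i ω)

/-- `F_i` as a function of `(x_i, V_i)`. -/
noncomputable def FD (p : (Fin dx → ℝ) × Vec d) : Vec2 d := pair (S.Pi0 (S.Z p.1)) p.2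

/-- The index as a function of `(x_i, V_i)`. -/
noncomputable def idxD (n : ℕ) (p : (Fin dx → ℝ) × Vec d) : ℝ :=
  inner ℝ (pair (S.D n (S.Pi0 (S.Z p.1))) p.2) S.theta0

/-- `Y_{2i}'β₀` as a function of `(x_i, V_i)`. -/
noncomputable def cutD (n : ℕ) (p : (Fin dx → ℝ) × Vec d) : ℝ :=
  inner ℝ (S.D n (S.Pi0 (S.Z p.1)) + p.2) S.beta0

open Classical in
/-- The response as a function of `((x_i, V_i), u_i)`. -/
noncomputable def yD (n : ℕ) (p : ((Fin dx → ℝ) × Vec d) × ℝ) : ℝ :=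
  if p.2 ≤ S.cutD n p.1 then 1 else 0

lemma idx_eq (n i : ℕ) (ω : Ω) : S.idx n i ω = S.idxD n (S.x i ω, S.V i ω) := by
  rw [idx, g_eq]
  rfl

lemma y_eq (n i : ℕ) (ω : Ω) : S.y n i ω = S.yD n ((S.x i ω, S.V i ω), S.u i ω) := rfl

/-- The control function identity: the second block `β₀ + ψ₀` of the parameter splits the index into
the threshold for `u` and minus the conditional mean of `u`. -/
lemma idxD_eq (n : ℕ) (p : (Fin dx → ℝ) × Vec d) :
    S.idxD n p = S.cutD n p + inner ℝ S.psi0 p.2 := by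
  simp only [idxD, cutD, theta0, inner_pair, pair_fst, pair_snd, inner_add_left, inner_add_right]
  rw [real_inner_comm p.2 S.psi0]
  ring

lemma y_mem (n i : ℕ) (ω : Ω) : S.y n i ω = 0 ∨ S.y n i ω = 1 := by
  unfold y
  split_ifs <;> simp

lemma abs_eps_le (n i : ℕ) (ω : Ω) : |S.eps n i ω| ≤ 1 := by
  have h1 := Phi_pos (S.idx n i ω)
  have h2 := Phi_lt_one (S.idx n i ω)
  rw [eps, abs_le]
  rcases S.y_mem n i ω with h | h <;> rw [h] <;> constructor <;> linarith

/-- `σ((x_j, V_j, u_j), j ≠ i)`. -/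
abbrev rest (i : ℕ) : MeasurableSpace Ω :=
  ⨆ j ∈ ({i}ᶜ : Set ℕ), MeasurableSpace.comap (S.obs j) inferInstance

lemma comap_obs_le_rest {i j : ℕ} (h : j ≠ i) :
    MeasurableSpace.comap (S.obs j) inferInstance ≤ S.rest i :=
  le_iSup₂_of_le (f := fun j (_ : j ∈ ({i}ᶜ : Set ℕ)) =>
    MeasurableSpace.comap (S.obs j) inferInstance) j h le_rfl

lemma comap_comp_obs_le {E : Type*} [mE : MeasurableSpace E] {φ : (Fin dx → ℝ) × Vec d × ℝ → E}
    (hφ : Measurable φ) (j : ℕ) :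
    MeasurableSpace.comap (fun ω => φ (S.obs j ω)) mE
      ≤ MeasurableSpace.comap (S.obs j) inferInstance := by
  rw [show (fun ω => φ (S.obs j ω)) = φ ∘ S.obs j from rfl, ← MeasurableSpace.comap_comp]
  exact MeasurableSpace.comap_mono hφ.comap_le

lemma comap_xV_le_obs (j : ℕ) :
    MeasurableSpace.comap (fun ω => (S.x j ω, S.V j ω)) inferInstance
      ≤ MeasurableSpace.comap (S.obs j) inferInstance :=
  S.comap_comp_obs_le (φ := fun p => (p.1, p.2.1))
    (measurable_fst.prodMk (measurable_fst.comp measurable_snd)) j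

lemma comap_x_le_obs (j : ℕ) :
    MeasurableSpace.comap (S.x j) inferInstance
      ≤ MeasurableSpace.comap (S.obs j) inferInstance :=
  S.comap_comp_obs_le (φ := fun p => p.1) measurable_fst j

lemma comap_x_le_xV (j : ℕ) :
    MeasurableSpace.comap (S.x j) inferInstance
      ≤ MeasurableSpace.comap (fun ω => (S.x j ω, S.V j ω)) inferInstance := by
  rw [show S.x j = Prod.fst ∘ fun ω => (S.x j ω, S.V j ω) from rfl, ← MeasurableSpace.comap_comp]
  exact MeasurableSpace.comap_mono measurable_fst.comap_le

/-- Observation `i` keeps only its own `x_i`, while the others are enlarged to everything they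
contain. The right side then joins a σ-algebra given which `V_i` is centred with one independent of
observation `i`. -/
lemma sigmaX_le_sup (i : ℕ) :
    S.sigmaX ≤ MeasurableSpace.comap (S.x i) inferInstance ⊔ S.rest i := by
  refine iSup_le fun j => ?_
  by_cases h : j = i
  · subst h
    exact le_sup_left
  · exact ((S.comap_x_le_obs j).trans (S.comap_obs_le_rest h)).trans le_sup_right

lemma sigmaXV_le_sup (i : ℕ) :
    S.sigmaXV ≤
      MeasurableSpace.comap (fun ω => (S.x i ω, S.V i ω)) inferInstance ⊔ S.rest i := by
  refine iSup_le fun j => ?_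
  by_cases h : j = i
  · subst h
    exact le_sup_left
  · exact ((S.comap_xV_le_obs j).trans (S.comap_obs_le_rest h)).trans le_sup_right

lemma sigmaX_le_sigmaXV : S.sigmaX ≤ S.sigmaXV :=
  iSup_mono fun j => S.comap_x_le_xV j

lemma measurable_x_sigmaX (i : ℕ) : Measurable[S.sigmaX] (S.x i) :=
  Measurable.mono (comap_measurable (S.x i))
    (le_iSup (fun i => MeasurableSpace.comap (S.x i) inferInstance) i) le_rfl

lemma measurable_xV_sigmaXV (i : ℕ) : Measurable[S.sigmaXV] fun ω => (S.x i ω, S.V i ω) :=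
  Measurable.mono (comap_measurable fun ω => (S.x i ω, S.V i ω))
    (le_iSup (fun i => MeasurableSpace.comap (fun ω => (S.x i ω, S.V i ω)) inferInstance) i) le_rfl

lemma measurable_obs_rest {i j : ℕ} (h : j ≠ i) : Measurable[S.rest i] (S.obs j) :=
  Measurable.mono (comap_measurable (S.obs j)) (S.comap_obs_le_rest h) le_rfl

end Design

namespace ModelConditions

variable {Ω : Type*} [mΩ : MeasurableSpace Ω] {P : Measure Ω} [IsProbabilityMeasure P]
  {H : Type*} [NormedAddCommGroup H] [InnerProductSpace ℝ H] [CompleteSpace H]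
  [SecondCountableTopology H] [MeasurableSpace H] [BorelSpace H] {dx d : ℕ}
  {S : Design Ω H dx d} {Θ : Set (Vec2 d)} {ρ : ℝ} (hS : ModelConditions P S Θ ρ)
include hS

lemma measurable_obs (i : ℕ) : Measurable (S.obs i) :=
  (hS.meas_x i).prodMk ((hS.meas_V i).prodMk (hS.meas_u i))

lemma comap_obs_le (i : ℕ) : MeasurableSpace.comap (S.obs i) inferInstance ≤ mΩ :=
  (hS.measurable_obs i).comap_le

lemma rest_le (i : ℕ) : S.rest i ≤ mΩ := iSup₂_le fun j _ => hS.comap_obs_le j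

lemma sigmaX_le : S.sigmaX ≤ mΩ := iSup_le fun i => (hS.meas_x i).comap_le

lemma sigmaXV_le : S.sigmaXV ≤ mΩ :=
  iSup_le fun i => ((hS.meas_x i).prodMk (hS.meas_V i)).comap_le

lemma indep_rest (i : ℕ) :
    Indep (MeasurableSpace.comap (S.obs i) inferInstance) (S.rest i) P := by
  have h := indep_iSup_of_disjoint (S := {i}) (T := {i}ᶜ) hS.comap_obs_le hS.indep.iIndep
    disjoint_compl_right
  rw [iSup_singleton] at h
  exact h

lemma iIndepFun_obs {E : Type*} [MeasurableSpace E] {φ : (Fin dx → ℝ) × Vec d × ℝ → E}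
    (hφ : Measurable φ) : iIndepFun (fun i ω => φ (S.obs i ω)) P :=
  hS.indep.comp (fun _ => φ) fun _ => hφ

lemma identDistrib_obs {E : Type*} [MeasurableSpace E] {φ : (Fin dx → ℝ) × Vec d × ℝ → E}
    (hφ : Measurable φ) (i : ℕ) :
    IdentDistrib (fun ω => φ (S.obs i ω)) (fun ω => φ (S.obs 0 ω)) P P :=
  (hS.ident i).comp hφ

lemma measurable_FD : Measurable S.FD :=
  continuous_pair.measurable.comp
    ((S.Pi0.continuous.measurable.comp (hS.meas_Z.comp measurable_fst)).prodMk measurable_snd)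

lemma measurable_DPi0 (n : ℕ) :
    Measurable fun p : (Fin dx → ℝ) × Vec d => S.D n (S.Pi0 (S.Z p.1)) :=
  (S.D n).continuous.measurable.comp
    (S.Pi0.continuous.measurable.comp (hS.meas_Z.comp measurable_fst))

lemma measurable_idxD (n : ℕ) : Measurable (S.idxD n) := by
  have h := continuous_pair.measurable.comp ((hS.measurable_DPi0 n).prodMk measurable_snd)
  exact h.inner measurable_const

lemma measurable_cutD (n : ℕ) : Measurable (S.cutD n) :=
  ((hS.measurable_DPi0 n).add measurable_snd).inner measurable_const

lemma measurable_yD (n : ℕ) : Measurable (S.yD n) :=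
  Measurable.ite (measurableSet_le measurable_snd ((hS.measurable_cutD n).comp measurable_fst))
    measurable_const measurable_const

/-- The residual as a function of the observation is measurable. -/
lemma measurable_epsD (n : ℕ) : Measurable fun p : (Fin dx → ℝ) × Vec d × ℝ =>
    S.yD n ((p.1, p.2.1), p.2.2) - Phi (S.idxD n (p.1, p.2.1)) := by
  have h1 : Measurable fun p : (Fin dx → ℝ) × Vec d × ℝ => (p.1, p.2.1) :=
    measurable_fst.prodMk (measurable_fst.comp measurable_snd)
  exact ((hS.measurable_yD n).comp (h1.prodMk (measurable_snd.comp measurable_snd))).sub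
    (continuous_Phi.measurable.comp ((hS.measurable_idxD n).comp h1))

omit hS in
lemma eps_eq (n i : ℕ) (ω : Ω) : S.eps n i ω =
    (fun p : (Fin dx → ℝ) × Vec d × ℝ => S.yD n ((p.1, p.2.1), p.2.2)
      - Phi (S.idxD n (p.1, p.2.1))) (S.obs i ω) := by
  rw [Design.eps, Design.idx_eq, Design.y_eq]
  rfl

lemma measurable_eps (n i : ℕ) : Measurable (S.eps n i) := by
  have : S.eps n i = _ := funext (eps_eq n i)
  rw [this]
  exact (hS.measurable_epsD n).comp (hS.measurable_obs i)

lemma measurable_eps_rest (n : ℕ) {i j : ℕ} (h : j ≠ i) : Measurable[S.rest i] (S.eps n j) := by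
  have : S.eps n j = _ := funext (eps_eq n j)
  rw [this]
  exact (hS.measurable_epsD n).comp (S.measurable_obs_rest h)

lemma measurable_eps_comap (n i : ℕ) :
    Measurable[MeasurableSpace.comap (S.obs i) inferInstance] (S.eps n i) := by
  have : S.eps n i = _ := funext (eps_eq n i)
  rw [this]
  exact (hS.measurable_epsD n).comp (comap_measurable (S.obs i))

lemma integrable_eps (n i : ℕ) : Integrable (S.eps n i) P :=
  (integrable_const (1 : ℝ)).mono' (hS.measurable_eps n i).aestronglyMeasurable
    (Eventually.of_forall (S.abs_eps_le n i))

/-- Given `(x_i, V_i)` the error `u_i` is normal with mean `-ψ₀'V_i`. The probability of lying below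
the threshold `Y_{2i}'β₀` is thus `Φ(Y_{2i}'β₀ + ψ₀'V_i)`, and the argument is the index. -/
lemma condExp_eps (n i : ℕ) :
    P[S.eps n i | MeasurableSpace.comap (fun ω => (S.x i ω, S.V i ω)) inferInstance] =ᵐ[P] 0 := by
  set X : Ω → (Fin dx → ℝ) × Vec d := fun ω => (S.x i ω, S.V i ω) with hX
  have hXm : Measurable X := (hS.meas_x i).prodMk (hS.meas_V i)
  have hym : Measurable fun ω => S.yD n (X ω, S.u i ω) :=
    (hS.measurable_yD n).comp (hXm.prodMk (hS.meas_u i))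
  have hyi : Integrable (fun ω => S.yD n (X ω, S.u i ω)) P := by
    refine (integrable_const (1 : ℝ)).mono' hym.aestronglyMeasurable (Eventually.of_forall ?_)
    intro ω
    unfold Design.yD
    split_ifs <;> simp
  have h1 := condExp_prod_ae_eq_integral_condDistrib hXm (hS.meas_u i).aemeasurable
    (hS.measurable_yD n).stronglyMeasurable hyi
  have h2 := ae_of_ae_map hXm.aemeasurable (hS.law_u i)
  have hPm : Measurable[MeasurableSpace.comap X inferInstance] fun ω => Phi (S.idx n i ω) := by
    have : (fun ω => Phi (S.idx n i ω)) = (fun p => Phi (S.idxD n p)) ∘ X :=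
      funext fun ω => by rw [Design.idx_eq]; rfl
    rw [this]
    exact (continuous_Phi.measurable.comp (hS.measurable_idxD n)).comp (comap_measurable X)
  have hPi : Integrable (fun ω => Phi (S.idx n i ω)) P := by
    refine (integrable_const (1 : ℝ)).mono' (hPm.mono hXm.comap_le le_rfl).aestronglyMeasurable
      (Eventually.of_forall fun ω => ?_)
    rw [Real.norm_eq_abs, abs_of_pos (Phi_pos _)]
    exact (Phi_lt_one _).le
  have h3 : P[S.eps n i | MeasurableSpace.comap X inferInstance] =ᵐ[P]
      P[fun ω => S.yD n (X ω, S.u i ω) | MeasurableSpace.comap X inferInstance]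
        - P[fun ω => Phi (S.idx n i ω) | MeasurableSpace.comap X inferInstance] :=
    condExp_sub hyi hPi _
  rw [condExp_of_stronglyMeasurable hXm.comap_le hPm.stronglyMeasurable hPi] at h3
  filter_upwards [h1, h2, h3] with ω h1 h2 h3
  rw [h3, Pi.sub_apply, h1, h2]
  have h4 : (fun u => S.yD n (X ω, u)) = (Set.Iic (S.cutD n (X ω))).indicator fun _ => (1 : ℝ) := by
    funext u
    by_cases h : u ≤ S.cutD n (X ω) <;> simp [Design.yD, h]
  rw [h4, integral_indicator_const _ measurableSet_Iic, gaussianReal_one_Iic, Design.idx_eq,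
    Design.idxD_eq]
  simp [hX]

/-- The multiplier may use the responses of the other observations, which are independent of
observation `i`. This is what makes products of two different residuals integrate to zero. -/
lemma integral_eps_mul_eq_zero (n i : ℕ) {G : Ω → ℝ}
    (hG : StronglyMeasurable[MeasurableSpace.comap (fun ω => (S.x i ω, S.V i ω)) inferInstance
      ⊔ S.rest i] G) (hi : Integrable (fun ω => S.eps n i ω * G ω) P) :
    ∫ ω, S.eps n i ω * G ω ∂P = 0 :=
  integral_mul_eq_zero_of_condExp_eq_zero (S.comap_xV_le_obs i) (hS.comap_obs_le i) (hS.rest_le i)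
    (hS.indep_rest i) (hS.measurable_eps_comap n i).stronglyMeasurable (hS.integrable_eps n i)
    (hS.condExp_eps n i) hG hi

lemma integrable_V (i : ℕ) : Integrable (S.V i) P := (hS.moment_V i).integrable (by norm_num)

lemma integral_V_mul_eq_zero (i : ℕ) (v : Vec d) {G : Ω → ℝ}
    (hG : StronglyMeasurable[MeasurableSpace.comap (S.x i) inferInstance ⊔ S.rest i] G)
    (hi : Integrable (fun ω => inner ℝ v (S.V i ω) * G ω) P) :
    ∫ ω, inner ℝ v (S.V i ω) * G ω ∂P = 0 := by
  refine integral_mul_eq_zero_of_condExp_eq_zero (S.comap_x_le_obs i) (hS.comap_obs_le i)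
    (hS.rest_le i) (hS.indep_rest i) ?_ ?_ ?_ hG hi
  · have h1 : Measurable fun p : (Fin dx → ℝ) × Vec d × ℝ => inner ℝ v p.2.1 :=
      measurable_const.inner (measurable_fst.comp measurable_snd)
    exact (h1.comp (comap_measurable (S.obs i))).stronglyMeasurable
  · exact (hS.integrable_V i).const_inner v
  · have h1 := (innerSL ℝ v).comp_condExp_comm (hS.integrable_V i)
      (m := MeasurableSpace.comap (S.x i) inferInstance)
    filter_upwards [h1, hS.mean_V i] with ω h1 h2
    simp only [Function.comp_apply, h2, Pi.zero_apply, map_zero] at h1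
    exact h1.symm

/-- Second moment of a sum of residuals weighted by functions of `(x, V)`. -/
lemma integral_norm_sq_sum_eps_smul_le {E : Type*} [NormedAddCommGroup E] [InnerProductSpace ℝ E]
    (n m : ℕ) {a : ℕ → Ω → E} (ha : ∀ i < m, StronglyMeasurable[S.sigmaXV] (a i))
    (hL : ∀ i < m, MemLp (a i) 2 P) :
    (∀ i < m, MemLp (fun ω => S.eps n i ω • a i ω) 2 P) ∧
    ∫ ω, ‖∑ i ∈ Finset.range m, S.eps n i ω • a i ω‖ ^ 2 ∂P
      ≤ ∑ i ∈ Finset.range m, ∫ ω, ‖a i ω‖ ^ 2 ∂P := by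
  have hle : ∀ i ω, ‖S.eps n i ω • a i ω‖ ≤ ‖a i ω‖ := fun i ω => by
    rw [norm_smul]
    exact mul_le_of_le_one_left (norm_nonneg _) (S.abs_eps_le n i ω)
  have hmem : ∀ i < m, MemLp (fun ω => S.eps n i ω • a i ω) 2 P := fun i hi =>
    (hL i hi).mono ((hS.measurable_eps n i).aestronglyMeasurable.smul (hL i hi).1)
      (Eventually.of_forall (hle i))
  refine ⟨hmem, ?_⟩
  rw [integral_norm_sq_sum_of_orthogonal m hmem]
  · refine Finset.sum_le_sum fun i hi => ?_
    have hi' := Finset.mem_range.1 hi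
    refine integral_mono ((hmem i hi').integrable_norm_pow two_ne_zero)
      ((hL i hi').integrable_norm_pow two_ne_zero) fun ω => ?_
    simp only
    gcongr
    exact hle i ω
  · intro i hi j hj hij
    -- For `i ≠ j` the residual `ε_j` and both weights form an admissible multiplier for `ε_i`, so
    -- the cross term vanishes.
    have h1 : ∀ ω, inner ℝ (S.eps n i ω • a i ω) (S.eps n j ω • a j ω) =
        S.eps n i ω * (S.eps n j ω * inner ℝ (a i ω) (a j ω)) := fun ω => by
      rw [inner_smul_left, inner_smul_right]
      simp
    have h2 := (hmem i hi).integrable_inner' (hmem j hj)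
    simp_rw [h1] at h2 ⊢
    refine hS.integral_eps_mul_eq_zero n i ?_ h2
    refine StronglyMeasurable.mul ?_ ?_
    · exact (hS.measurable_eps_rest n hij.symm).stronglyMeasurable.mono le_sup_right
    · exact ((ha i hi).inner (ha j hj)).mono (S.sigmaXV_le_sup i)

/-- Second moment of a sum of first-stage errors weighted by functions of `x`. -/
lemma integral_sq_sum_V_mul_le (v : Vec d) (m : ℕ) {C : ℝ}
    (hC : ∀ i, ∀ᵐ ω ∂P, |inner ℝ v (S.V i ω)| ≤ C) {a : ℕ → Ω → ℝ}
    (ha : ∀ i < m, StronglyMeasurable[S.sigmaX] (a i)) (hL : ∀ i < m, MemLp (a i) 2 P) :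
    MemLp (fun ω => ∑ i ∈ Finset.range m, inner ℝ v (S.V i ω) * a i ω) 2 P ∧
    ∫ ω, (∑ i ∈ Finset.range m, inner ℝ v (S.V i ω) * a i ω) ^ 2 ∂P
      ≤ C ^ 2 * ∑ i ∈ Finset.range m, ∫ ω, a i ω ^ 2 ∂P := by
  have hvm : ∀ i, Measurable fun ω => inner ℝ v (S.V i ω) := fun i =>
    measurable_const.inner (hS.meas_V i)
  have hle : ∀ i, ∀ᵐ ω ∂P, ‖inner ℝ v (S.V i ω) * a i ω‖ ≤ C * ‖a i ω‖ := fun i => by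
    filter_upwards [hC i] with ω h
    rw [norm_mul]
    gcongr
    exact h
  have hmem : ∀ i < m, MemLp (fun ω => inner ℝ v (S.V i ω) * a i ω) 2 P := fun i hi =>
    (hL i hi).of_le_mul ((hvm i).aestronglyMeasurable.mul (hL i hi).1) (hle i)
  refine ⟨memLp_finsetSum _ fun i hi => hmem i (Finset.mem_range.1 hi), ?_⟩
  have key := integral_norm_sq_sum_of_orthogonal m hmem (μ := P) (E := ℝ) ?_
  · simp only [Real.norm_eq_abs, sq_abs] at key
    rw [key, Finset.mul_sum]
    refine Finset.sum_le_sum fun i hi => ?_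
    have hi' := Finset.mem_range.1 hi
    rw [← integral_const_mul]
    have i1 := (hmem i hi').integrable_norm_pow two_ne_zero
    have i2 := (hL i hi').integrable_norm_pow two_ne_zero
    simp only [Real.norm_eq_abs, sq_abs] at i1 i2
    refine integral_mono_ae i1 (i2.const_mul _) ?_
    filter_upwards [hle i] with ω h
    rw [← sq_abs, ← sq_abs (a i ω), ← mul_pow]
    exact pow_le_pow_left₀ (abs_nonneg _) h 2
  · intro i hi j hj hij
    have h1 : ∀ ω, inner ℝ (inner ℝ v (S.V i ω) * a i ω) (inner ℝ v (S.V j ω) * a j ω) =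
        inner ℝ v (S.V i ω) * (inner ℝ v (S.V j ω) * (a i ω * a j ω)) := fun ω => by
      simp only [RCLike.inner_apply, conj_trivial]
      ring
    have h2 := (hmem i hi).integrable_inner' (hmem j hj)
    simp_rw [h1] at h2 ⊢
    refine hS.integral_V_mul_eq_zero i v ?_ h2
    refine StronglyMeasurable.mul ?_ ?_
    · have h3 : Measurable fun p : (Fin dx → ℝ) × Vec d × ℝ => inner ℝ v p.2.1 :=
        measurable_const.inner (measurable_fst.comp measurable_snd)
      exact (h3.comp (S.measurable_obs_rest hij.symm)).stronglyMeasurable.mono le_sup_right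
    · exact ((ha i hi).mul (ha j hj)).mono (S.sigmaX_le_sup i)

end ModelConditions

/-! ### Residual of the regularized inverse -/

section Residual

/-- The spectral residual `1 - q` of the regularization (equal to one at zero). -/
noncomputable def resid (q : ℝ → ℝ → ℝ) (α κ : ℝ) : ℝ := 1 - κ * (κ⁻¹ * q κ α)

lemma resid_mem {q : ℝ → ℝ → ℝ} {ρ : ℝ} (hq : IsRegularization q ρ) {κ α : ℝ} (hκ : 0 ≤ κ)
    (hα : 0 < α) : resid q α κ ∈ Set.Icc (0 : ℝ) 1 := by
  unfold resid
  rcases hκ.eq_or_lt with rfl | h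
  · simp
  · rw [mul_inv_cancel_left₀ h.ne']
    have := hq.mem_unit κ α hκ hα
    exact ⟨by linarith [this.2], by linarith [this.1]⟩

lemma abs_resid_le {q : ℝ → ℝ → ℝ} {ρ : ℝ} (hq : IsRegularization q ρ) {κ α : ℝ} (hκ : 0 ≤ κ)
    (hα : 0 < α) : |resid q α κ| ≤ 1 := by
  have h := resid_mem hq hκ hα
  rw [abs_of_nonneg h.1]
  exact h.2

/-- The constants of a regularization scheme, with a smoothness index `s` not above `ρ`. -/
lemma IsRegularization.exists_consts {q : ℝ → ℝ → ℝ} {ρ : ℝ} (hq : IsRegularization q ρ) :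
    ∃ s C : ℝ, 3 / 2 ≤ s ∧ s ≤ ρ ∧ 0 < C ∧
      (∀ κ α, 0 ≤ κ → 0 < α → α ≤ 1 → |κ⁻¹ * q κ α| ≤ C * (Real.sqrt α)⁻¹) ∧
      (∀ κ α, 0 ≤ κ → 0 < α → α ≤ 1 → |Real.sqrt κ * (κ⁻¹ * q κ α)| ^ 2 ≤ C * (Real.sqrt α)⁻¹) ∧
      (∀ κ α, 0 ≤ κ → 0 < α → α ≤ 1 → |Real.sqrt κ * resid q α κ * κ ^ s| ≤ C * α) := by
  obtain ⟨c1, h1⟩ := hq.bound_inv_sqrt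
  obtain ⟨r, c2, hr1, hr2, h2⟩ := hq.qualification
  have hinv : ∀ κ α, 0 ≤ κ → 0 < α → α ≤ 1 → 0 ≤ κ⁻¹ * q κ α ∧
      κ⁻¹ * q κ α ≤ |c1| * (Real.sqrt α)⁻¹ := by
    intro κ α hκ hα hα1
    have hs := Real.sqrt_pos.2 hα
    have hq0 := (hq.mem_unit κ α hκ hα).1
    refine ⟨by positivity, ?_⟩
    rcases hκ.eq_or_lt with rfl | h
    · simp only [inv_zero, zero_mul]
      positivity
    · rw [← div_eq_mul_inv, le_div_iff₀ hs]
      have := (h1 κ α h hα hα1).trans (le_abs_self c1)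
      linarith [this, mul_comm (Real.sqrt α) (κ⁻¹ * q κ α), mul_assoc (Real.sqrt α) κ⁻¹ (q κ α)]
  -- The exponent `s = 2r - 1/2` turns `√κ κ^s` into the `κ^{2r}` of the qualification. The bounds
  -- `1 ≤ r ≤ (2ρ+1)/4` translate into `3/2 ≤ s ≤ ρ`.
  refine ⟨2 * r - 1 / 2, |c1| + |c2| + 1, by linarith, by linarith, by positivity, ?_, ?_, ?_⟩
  · intro κ α hκ hα hα1
    obtain ⟨h3, h4⟩ := hinv κ α hκ hα hα1
    rw [abs_of_nonneg h3]
    refine h4.trans ?_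
    gcongr
    have := abs_nonneg c2
    linarith
  · intro κ α hκ hα hα1
    obtain ⟨h3, h4⟩ := hinv κ α hκ hα hα1
    have hq1 := hq.mem_unit κ α hκ hα
    have h5 : κ * (κ⁻¹ * q κ α) ≤ 1 := by
      rcases hκ.eq_or_lt with rfl | h
      · simp
      · rw [mul_inv_cancel_left₀ h.ne']
        exact hq1.2
    rw [sq_abs, mul_pow, Real.sq_sqrt hκ]
    -- One of the two factors is used only through `q ≤ 1`. The variance therefore pays `α^{-1/2}`
    -- once instead of twice.
    calc κ * (κ⁻¹ * q κ α) ^ 2 = (κ * (κ⁻¹ * q κ α)) * (κ⁻¹ * q κ α) := by ring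
      _ ≤ 1 * (|c1| * (Real.sqrt α)⁻¹) := mul_le_mul h5 h4 h3 one_pos.le
      _ ≤ _ := by
        rw [one_mul]
        gcongr
        have := abs_nonneg c2
        linarith
  · intro κ α hκ hα hα1
    have hr0 := resid_mem hq hκ hα
    rcases hκ.eq_or_lt with rfl | h
    · simp only [Real.sqrt_zero, zero_mul, abs_zero]
      positivity
    · have e1 : Real.sqrt κ * resid q α κ * κ ^ (2 * r - 1 / 2) = κ ^ (2 * r) * (1 - q κ α) := by
        rw [resid, mul_inv_cancel_left₀ h.ne', Real.sqrt_eq_rpow, mul_right_comm,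
          ← Real.rpow_add h]
        ring_nf
      have e2 : 0 ≤ κ ^ (2 * r) * (1 - q κ α) := by
        have := (hq.mem_unit κ α hκ hα).2
        have h3 := Real.rpow_nonneg hκ (2 * r)
        exact mul_nonneg h3 (by linarith)
      rw [e1, abs_of_nonneg e2]
      refine (h2 κ α hκ hα hα1).trans ?_
      -- The qualification saturates at one, which is the source of the `α²` in the squared bias.
      rw [min_eq_right hr1, Real.rpow_one]
      have := le_abs_self c2
      have := abs_nonneg c1
      gcongr
      linarith

lemma abs_rpow_sub_rpow_le {s M a b : ℝ} (hs : 1 ≤ s) (ha : 0 ≤ a) (hb : 0 ≤ b) (haM : a ≤ M)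
    (hbM : b ≤ M) : |a ^ s - b ^ s| ≤ s * M ^ (s - 1) * |a - b| := by
  have h := (convex_Icc (0 : ℝ) M).norm_image_sub_le_of_norm_hasDerivWithin_le
    (f := fun x => x ^ s) (f' := fun x => s * x ^ (s - 1)) (C := s * M ^ (s - 1))
    (fun x _ => (Real.hasDerivAt_rpow_const (Or.inr hs)).hasDerivWithinAt)
    (fun x hx => by
      have h1 := Real.rpow_nonneg hx.1 (s - 1)
      rw [Real.norm_eq_abs, abs_of_nonneg (by positivity)]
      have := Real.rpow_le_rpow hx.1 hx.2 (by linarith : 0 ≤ s - 1)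
      gcongr)
    (Set.mem_Icc.2 ⟨hb, hbM⟩) (Set.mem_Icc.2 ⟨ha, haM⟩)
  simpa [Real.norm_eq_abs] using h

variable {H : Type*} [NormedAddCommGroup H] [InnerProductSpace ℝ H] [CompleteSpace H]
  {T K : H →L[ℝ] H} {s₀ : Finset ℝ} {q : ℝ → ℝ → ℝ} {ρ α : ℝ}

lemma IsFiniteSpec.sub_apply_regInv (hs : IsFiniteSpec T s₀) (v : H) :
    v - T (regInv q α T v) = fc (resid q α) T v := by
  rw [regInv_eq_fc, ← hs.fc_id, hs.fc_fc]
  have : resid q α = fun κ => 1 - κ * (κ⁻¹ * q κ α) := rfl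
  rw [this, hs.fc_sub (fun _ => 1) fun κ => κ * (κ⁻¹ * q κ α), hs.fc_const, one_smul]

lemma IsFiniteSpec.norm_regInv_le (hs : IsFiniteSpec T s₀) (hpos : ∀ v, 0 ≤ inner ℝ (T v) v)
    {C : ℝ} (hC : ∀ κ, 0 ≤ κ → |κ⁻¹ * q κ α| ≤ C) (v : H) : ‖regInv q α T v‖ ≤ C * ‖v‖ := by
  rw [regInv_eq_fc]
  exact hs.norm_fc_le hpos (fun κ h _ => hC κ h) ((abs_nonneg _).trans (hC 0 le_rfl)) v

lemma eigenvalue_mem (hpos : ∀ v, 0 ≤ inner ℝ (K v) v) {κ : ℝ} {v : H} (h : eigProj K κ v ≠ 0) :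
    0 ≤ κ ∧ κ ≤ ‖K‖ := by
  have hn : 0 < ‖eigProj K κ v‖ := norm_pos_iff.2 h
  have h1 := hpos (eigProj K κ v)
  rw [apply_eigProj, inner_smul_left, real_inner_self_eq_norm_sq] at h1
  have h2 : 0 ≤ κ := by
    simp only [conj_trivial] at h1
    exact nonneg_of_mul_nonneg_left h1 (by positivity)
  refine ⟨h2, ?_⟩
  have := K.le_opNorm (eigProj K κ v)
  rw [apply_eigProj, norm_smul, Real.norm_eq_abs, abs_of_nonneg h2] at this
  exact le_of_mul_le_mul_right this hn

/-- The component `κ^{-s} P_κ π` of the source element of `π`. -/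
noncomputable def src (K : H →L[ℝ] H) (s : ℝ) (π : H) (κ : ℝ) : H := κ ^ (-s) • eigProj K κ π

lemma apply_src (K : H →L[ℝ] H) (s : ℝ) (π : H) (κ : ℝ) : K (src K s π κ) = κ • src K s π κ := by
  rw [src, map_smul, apply_eigProj, smul_comm]

/-- Bias of the regularized inverse for a vector in the range of `K^s`, in terms of the
perturbation `K - T`. -/
lemma IsFiniteSpec.norm_sqrt_resid_le (hs : IsFiniteSpec T s₀) (hpos : ∀ v, 0 ≤ inner ℝ (T v) v)
    (hposK : ∀ v, 0 ≤ inner ℝ (K v) v) (hsymmK : (K : H →ₗ[ℝ] H).IsSymmetric)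
    (hq : IsRegularization q ρ) (hα : 0 < α)
    {s C M W : ℝ} (hs1 : 1 ≤ s) (hM : 0 ≤ M) (hTM : ‖T‖ ≤ M) (hKM : ‖K‖ ≤ M)
    (hC : ∀ κ, 0 ≤ κ → |Real.sqrt κ * resid q α κ * κ ^ s| ≤ C)
    {π : H} (hker : eigProj K 0 π = 0) (t : Finset ℝ)
    (hW : ∑ κ ∈ t, ‖src K s π κ‖ ^ 2 ≤ W ^ 2) (hW0 : 0 ≤ W) :
    ‖fc (fun κ => Real.sqrt κ * resid q α κ) T π‖ ≤
      C * W + Real.sqrt M * (s * M ^ (s - 1) * ∑ κ ∈ t, ‖(K - T) (src K s π κ)‖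
        + ‖π - ∑ κ ∈ t, eigProj K κ π‖) := by
  set f : ℝ → ℝ := fun κ => κ ^ s
  set w : H := ∑ κ ∈ t, src K s π κ with hw
  set g : ℝ → ℝ := fun κ => Real.sqrt κ * resid q α κ
  have hC0 : 0 ≤ C := (abs_nonneg _).trans (hC 0 le_rfl)
  have hL0 : 0 ≤ s * M ^ (s - 1) := by positivity
  have hwn : ‖w‖ ≤ W := by
    refine (sq_le_sq₀ (norm_nonneg _) hW0).1 ?_
    have := norm_sum_smul_eigProj_sq hsymmK t (fun κ => κ ^ (-s)) π
    change ‖w‖ ^ 2 = _ at this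
    rw [this]
    refine le_trans (le_of_eq ?_) hW
    refine Finset.sum_congr rfl fun κ _ => ?_
    rw [src, norm_smul, mul_pow, Real.norm_eq_abs, sq_abs]
  have hgn : ∀ v, ‖fc g T v‖ ≤ Real.sqrt M * ‖v‖ := fun v => by
    refine hs.norm_fc_le hpos (fun κ h1 h2 => ?_) (Real.sqrt_nonneg _) v
    rw [abs_mul, abs_of_nonneg (Real.sqrt_nonneg _)]
    calc Real.sqrt κ * |resid q α κ| ≤ Real.sqrt κ * 1 := by
          gcongr
          exact abs_resid_le hq h1 hα
      _ ≤ Real.sqrt M := by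
          rw [mul_one]
          exact Real.sqrt_le_sqrt (h2.trans hTM)
  have h1 : ‖fc g T (fc f T w)‖ ≤ C * W := by
    rw [hs.fc_fc]
    refine (hs.norm_fc_le hpos (fun κ h1 _ => hC κ h1) hC0 w).trans ?_
    gcongr
  have h2 : ‖(∑ κ ∈ t, eigProj K κ π) - fc f T w‖ ≤
      s * M ^ (s - 1) * ∑ κ ∈ t, ‖(K - T) (src K s π κ)‖ := by
    -- Each source component is an eigenvector of `K`, on which `K^s` is multiplication by `κ^s`.
    -- Comparing it with `T^s` needs only the scalar Lipschitz bound, at the price of a sum of norms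
    -- over the eigenvalues.
    rw [hw, map_sum, ← Finset.sum_sub_distrib, Finset.mul_sum]
    refine (norm_sum_le _ _).trans (Finset.sum_le_sum fun κ _ => ?_)
    by_cases h0 : eigProj K κ π = 0
    · simp [src, h0]
    obtain ⟨k1, k2⟩ := eigenvalue_mem hposK h0
    have k3 : 0 < κ := lt_of_le_of_ne k1 fun h => h0 (by rw [← h]; exact hker)
    have e1 : eigProj K κ π = f κ • src K s π κ := by
      simp only [f, src, smul_smul]
      rw [← Real.rpow_add k3]
      simp
    have e2 : (K - T) (src K s π κ) = κ • src K s π κ - T (src K s π κ) := by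
      rw [_root_.sub_apply, apply_src]
    rw [e1, e2]
    exact hs.norm_smul_sub_fc_le hpos hL0
      (fun κ' h3 h4 => abs_rpow_sub_rpow_le hs1 k1 h3 (k2.trans hKM) (h4.trans hTM)) _
  -- `π` is written as `T^s w`, on which the qualification acts, plus the error of replacing `K^s`
  -- by `T^s`, plus the truncation error of the eigenexpansion.
  have h3 : fc g T π = fc g T (fc f T w) + fc g T ((∑ κ ∈ t, eigProj K κ π - fc f T w)
      + (π - ∑ κ ∈ t, eigProj K κ π)) := by
    rw [← map_add]
    congr 1
    abel
  rw [h3]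
  refine (norm_add_le _ _).trans (add_le_add h1 ((hgn _).trans ?_))
  gcongr
  exact (norm_add_le _ _).trans (add_le_add_left h2 _)

end Residual

/-! ### Covariance operators -/

section Tensor

variable {H : Type*} [NormedAddCommGroup H] [InnerProductSpace ℝ H]
  {E : Type*} [NormedAddCommGroup E] [InnerProductSpace ℝ E]

lemma tensor_apply (a : H) (b : E) (h : H) : tensor a b h = (inner ℝ a h : ℝ) • b := rfl

lemma norm_tensor_le (a : H) (b : E) : ‖tensor a b‖ ≤ ‖a‖ * ‖b‖ := by
  refine ContinuousLinearMap.opNorm_le_bound _ (by positivity) fun h => ?_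
  rw [tensor_apply, norm_smul, Real.norm_eq_abs]
  have := abs_real_inner_le_norm a h
  calc |inner ℝ a h| * ‖b‖ ≤ ‖a‖ * ‖h‖ * ‖b‖ := by gcongr
    _ = _ := by ring

lemma continuous_tensor_self : Continuous fun z : H => tensor z z := by
  unfold tensor
  fun_prop

lemma isCompactOperator_tensor (a : H) (b : E) : IsCompactOperator (tensor a b) := by
  have h : IsCompactOperator (ContinuousLinearMap.toSpanSingleton ℝ b) :=
    isCompactOperator_of_locallyCompactSpace_rng _
  exact h.comp_clm (innerSL ℝ a)

end Tensor

namespace Design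

variable {Ω : Type*} {H : Type*} [NormedAddCommGroup H] [InnerProductSpace ℝ H] {dx d : ℕ}
  (S : Design Ω H dx d)

/-- The trace of the sample covariance operator. -/
noncomputable def trN (n : ℕ) (ω : Ω) : ℝ := (n : ℝ)⁻¹ * ∑ i ∈ Finset.range n, ‖S.Zi i ω‖ ^ 2

lemma trN_nonneg (n : ℕ) (ω : Ω) : 0 ≤ S.trN n ω := by
  unfold trN
  positivity

lemma covN_apply (n : ℕ) (ω : Ω) (v : H) : S.covN n ω v =
    (n : ℝ)⁻¹ • ∑ i ∈ Finset.range n, (inner ℝ (S.Zi i ω) v : ℝ) • S.Zi i ω := by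
  simp only [covN, _root_.smul_apply, _root_.sum_apply, tensor_apply]

lemma inner_covN (n : ℕ) (ω : Ω) (u v : H) : inner ℝ u (S.covN n ω v) =
    (n : ℝ)⁻¹ * ∑ i ∈ Finset.range n, (inner ℝ (S.Zi i ω) u : ℝ) * inner ℝ (S.Zi i ω) v := by
  rw [covN_apply, inner_smul_right, inner_sum]
  congr 1
  refine Finset.sum_congr rfl fun i _ => ?_
  rw [inner_smul_right, real_inner_comm u, mul_comm]

lemma covN_symm (n : ℕ) (ω : Ω) : (S.covN n ω : H →ₗ[ℝ] H).IsSymmetric := by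
  intro u v
  simp only [ContinuousLinearMap.coe_coe]
  rw [real_inner_comm, inner_covN, inner_covN]
  simp only [mul_comm]

lemma covN_nonneg (n : ℕ) (ω : Ω) (v : H) : 0 ≤ inner ℝ (S.covN n ω v) v := by
  rw [real_inner_comm, inner_covN]
  simp only [← sq]
  positivity

lemma norm_covN_le (n : ℕ) (ω : Ω) : ‖S.covN n ω‖ ≤ S.trN n ω := by
  unfold covN trN
  rw [norm_smul, norm_inv, Real.norm_natCast]
  gcongr
  refine (norm_sum_le _ _).trans (Finset.sum_le_sum fun i _ => ?_)
  rw [sq]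
  exact norm_tensor_le _ _

lemma exists_spec_covN [CompleteSpace H] (n : ℕ) (ω : Ω) : ∃ s, IsFiniteSpec (S.covN n ω) s := by
  let W := Submodule.span ℝ ((fun i => S.Zi i ω) '' (Finset.range n : Set ℕ))
  have : FiniteDimensional ℝ W :=
    FiniteDimensional.span_of_finite ℝ ((Finset.finite_toSet _).image _)
  refine exists_isFiniteSpec (S.covN_symm n ω) W fun v => ?_
  rw [covN_apply]
  exact W.smul_mem _ (W.sum_mem fun i hi => W.smul_mem _ (Submodule.subset_span ⟨i, hi, rfl⟩))

end Design

namespace ModelConditions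

variable {Ω : Type*} [mΩ : MeasurableSpace Ω] {P : Measure Ω} [IsProbabilityMeasure P]
  {H : Type*} [NormedAddCommGroup H] [InnerProductSpace ℝ H] [CompleteSpace H]
  [SecondCountableTopology H] [MeasurableSpace H] [BorelSpace H] {dx d : ℕ}
  {S : Design Ω H dx d} {Θ : Set (Vec2 d)} {ρ : ℝ} (hS : ModelConditions P S Θ ρ)
include hS

lemma measurable_Z_sigmaX (i : ℕ) : Measurable[S.sigmaX] (S.Zi i) :=
  hS.meas_Z.comp (S.measurable_x_sigmaX i)

lemma measurable_Z (i : ℕ) : Measurable (S.Zi i) := hS.meas_Z.comp (hS.meas_x i)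

lemma integrable_norm_Z_sq (i : ℕ) : Integrable (fun ω => ‖S.Zi i ω‖ ^ 2) P :=
  MemLp.integrable_norm_pow (p := 2)
    (by exact_mod_cast (hS.moment_Z i).mono_exponent (by norm_num)) (by norm_num)

lemma integrable_norm_Z_pow_four (i : ℕ) : Integrable (fun ω => ‖S.Zi i ω‖ ^ 4) P :=
  MemLp.integrable_norm_pow (p := 4) (by exact_mod_cast hS.moment_Z i) (by norm_num)

lemma memLp_Z (i : ℕ) : MemLp (S.Zi i) 2 P := (hS.moment_Z i).mono_exponent (by norm_num)

lemma integrable_Z (i : ℕ) : Integrable (S.Zi i) P := (hS.memLp_Z i).integrable (by norm_num)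

lemma integrable_tensor (i : ℕ) : Integrable (fun ω => tensor (S.Zi i ω) (S.Zi i ω)) P := by
  refine (hS.integrable_norm_Z_sq i).mono'
    (continuous_tensor_self.comp_aestronglyMeasurable (hS.moment_Z i).1)
    (Eventually.of_forall fun ω => ?_)
  rw [sq]
  exact norm_tensor_le _ _

lemma cov_apply (v : H) : S.cov P v = ∫ ω, (inner ℝ (S.Zi 0 ω) v : ℝ) • S.Zi 0 ω ∂P := by
  rw [Design.cov, ContinuousLinearMap.integral_apply (hS.integrable_tensor 0)]
  rfl

lemma integrable_inner_smul_Z (i : ℕ) (v : H) :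
    Integrable (fun ω => (inner ℝ (S.Zi i ω) v : ℝ) • S.Zi i ω) P :=
  (hS.integrable_tensor i).apply_continuousLinearMap v

lemma inner_cov (u v : H) : inner ℝ u (S.cov P v) =
    ∫ ω, (inner ℝ (S.Zi 0 ω) u : ℝ) * inner ℝ (S.Zi 0 ω) v ∂P := by
  rw [hS.cov_apply, ← integral_inner (hS.integrable_inner_smul_Z 0 v)]
  refine integral_congr_ae (Eventually.of_forall fun ω => ?_)
  simp only
  rw [inner_smul_right, real_inner_comm u, mul_comm]

lemma cov_symm : (S.cov P : H →ₗ[ℝ] H).IsSymmetric := by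
  intro u v
  simp only [ContinuousLinearMap.coe_coe]
  rw [real_inner_comm, hS.inner_cov, hS.inner_cov]
  simp only [mul_comm]

lemma cov_nonneg (v : H) : 0 ≤ inner ℝ (S.cov P v) v := by
  rw [real_inner_comm, hS.inner_cov]
  refine integral_nonneg fun ω => ?_
  simp only [← sq, Pi.zero_apply]
  positivity

/-- Compact operators form a closed convex set that contains the rank-one integrand, so the Bochner
mean stays in it. -/
lemma isCompactOperator_cov : IsCompactOperator (S.cov P) := by
  have h := (compactOperator (RingHom.id ℝ) H H).convex.integral_mem (μ := P)
    (isClosed_setOfPred_isCompactOperator (σ₁₂ := RingHom.id ℝ) (M₁ := H) (M₂ := H))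
    (Eventually.of_forall fun ω => isCompactOperator_tensor (S.Zi 0 ω) (S.Zi 0 ω))
    (hS.integrable_tensor 0)
  exact h

lemma adjoint_eq_sum (w : Vec d) :
    S.Pi0.adjoint w = ∑ l, w l • S.Pi0.adjoint (EuclideanSpace.single l 1) := by
  conv_lhs => rw [← (EuclideanSpace.basisFun (Fin d) ℝ).sum_repr w, map_sum]
  refine Finset.sum_congr rfl fun l _ => ?_
  rw [map_smul]
  simp

lemma eigProj_zero_adjoint (w : Vec d) : eigProj (S.cov P) 0 (S.Pi0.adjoint w) = 0 := by
  rw [hS.adjoint_eq_sum, map_sum]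
  exact Finset.sum_eq_zero fun l _ => by rw [map_smul, hS.source_ker, smul_zero]

/-- The source condition, uniformly over the linear combinations of the `Π₀* e_l`. -/
lemma exists_sum_norm_src_le {s : ℝ} (hs : s ≤ ρ) : ∃ W : ℝ, 0 ≤ W ∧
    ∀ (w : Vec d) (t : Finset ℝ),
    ∑ κ ∈ t, ‖src (S.cov P) s (S.Pi0.adjoint w) κ‖ ^ 2 ≤ (W * ‖w‖) ^ 2 := by
  have key : ∀ l : Fin d, ∃ A : ℝ, 0 ≤ A ∧ ∀ t : Finset ℝ,
      ∑ κ ∈ t, ‖src (S.cov P) s (S.Pi0.adjoint (EuclideanSpace.single l 1)) κ‖ ^ 2 ≤ A := by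
    intro l
    set π := S.Pi0.adjoint (EuclideanSpace.single l 1)
    set g : ℝ → ℝ := fun κ => ‖eigProj (S.cov P) κ π‖ ^ 2 / κ ^ (2 * ρ)
    set N : ℝ := ‖S.cov P‖ ^ (2 * (ρ - s))
    -- Lowering the exponent from `ρ` to `s` multiplies a term by `κ^{2(ρ-s)}`, which is bounded on
    -- the spectrum.
    have hterm : ∀ κ, ‖src (S.cov P) s π κ‖ ^ 2 ≤ N * |g κ| := by
      intro κ
      by_cases h0 : eigProj (S.cov P) κ π = 0
      · simp only [src, h0, smul_zero, norm_zero]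
        rw [zero_pow two_ne_zero]
        positivity
      obtain ⟨k1, k2⟩ := eigenvalue_mem hS.cov_nonneg h0
      have k3 : 0 < κ := lt_of_le_of_ne k1 fun h => h0 (by
        rw [← h, hS.source_ker l])
      have e : ‖src (S.cov P) s π κ‖ ^ 2 = κ ^ (2 * (ρ - s)) * |g κ| := by
        rw [abs_of_nonneg (by simp only [g]; positivity), src, norm_smul, mul_pow, Real.norm_eq_abs, sq_abs,
          ← Real.rpow_natCast, ← Real.rpow_mul k1]
        simp only [g]
        rw [div_eq_mul_inv, ← Real.rpow_neg k1]
        have : κ ^ (-s * (2 : ℕ)) = κ ^ (2 * (ρ - s)) * κ ^ (-(2 * ρ)) := by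
          rw [← Real.rpow_add k3]
          congr 1
          push_cast
          ring
        rw [this]
        ring
      rw [e]
      gcongr
      exact Real.rpow_le_rpow k1 k2 (by linarith)
    refine ⟨N * ∑' κ, |g κ|, by positivity, fun t => ?_⟩
    refine (Finset.sum_le_sum fun κ _ => hterm κ).trans ?_
    rw [← Finset.mul_sum]
    gcongr
    exact (hS.source_sum l).abs.sum_le_tsum t fun _ _ => abs_nonneg _
  choose A hA0 hA using key
  refine ⟨Real.sqrt (∑ l, A l), Real.sqrt_nonneg _, fun w t => ?_⟩
  rw [mul_pow, Real.sq_sqrt (Finset.sum_nonneg fun l _ => hA0 l)]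
  have h1 : ∀ κ, ‖src (S.cov P) s (S.Pi0.adjoint w) κ‖ ^ 2 ≤
      ‖w‖ ^ 2 * ∑ l, ‖src (S.cov P) s (S.Pi0.adjoint (EuclideanSpace.single l 1)) κ‖ ^ 2 := by
    intro κ
    have e : src (S.cov P) s (S.Pi0.adjoint w) κ =
        ∑ l, w l • src (S.cov P) s (S.Pi0.adjoint (EuclideanSpace.single l 1)) κ := by
      simp only [src]
      rw [hS.adjoint_eq_sum w, map_sum, Finset.smul_sum]
      exact Finset.sum_congr rfl fun l _ => by rw [map_smul, smul_comm]
    rw [e, EuclideanSpace.norm_sq_eq]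
    refine (pow_le_pow_left₀ (norm_nonneg _) (norm_sum_le _ _) 2).trans ?_
    simp only [norm_smul]
    exact Finset.sum_mul_sq_le_sq_mul_sq _ _ _
  refine (Finset.sum_le_sum fun κ _ => h1 κ).trans ?_
  rw [← Finset.mul_sum, Finset.sum_comm, mul_comm]
  gcongr with l
  exact hA l t

end ModelConditions

/-! ### Measurability of the random spectral operators. -/

namespace ModelConditions

variable {Ω : Type*} {m mΩ : MeasurableSpace Ω} {P : Measure Ω} [IsProbabilityMeasure P]
  {H : Type*} [NormedAddCommGroup H] [InnerProductSpace ℝ H] [CompleteSpace H]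
  [SecondCountableTopology H] [MeasurableSpace H] [BorelSpace H] {dx d : ℕ}
  {S : Design Ω H dx d} {Θ : Set (Vec2 d)} {ρ : ℝ} (hS : ModelConditions P S Θ ρ)
include hS

/-- The σ-algebra is left free because the results are used for `σ(x)`, for `σ(x, V)` and for the
ambient one. -/
lemma measurable_covN (hm : S.sigmaX ≤ m) (n : ℕ) {b : Ω → H}
    (hb : Measurable[m] b) : Measurable[m] fun ω => S.covN n ω (b ω) := by
  simp only [Design.covN_apply]
  refine Measurable.const_smul ?_ _
  refine Finset.measurable_fun_sum _ fun i _ => ?_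
  have hZ : Measurable[m] (S.Zi i) := (hS.measurable_Z_sigmaX i).mono hm le_rfl
  exact (hZ.inner hb).smul hZ

lemma measurable_fc_covN (hm : S.sigmaX ≤ m) (n : ℕ) {h : ℝ → ℝ}
    (hh : Measurable h) {b : Ω → H} (hb : Measurable[m] b) :
    Measurable[m] fun ω => fc h (S.covN n ω) (b ω) := by
  exact @measurable_fc H _ _ _ _ _ _ Ω m _ (fun ω => S.exists_spec_covN n ω)
    (fun b hb => hS.measurable_covN hm n hb) _ hh b hb

lemma measurable_regInv (hm : S.sigmaX ≤ m) {q : ℝ → ℝ → ℝ}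
    (hq : IsRegularization q ρ) (α : ℝ) (n : ℕ) {b : Ω → H} (hb : Measurable[m] b) :
    Measurable[m] fun ω => regInv q α (S.covN n ω) (b ω) :=
  hS.measurable_fc_covN hm n (measurable_inv.mul (hq.measurable α)) hb

end ModelConditions

/-! ### The first-stage error and the linearized score -/

namespace Design

variable {Ω : Type*} {H : Type*} [NormedAddCommGroup H] [InnerProductSpace ℝ H] [CompleteSpace H]
  {dx d : ℕ} (S : Design Ω H dx d)

/-- The noise part `n⁻¹ ∑ Z_j ⊗ V_j` of the first-stage moment. -/
noncomputable def noise (n : ℕ) (ω : Ω) (v : H) : Vec d :=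
  (n : ℝ)⁻¹ • ∑ j ∈ Finset.range n, (inner ℝ (S.Zi j ω) v : ℝ) • S.V j ω

/-- The estimation error of the first stage. -/
noncomputable def err (q : ℝ → ℝ → ℝ) (a : ℝ) (n : ℕ) (ω : Ω) : H →L[ℝ] Vec d :=
  S.PiHat q a n ω - S.PiN n

/-- Substituting `Y_{2i} = Π_n Z_i + V_i` splits the sample moment into `Π_n K_n` and noise. After
the regularized inverse `R` is applied, the signal misses `Π_n` by `Π_n (1 - K_n R)`, the spectral
residual. -/
lemma err_apply (q : ℝ → ℝ → ℝ) (a : ℝ) (n : ℕ) (ω : Ω) (v : H) :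
    S.err q a n ω v = S.noise n ω (regInv q a (S.covN n ω) v)
      - S.D n (S.Pi0 (fc (resid q a) (S.covN n ω) v)) := by
  obtain ⟨s, hs⟩ := S.exists_spec_covN n ω
  rw [← hs.sub_apply_regInv, err, _root_.sub_apply, PiN_apply, map_sub, map_sub, covN_apply]
  set u := regInv q a (S.covN n ω) v with hu
  have h1 : S.PiHat q a n ω v = (n : ℝ)⁻¹ • ∑ j ∈ Finset.range n,
      (inner ℝ (S.Zi j ω) u : ℝ) • S.Y2 n j ω := by
    simp only [PiHat, ContinuousLinearMap.comp_apply, _root_.smul_apply, _root_.sum_apply,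
      tensor_apply, hu]
  rw [h1, map_smul, map_smul, map_sum, map_sum, noise]
  simp only [Y2, smul_add, Finset.sum_add_distrib, map_smul, PiN_apply]
  abel

/-- The residual operator is moved onto `Π₀* D_n* ψ₀`, a nonrandom vector covered by the source
condition, instead of acting on an arbitrary `v`. -/
lemma inner_psi0_err (q : ℝ → ℝ → ℝ) (a : ℝ) (n : ℕ) (ω : Ω) (v : H) :
    inner ℝ S.psi0 (S.err q a n ω v) =
      inner ℝ S.psi0 (S.noise n ω (regInv q a (S.covN n ω) v))
      - inner ℝ (fc (resid q a) (S.covN n ω) (S.Pi0.adjoint ((S.D n).adjoint S.psi0))) v := by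
  obtain ⟨s, hs⟩ := S.exists_spec_covN n ω
  rw [err_apply, inner_sub_right, hs.inner_fc, ContinuousLinearMap.adjoint_inner_left,
    ContinuousLinearMap.adjoint_inner_left]

/-- The coordinates of the noise part. -/
noncomputable def noiseVec (n : ℕ) (l : Fin d) (ω : Ω) : H :=
  (n : ℝ)⁻¹ • ∑ j ∈ Finset.range n, S.V j ω l • S.Zi j ω

/-- A bound on the operator norm of the noise part. -/
noncomputable def noiseBd (n : ℕ) (ω : Ω) : ℝ := ∑ l, ‖S.noiseVec n l ω‖

lemma noiseBd_nonneg (n : ℕ) (ω : Ω) : 0 ≤ S.noiseBd n ω :=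
  Finset.sum_nonneg fun _ _ => norm_nonneg _

lemma norm_noise_le (n : ℕ) (ω : Ω) (v : H) : ‖S.noise n ω v‖ ≤ S.noiseBd n ω * ‖v‖ := by
  have h1 : ∀ l, S.noise n ω v l = inner ℝ (S.noiseVec n l ω) v := fun l => by
    simp only [noise, noiseVec, inner_smul_left, sum_inner, PiLp.smul_apply, smul_eq_mul,
      conj_trivial, WithLp.ofLp_sum, Finset.sum_apply]
    congr 1
    exact Finset.sum_congr rfl fun j _ => mul_comm _ _
  have h2 : S.noise n ω v = ∑ l, S.noise n ω v l • EuclideanSpace.single l (1 : ℝ) := by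
    conv_lhs => rw [← (EuclideanSpace.basisFun (Fin d) ℝ).sum_repr (S.noise n ω v)]
    simp
  rw [h2, noiseBd, Finset.sum_mul]
  refine (norm_sum_le _ _).trans (Finset.sum_le_sum fun l _ => ?_)
  rw [norm_smul, h1, PiLp.norm_single, norm_one, mul_one]
  exact norm_inner_le_norm _ _

/-- The coefficient of the residual in the scaled linearized score. -/
noncomputable def lin (c : Criterion) (n i : ℕ) (B : H →L[ℝ] Vec d) (ω : Ω) : Vec2 d :=
  hfac c (S.idx n i ω) • S.scaleInv n (pair (B (S.Zi i ω)) (-(B (S.Zi i ω))))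
    - (hfacD c (S.idx n i ω) * inner ℝ S.psi0 (B (S.Zi i ω))) • S.F i ω

/-- Opposite movements of the two blocks cancel the coefficient `β₀`. Only the endogeneity `ψ₀`
carries the first-stage error into the index. -/
lemma inner_pair_theta0 (b : Vec d) : inner ℝ (pair b (-b)) S.theta0 = -inner ℝ S.psi0 b := by
  rw [theta0, inner_pair, pair_fst, pair_snd, inner_neg_left, inner_add_right,
    real_inner_comm S.psi0 b]
  ring

end Design

namespace ModelConditions

variable {Ω : Type*} [mΩ : MeasurableSpace Ω] {P : Measure Ω} [IsProbabilityMeasure P]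
  {H : Type*} [NormedAddCommGroup H] [InnerProductSpace ℝ H] [CompleteSpace H]
  [SecondCountableTopology H] [MeasurableSpace H] [BorelSpace H] {dx d : ℕ}
  {S : Design Ω H dx d} {Θ : Set (Vec2 d)} {ρ : ℝ} (hS : ModelConditions P S Θ ρ)
include hS

lemma scaleInv_score (c : Criterion) {n : ℕ} (hn : 1 ≤ n) (i : ℕ) (ω : Ω) :
    S.scaleInv n (score c (S.y n i ω) (S.Zi i ω) (S.Y2 n i ω) S.theta0 (S.PiN n))
      = S.eps n i ω • hfac c (S.idx n i ω) • S.F i ω := by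
  rw [score_eq, ← S.scaleInvL_apply, map_smul, S.scaleInvL_apply]
  change _ • S.scaleInv n (S.g n i ω) = _
  rw [hS.scaleInv_g hn, smul_smul]
  rfl

/-- The terms containing the residual are collected apart, with a coefficient depending on `(x, V)`
when `B` does. The other term is handled through linear functionals of the first stage. -/
lemma scaleInv_scoreD2 (c : Criterion) {n : ℕ} (hn : 1 ≤ n) (i : ℕ) (ω : Ω)
    (B : H →L[ℝ] Vec d) :
    S.scaleInv n (scoreD2 c (S.y n i ω) (S.Zi i ω) (S.Y2 n i ω) S.theta0 (S.PiN n) B)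
      = (wgt c (S.idx n i ω) * inner ℝ S.psi0 (B (S.Zi i ω))) • S.F i ω
        + S.eps n i ω • S.lin c n i B ω := by
  rw [scoreD2_apply, S.inner_pair_theta0, ← S.scaleInvL_apply, map_add, map_smul, map_smul,
    S.scaleInvL_apply, S.scaleInvL_apply]
  change (_ * _) • S.scaleInv n (S.g n i ω) + _ = _
  rw [hS.scaleInv_g hn, Design.lin]
  change ((-(wgt c (S.idx n i ω)) + S.eps n i ω * hfacD c (S.idx n i ω)) * _) • _ +
    (S.eps n i ω * hfac c (S.idx n i ω)) • _ = _
  rw [smul_sub, smul_smul, smul_smul]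
  module

lemma scaleInv_scoreD1 (c : Criterion) {n : ℕ} (hn : 1 ≤ n) (i : ℕ) (ω : Ω) (v : Vec2 d) :
    S.scaleInv n (scoreD1 c (S.y n i ω) (S.Zi i ω) (S.Y2 n i ω) S.theta0 (S.PiN n) v)
      = ((-(wgt c (S.idx n i ω)) + S.eps n i ω * hfacD c (S.idx n i ω))
        * inner ℝ (S.F i ω) (S.scaleT n v)) • S.F i ω := by
  rw [scoreD1_apply, ← S.scaleInvL_apply, map_smul, S.scaleInvL_apply]
  change (_ * inner ℝ (S.g n i ω) v) • S.scaleInv n (S.g n i ω) = _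
  rw [hS.scaleInv_g hn, S.inner_g]
  rfl

/-- The scaled sample score at the estimated first stage, linearized. -/
lemma scaleInv_sample (c : Criterion) {n : ℕ} (hn : 1 ≤ n) (ω : Ω) (B : H →L[ℝ] Vec d) :
    S.scaleInv n (S.scoreN c n ω + S.Gamma2N c n ω B) =
      (n : ℝ)⁻¹ • ∑ i ∈ Finset.range n,
        S.eps n i ω • (hfac c (S.idx n i ω) • S.F i ω + S.lin c n i B ω)
      + (n : ℝ)⁻¹ • ∑ i ∈ Finset.range n,
        (wgt c (S.idx n i ω) * inner ℝ S.psi0 (B (S.Zi i ω))) • S.F i ω := by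
  rw [Design.scoreN, Design.Gamma2N, _root_.smul_apply, _root_.sum_apply, ← smul_add,
    ← Finset.sum_add_distrib, ← S.scaleInvL_apply, map_smul, map_sum, ← smul_add,
    ← Finset.sum_add_distrib]
  congr 1
  refine Finset.sum_congr rfl fun i _ => ?_
  rw [map_add, S.scaleInvL_apply, S.scaleInvL_apply, hS.scaleInv_score c hn,
    hS.scaleInv_scoreD2 c hn, smul_add]
  abel

end ModelConditions

/-! ### Moments of sample averages -/

namespace Design

variable {Ω : Type*} {H : Type*} [NormedAddCommGroup H] [InnerProductSpace ℝ H]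
  {dx d : ℕ} (S : Design Ω H dx d)

/-- The sample average of `φ(x_i, V_i, u_i) Z_i`. -/
noncomputable def avg (φ : (Fin dx → ℝ) × Vec d × ℝ → ℝ) (n : ℕ) (ω : Ω) : H :=
  (n : ℝ)⁻¹ • ∑ i ∈ Finset.range n, φ (S.obs i ω) • S.Zi i ω

/-- The population counterpart of `avg`. -/
noncomputable def mean [MeasurableSpace Ω] (P : Measure Ω)
    (φ : (Fin dx → ℝ) × Vec d × ℝ → ℝ) : H := ∫ ω, φ (S.obs 0 ω) • S.Zi 0 ω ∂P

end Design

namespace ModelConditions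

variable {Ω : Type*} [mΩ : MeasurableSpace Ω] {P : Measure Ω} [IsProbabilityMeasure P]
  {H : Type*} [NormedAddCommGroup H] [InnerProductSpace ℝ H] [CompleteSpace H]
  [SecondCountableTopology H] [MeasurableSpace H] [BorelSpace H] {dx d : ℕ}
  {S : Design Ω H dx d} {Θ : Set (Vec2 d)} {ρ : ℝ} (hS : ModelConditions P S Θ ρ)
include hS

lemma memLp_smul_Z {φ : (Fin dx → ℝ) × Vec d × ℝ → ℝ} (hφ : Measurable φ) {C : ℝ} {i : ℕ}
    (hC : ∀ᵐ ω ∂P, |φ (S.obs i ω)| ≤ C) : MemLp (fun ω => φ (S.obs i ω) • S.Zi i ω) 4 P := by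
  refine (hS.moment_Z i).of_le_mul (c := C)
    ((hφ.comp (hS.measurable_obs i)).aestronglyMeasurable.smul (hS.moment_Z i).1) ?_
  filter_upwards [hC] with ω h
  rw [norm_smul]
  gcongr
  exact h

lemma measurable_smul_Z {φ : (Fin dx → ℝ) × Vec d × ℝ → ℝ} (hφ : Measurable φ) :
    Measurable fun p : (Fin dx → ℝ) × Vec d × ℝ => φ p • S.Z p.1 :=
  hφ.smul (hS.meas_Z.comp measurable_fst)

lemma measurable_avg {φ : (Fin dx → ℝ) × Vec d × ℝ → ℝ} (hφ : Measurable φ) (n : ℕ) :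
    Measurable (S.avg φ n) := by
  unfold Design.avg
  refine Measurable.const_smul ?_ _
  exact Finset.measurable_fun_sum _ fun i _ =>
    (hφ.comp (hS.measurable_obs i)).smul (hS.measurable_Z i)

/-- Fourth moment of the deviation of `avg` from its mean. -/
lemma exists_fourth_moment (C : ℝ) : ∃ B : ℝ, 0 < B ∧
    ∀ φ : (Fin dx → ℝ) × Vec d × ℝ → ℝ, Measurable φ → (∀ᵐ ω ∂P, |φ (S.obs 0 ω)| ≤ C) →
    ∀ n : ℕ, 1 ≤ n → MemLp (fun ω => S.avg φ n ω - S.mean P φ) 4 P ∧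
      ∫ ω, ‖S.avg φ n ω - S.mean P φ‖ ^ 4 ∂P ≤ B * (n : ℝ)⁻¹ ^ 2 := by
  set m4 := ∫ ω, ‖S.Zi 0 ω‖ ^ 4 ∂P with hm4
  set m1 := ∫ ω, ‖S.Zi 0 ω‖ ∂P with hm1
  have hm40 : 0 ≤ m4 := integral_nonneg fun ω => by positivity
  -- The factor `8` comes from `(a + b)⁴ ≤ 2³ (a⁴ + b⁴)`, applied to a summand and its mean.
  set B1 : ℝ := 8 * (|C| ^ 4 * m4 + (|C| * m1) ^ 4) with hB1
  have hB10 : 0 ≤ B1 := by positivity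
  refine ⟨11 * (1 + B1) ^ 2, by positivity, fun φ hφ hC n hn => ?_⟩
  have hC' : ∀ᵐ ω ∂P, |φ (S.obs 0 ω)| ≤ |C| := by
    filter_upwards [hC] with ω h using h.trans (le_abs_self C)
  set h := S.mean P φ with hh
  set ψ : (Fin dx → ℝ) × Vec d × ℝ → H := fun p => φ p • S.Z p.1 - h with hψ
  have hψm : Measurable ψ := (hS.measurable_smul_Z hφ).sub measurable_const
  have hL0 : MemLp (fun ω => ψ (S.obs 0 ω)) 4 P :=
    (hS.memLp_smul_Z hφ hC').sub (memLp_const h)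
  have hL : ∀ i, MemLp (fun ω => ψ (S.obs i ω)) 4 P := fun i =>
    (hS.identDistrib_obs hψm i).memLp_iff.2 hL0
  have hmean : ‖h‖ ≤ |C| * m1 := by
    rw [hh, Design.mean, hm1, ← integral_const_mul]
    refine norm_integral_le_of_norm_le ((hS.integrable_Z 0).norm.const_mul _) ?_
    filter_upwards [hC'] with ω h
    rw [norm_smul]
    gcongr
    exact h
  have hb0 : ∫ ω, ‖ψ (S.obs 0 ω)‖ ^ 4 ∂P ≤ B1 := by
    have hi := (hS.integrable_norm_Z_pow_four 0).const_mul (8 * |C| ^ 4)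
    have e : B1 = ∫ ω, (8 * |C| ^ 4 * ‖S.Zi 0 ω‖ ^ 4 + 8 * (|C| * m1) ^ 4) ∂P := by
      rw [integral_add hi (integrable_const _), integral_const_mul, integral_const, hB1]
      simp only [probReal_univ, smul_eq_mul, one_mul]
      ring
    rw [e]
    refine integral_mono_ae (MemLp.integrable_norm_pow (p := 4) (by exact_mod_cast hL0)
      (by norm_num)) (hi.add (integrable_const _)) ?_
    filter_upwards [hC'] with ω h1
    have h2 : ‖ψ (S.obs 0 ω)‖ ≤ |C| * ‖S.Zi 0 ω‖ + |C| * m1 := by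
      refine (norm_sub_le _ _).trans (add_le_add ?_ hmean)
      rw [norm_smul]
      exact mul_le_mul_of_nonneg_right h1 (norm_nonneg _)
    calc ‖ψ (S.obs 0 ω)‖ ^ 4 ≤ (|C| * ‖S.Zi 0 ω‖ + |C| * m1) ^ 4 := by gcongr
      _ ≤ 2 ^ (4 - 1) * ((|C| * ‖S.Zi 0 ω‖) ^ 4 + (|C| * m1) ^ 4) := by
        exact add_pow_le (by positivity) (by positivity) 4
      _ = _ := by ring
  have hb : ∀ i, ∫ ω, ‖ψ (S.obs i ω)‖ ^ 4 ∂P ≤ B1 := fun i =>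
    ((hS.identDistrib_obs hψm i).comp
      (measurable_norm.pow_const 4 : Measurable fun x : H => ‖x‖ ^ 4)).integral_eq.trans_le hb0
  have hz : ∀ i, ∫ ω, ψ (S.obs i ω) ∂P = 0 := fun i => by
    rw [(hS.identDistrib_obs hψm i).integral_eq]
    change ∫ ω, (φ (S.obs 0 ω) • S.Zi 0 ω - h) ∂P = 0
    rw [integral_sub ((hS.memLp_smul_Z hφ hC').integrable (by norm_num)) (integrable_const _),
      integral_const]
    simp [hh, Design.mean]
  have key := integral_norm_pow_four_sum_le (fun i => hψm.comp (hS.measurable_obs i)) hL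
    (hS.iIndepFun_obs hψm) hz hb n
  have hn0 : (n : ℝ) ≠ 0 := by positivity
  have e : ∀ ω, S.avg φ n ω - h = (n : ℝ)⁻¹ • ∑ i ∈ Finset.range n, ψ (S.obs i ω) := fun ω => by
    simp only [hψ, Finset.sum_sub_distrib, Finset.sum_const, Finset.card_range, smul_sub, Design.avg]
    rw [← Nat.cast_smul_eq_nsmul ℝ, smul_smul, inv_mul_cancel₀ hn0, one_smul]
    rfl
  simp_rw [e]
  refine ⟨(memLp_finsetSum _ fun i _ => hL i).const_smul _, ?_⟩
  simp only [norm_smul, mul_pow, norm_inv, Real.norm_natCast]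
  rw [integral_const_mul]
  refine (mul_le_mul_of_nonneg_left key (by positivity)).trans (le_of_eq ?_)
  field_simp

lemma integrable_norm_Z_sq_mul_inner_sq (v : H) :
    Integrable (fun ω => ‖S.Zi 0 ω‖ ^ 2 * inner ℝ (S.Zi 0 ω) v ^ 2) P := by
  refine ((hS.integrable_norm_Z_pow_four 0).mul_const (‖v‖ ^ 2)).mono' ?_
    (Eventually.of_forall fun ω => ?_)
  · exact (((hS.measurable_Z 0).norm.pow_const 2).mul
      (((hS.measurable_Z 0).inner measurable_const).pow_const 2)).aestronglyMeasurable
  · rw [Real.norm_of_nonneg (by positivity), ← sq_abs (inner ℝ _ _)]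
    have := abs_real_inner_le_norm (S.Zi 0 ω) v
    calc _ ≤ ‖S.Zi 0 ω‖ ^ 2 * (‖S.Zi 0 ω‖ * ‖v‖) ^ 2 := by gcongr
      _ = _ := by ring

/-- Second moment of the error of the sample covariance operator. -/
lemma integral_norm_sq_cov_sub_le (v : H) {n : ℕ} (hn : 1 ≤ n) :
    MemLp (fun ω => (S.cov P - S.covN n ω) v) 2 P ∧
    ∫ ω, ‖(S.cov P - S.covN n ω) v‖ ^ 2 ∂P
      ≤ (n : ℝ)⁻¹ * ∫ ω, ‖S.Zi 0 ω‖ ^ 2 * inner ℝ (S.Zi 0 ω) v ^ 2 ∂P := by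
  set k := S.cov P v with hk
  set ψ : (Fin dx → ℝ) × Vec d × ℝ → H := fun p => (inner ℝ (S.Z p.1) v : ℝ) • S.Z p.1 - k with hψ
  have hZm : Measurable fun p : (Fin dx → ℝ) × Vec d × ℝ => S.Z p.1 :=
    hS.meas_Z.comp measurable_fst
  have hψm : Measurable ψ := ((hZm.inner measurable_const).smul hZm).sub measurable_const
  have hi2 := hS.integrable_norm_Z_sq_mul_inner_sq v
  have e2 : ∀ ω, ‖(inner ℝ (S.Zi 0 ω) v : ℝ) • S.Zi 0 ω‖ ^ 2 =
      ‖S.Zi 0 ω‖ ^ 2 * inner ℝ (S.Zi 0 ω) v ^ 2 := fun ω => by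
    rw [norm_smul, mul_pow, Real.norm_eq_abs, sq_abs, mul_comm]
  have hX0 : MemLp (fun ω => (inner ℝ (S.Zi 0 ω) v : ℝ) • S.Zi 0 ω) 2 P := by
    rw [memLp_two_iff_integrable_sq_norm (hS.integrable_inner_smul_Z 0 v).1]
    simpa only [e2] using hi2
  have hL0 : MemLp (fun ω => ψ (S.obs 0 ω)) 2 P := hX0.sub (memLp_const k)
  have hL : ∀ i, MemLp (fun ω => ψ (S.obs i ω)) 2 P := fun i =>
    (hS.identDistrib_obs hψm i).memLp_iff.2 hL0
  -- Centring only reduces the second moment.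
  have hb0 : ∫ ω, ‖ψ (S.obs 0 ω)‖ ^ 2 ∂P ≤
      ∫ ω, ‖S.Zi 0 ω‖ ^ 2 * inner ℝ (S.Zi 0 ω) v ^ 2 ∂P := by
    have e3 : ∀ ω, ‖ψ (S.obs 0 ω)‖ ^ 2 = ‖S.Zi 0 ω‖ ^ 2 * inner ℝ (S.Zi 0 ω) v ^ 2
        - 2 * inner ℝ ((inner ℝ (S.Zi 0 ω) v : ℝ) • S.Zi 0 ω) k + ‖k‖ ^ 2 := fun ω => by
      rw [← e2, ← norm_sub_sq_real]
      rfl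
    have i3 : Integrable (fun ω => 2 * inner ℝ ((inner ℝ (S.Zi 0 ω) v : ℝ) • S.Zi 0 ω) k) P :=
      ((hS.integrable_inner_smul_Z 0 v).inner_const k).const_mul 2
    have e4 : ∫ ω, inner ℝ ((inner ℝ (S.Zi 0 ω) v : ℝ) • S.Zi 0 ω) k ∂P = ‖k‖ ^ 2 := by
      simp_rw [real_inner_comm k]
      rw [integral_inner (hS.integrable_inner_smul_Z 0 v), ← hS.cov_apply,
        real_inner_self_eq_norm_sq]
    simp_rw [e3]
    have i4 := hi2.sub i3
    simp only [Pi.sub_def] at i4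
    rw [integral_add i4 (integrable_const _), integral_sub hi2 i3, integral_const_mul, e4,
      integral_const]
    simp only [probReal_univ, smul_eq_mul, one_mul]
    nlinarith [sq_nonneg ‖k‖]
  have hb : ∀ i, ∫ ω, ‖ψ (S.obs i ω)‖ ^ 2 ∂P ≤ _ := fun i =>
    ((hS.identDistrib_obs hψm i).comp
      (measurable_norm.pow_const 2 : Measurable fun x : H => ‖x‖ ^ 2)).integral_eq.trans_le hb0
  have hz : ∀ i, ∫ ω, ψ (S.obs i ω) ∂P = 0 := fun i => by
    rw [(hS.identDistrib_obs hψm i).integral_eq]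
    change ∫ ω, ((inner ℝ (S.Zi 0 ω) v : ℝ) • S.Zi 0 ω - k) ∂P = 0
    rw [integral_sub (hS.integrable_inner_smul_Z 0 v) (integrable_const _), integral_const,
      ← hS.cov_apply]
    simp [hk]
  have key := integral_norm_sq_sum_le_of_iIndepFun hL (hS.iIndepFun_obs hψm) hz hb n
  have hn0 : (n : ℝ) ≠ 0 := by positivity
  have e : ∀ ω, (S.cov P - S.covN n ω) v = (-(n : ℝ)⁻¹) • ∑ i ∈ Finset.range n, ψ (S.obs i ω) := by
    intro ω
    simp only [hψ, Finset.sum_sub_distrib, Finset.sum_const, Finset.card_range, smul_sub,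
      _root_.sub_apply, Design.covN_apply, neg_smul]
    rw [← Nat.cast_smul_eq_nsmul ℝ, smul_smul, inv_mul_cancel₀ hn0, one_smul, ← hk, sub_neg_eq_add,
      neg_add_eq_sub]
    rfl
  simp_rw [e]
  refine ⟨(memLp_finsetSum _ fun i _ => hL i).const_smul _, ?_⟩
  simp only [norm_smul, mul_pow, norm_neg, norm_inv, Real.norm_natCast]
  rw [integral_const_mul]
  refine (mul_le_mul_of_nonneg_left key (by positivity)).trans (le_of_eq ?_)
  field_simp

/-- The perturbation of the source components by the error of the covariance operator. -/
lemma integral_sq_sum_cov_sub_le (t : Finset ℝ) (π : H) {s W : ℝ}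
    (hW : ∑ κ ∈ t, ‖src (S.cov P) s π κ‖ ^ 2 ≤ W ^ 2) {n : ℕ} (hn : 1 ≤ n) :
    MemLp (fun ω => ∑ κ ∈ t, ‖(S.cov P - S.covN n ω) (src (S.cov P) s π κ)‖) 2 P ∧
    ∫ ω, (∑ κ ∈ t, ‖(S.cov P - S.covN n ω) (src (S.cov P) s π κ)‖) ^ 2 ∂P
      ≤ W ^ 2 * ((n : ℝ)⁻¹ * ∫ ω, ‖S.Zi 0 ω‖ ^ 4 ∂P) := by
  set w : ℝ → H := src (S.cov P) s π with hw
  set δ : ℝ → Ω → ℝ := fun κ ω => ‖(S.cov P - S.covN n ω) (w κ)‖ with hδ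
  have hδL : ∀ κ, MemLp (δ κ) 2 P := fun κ => (hS.integral_norm_sq_cov_sub_le (w κ) hn).1.norm
  have hsum := memLp_finsetSum t fun κ _ => hδL κ
  refine ⟨hsum, ?_⟩
  have hδi : ∀ κ, Integrable (fun ω => δ κ ω ^ 2) P := fun κ => (hδL κ).integrable_sq
  set g : ℝ → Ω → ℝ := fun κ ω => δ κ ω ^ 2 * (‖w κ‖ ^ 2)⁻¹
  -- Cauchy-Schwarz with weights `‖w κ‖` separates the source condition from the errors at
  -- normalized eigenvectors. The latter sum to a quantity of Hilbert-Schmidt type, so the number of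
  -- elements of `t` does not matter.
  have hCS : ∀ ω, (∑ κ ∈ t, δ κ ω) ^ 2 ≤ W ^ 2 * ∑ κ ∈ t, g κ ω := by
    intro ω
    have e1 : ∑ κ ∈ t, δ κ ω = ∑ κ ∈ t, ‖w κ‖ * (δ κ ω * ‖w κ‖⁻¹) := by
      refine Finset.sum_congr rfl fun κ _ => ?_
      by_cases h0 : ‖w κ‖ = 0
      · have : w κ = 0 := norm_eq_zero.1 h0
        simp [hδ, this]
      · field_simp
    rw [e1]
    refine (Finset.sum_mul_sq_le_sq_mul_sq _ _ _).trans ?_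
    have e2 : ∀ κ, (δ κ ω * ‖w κ‖⁻¹) ^ 2 = g κ ω := fun κ => by
      simp only [g, mul_pow, inv_pow]
    simp only [e2]
    exact mul_le_mul_of_nonneg_right hW
      (Finset.sum_nonneg fun κ _ => by simp only [g]; positivity)
  have hgi : ∀ κ, Integrable (g κ) P := fun κ => (hδi κ).mul_const _
  have hproj : ∀ κ, Integrable (fun ω => ‖S.Zi 0 ω‖ ^ 2 * ‖eigProj (S.cov P) κ (S.Zi 0 ω)‖ ^ 2) P := by
    intro κ
    refine (hS.integrable_norm_Z_pow_four 0).mono' ?_ (Eventually.of_forall fun ω => ?_)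
    · exact (((hS.measurable_Z 0).norm.pow_const 2).mul
        (((eigProj (S.cov P) κ).continuous.measurable.comp
          (hS.measurable_Z 0)).norm.pow_const 2)).aestronglyMeasurable
    · rw [Real.norm_of_nonneg (by positivity)]
      have h := sum_norm_eigProj_sq_le hS.cov_symm {κ} (S.Zi 0 ω)
      rw [Finset.sum_singleton] at h
      calc _ ≤ ‖S.Zi 0 ω‖ ^ 2 * ‖S.Zi 0 ω‖ ^ 2 := by gcongr
        _ = _ := by ring
  have hg : ∀ κ, ∫ ω, g κ ω ∂P ≤ (n : ℝ)⁻¹ *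
      ∫ ω, ‖S.Zi 0 ω‖ ^ 2 * ‖eigProj (S.cov P) κ (S.Zi 0 ω)‖ ^ 2 ∂P := by
    intro κ
    have hr : 0 ≤ (n : ℝ)⁻¹ *
      ∫ ω, ‖S.Zi 0 ω‖ ^ 2 * ‖eigProj (S.cov P) κ (S.Zi 0 ω)‖ ^ 2 ∂P :=
      mul_nonneg (by positivity) (integral_nonneg fun ω => by positivity)
    simp only [g]
    rw [integral_mul_const]
    by_cases h0 : ‖w κ‖ ^ 2 = 0
    · rw [h0, inv_zero, mul_zero]
      exact hr
    have hpos : 0 < ‖w κ‖ ^ 2 := lt_of_le_of_ne (by positivity) (Ne.symm h0)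
    rw [← div_eq_mul_inv, div_le_iff₀ hpos]
    refine (hS.integral_norm_sq_cov_sub_le (w κ) hn).2.trans ?_
    rw [mul_assoc, ← integral_mul_const]
    refine mul_le_mul_of_nonneg_left ?_ (by positivity)
    refine integral_mono (hS.integrable_norm_Z_sq_mul_inner_sq _) ((hproj κ).mul_const _)
      fun ω => ?_
    -- Since `w κ` lies in its eigenspace, only the component of `Z` there is seen. Bessel's
    -- inequality over `κ` then applies, also for multiple eigenvalues.
    have e3 : inner ℝ (S.Zi 0 ω) (w κ) = inner ℝ (eigProj (S.cov P) κ (S.Zi 0 ω)) (w κ) := by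
      rw [inner_eigProj_left, eigProj_of_mem (apply_src _ _ _ _)]
    simp only
    rw [e3, mul_assoc]
    refine mul_le_mul_of_nonneg_left ?_ (sq_nonneg _)
    rw [← mul_pow, ← sq_abs (inner ℝ _ _)]
    exact pow_le_pow_left₀ (abs_nonneg _) (abs_real_inner_le_norm _ _) 2
  calc ∫ ω, (∑ κ ∈ t, δ κ ω) ^ 2 ∂P ≤ ∫ ω, W ^ 2 * ∑ κ ∈ t, g κ ω ∂P := by
        refine integral_mono ?_ ((integrable_finsetSum _ fun κ _ => hgi κ).const_mul _) hCS
        have := hsum.integrable_sq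
        simpa only [Finset.sum_apply] using this
    _ = W ^ 2 * ∑ κ ∈ t, ∫ ω, g κ ω ∂P := by
        rw [integral_const_mul, integral_finsetSum _ fun κ _ => hgi κ]
    _ ≤ W ^ 2 * ((n : ℝ)⁻¹ *
        ∑ κ ∈ t, ∫ ω, ‖S.Zi 0 ω‖ ^ 2 * ‖eigProj (S.cov P) κ (S.Zi 0 ω)‖ ^ 2 ∂P) := by
        rw [Finset.mul_sum t _ (n : ℝ)⁻¹]
        gcongr with κ _
        exact hg κ
    _ ≤ _ := by
        rw [← integral_finsetSum _ fun κ _ => hproj κ]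
        refine mul_le_mul_of_nonneg_left (mul_le_mul_of_nonneg_left ?_ (by positivity))
          (sq_nonneg _)
        refine integral_mono (integrable_finsetSum _ fun κ _ => hproj κ)
          (hS.integrable_norm_Z_pow_four 0) fun ω => ?_
        simp only
        rw [← Finset.mul_sum]
        have h := sum_norm_eigProj_sq_le hS.cov_symm t (S.Zi 0 ω)
        calc _ ≤ ‖S.Zi 0 ω‖ ^ 2 * ‖S.Zi 0 ω‖ ^ 2 := by gcongr
          _ = _ := by ring

end ModelConditions

/-! ### Mean square bounds on an event -/

section SqLe

variable {Ω : Type*} [mΩ : MeasurableSpace Ω] {E F : Type*} [NormedAddCommGroup E]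
  [NormedAddCommGroup F]

/-- `X` is square integrable and `E[1_A ‖X‖²] ≤ b`. -/
structure SqLe (P : Measure Ω) (A : Set Ω) (X : Ω → E) (b : ℝ) : Prop where
  memLp : MemLp X 2 P
  le : ∫ ω in A, ‖X ω‖ ^ 2 ∂P ≤ b

variable {P : Measure Ω} {A : Set Ω}

lemma integrable_norm_sq_of_memLp {X : Ω → E} (hX : MemLp X 2 P) :
    Integrable (fun ω => ‖X ω‖ ^ 2) P := hX.integrable_norm_pow two_ne_zero

lemma SqLe.of_integral_le {X : Ω → E} {b : ℝ} (hX : MemLp X 2 P) (h : ∫ ω, ‖X ω‖ ^ 2 ∂P ≤ b) :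
    SqLe P A X b :=
  ⟨hX, (setIntegral_le_integral (integrable_norm_sq_of_memLp hX)
    (Eventually.of_forall fun _ => sq_nonneg _)).trans h⟩

lemma SqLe.mono {X : Ω → E} {b b' : ℝ} (hX : SqLe P A X b) (h : b ≤ b') : SqLe P A X b' :=
  ⟨hX.memLp, hX.le.trans h⟩

lemma SqLe.of_le {X : Ω → E} {Y : Ω → F} {b c : ℝ} (hY : SqLe P A Y b)
    (hX : AEStronglyMeasurable X P) (h : ∀ᵐ ω ∂P, ‖X ω‖ ≤ c * ‖Y ω‖) :
    SqLe P A X (c ^ 2 * b) := by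
  have hXL : MemLp X 2 P := hY.memLp.of_le_mul hX h
  refine ⟨hXL, ?_⟩
  refine le_trans ?_ (mul_le_mul_of_nonneg_left hY.le (sq_nonneg c))
  rw [← integral_const_mul]
  refine integral_mono_ae (integrable_norm_sq_of_memLp hXL).integrableOn
    ((integrable_norm_sq_of_memLp hY.memLp).integrableOn.const_mul _) (ae_restrict_of_ae ?_)
  filter_upwards [h] with ω h
  rw [← mul_pow]
  exact pow_le_pow_left₀ (norm_nonneg _) h 2

lemma SqLe.of_le_on {X : Ω → E} {Y : Ω → F} {b : ℝ} (hX : MemLp X 2 P) (hY : SqLe P A Y b)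
    (hA : MeasurableSet A) (h : ∀ᵐ ω ∂P, ω ∈ A → ‖X ω‖ ≤ ‖Y ω‖) : SqLe P A X b := by
  refine ⟨hX, le_trans ?_ hY.le⟩
  refine integral_mono_ae (integrable_norm_sq_of_memLp hX).integrableOn
    (integrable_norm_sq_of_memLp hY.memLp).integrableOn ?_
  filter_upwards [(ae_restrict_iff' hA).2 h] with ω h
  exact pow_le_pow_left₀ (norm_nonneg _) h 2

lemma SqLe.sum {ι : Type*} (s : Finset ι) {X : ι → Ω → E} {b : ι → ℝ}
    (h : ∀ i ∈ s, SqLe P A (X i) (b i)) :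
    SqLe P A (fun ω => ∑ i ∈ s, X i ω) (s.card * ∑ i ∈ s, b i) := by
  have hL := memLp_finsetSum s fun i hi => (h i hi).memLp
  refine ⟨hL, ?_⟩
  have hi : ∀ i ∈ s, Integrable (fun ω => ‖X i ω‖ ^ 2) (P.restrict A) := fun i hi =>
    (integrable_norm_sq_of_memLp (h i hi).memLp).integrableOn
  calc ∫ ω in A, ‖∑ i ∈ s, X i ω‖ ^ 2 ∂P ≤ ∫ ω in A, s.card * ∑ i ∈ s, ‖X i ω‖ ^ 2 ∂P := by
        refine integral_mono (integrable_norm_sq_of_memLp hL).integrableOn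
          ((integrable_finsetSum _ hi).const_mul _) fun ω => ?_
        exact (pow_le_pow_left₀ (norm_nonneg _) (norm_sum_le _ _) 2).trans
          sq_sum_le_card_mul_sum_sq
    _ = s.card * ∑ i ∈ s, ∫ ω in A, ‖X i ω‖ ^ 2 ∂P := by
        rw [integral_const_mul, integral_finsetSum _ hi]
    _ ≤ _ := by
        gcongr with i hi
        exact (h i hi).le

lemma SqLe.add {X Y : Ω → E} {b b' : ℝ} (hX : SqLe P A X b) (hY : SqLe P A Y b') :
    SqLe P A (fun ω => X ω + Y ω) (2 * (b + b')) := by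
  have h := SqLe.sum (P := P) (A := A) (Finset.univ : Finset Bool)
    (X := fun i => cond i X Y) (b := fun i => cond i b b') (by
      rintro (_ | _) _
      · exact hY
      · exact hX)
  simpa using h

lemma SqLe.neg {X : Ω → E} {b : ℝ} (hX : SqLe P A X b) : SqLe P A (fun ω => -X ω) b :=
  ⟨hX.memLp.neg, by simpa only [norm_neg] using hX.le⟩

lemma SqLe.const [IsProbabilityMeasure P] (v : E) : SqLe P A (fun _ => v) (‖v‖ ^ 2) :=
  SqLe.of_integral_le (memLp_const v) (by simp)

lemma integrable_norm_pow_four_of_memLp {X : Ω → E} (hX : MemLp X 4 P) :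
    Integrable (fun ω => ‖X ω‖ ^ 4) P :=
  MemLp.integrable_norm_pow (p := 4) (by exact_mod_cast hX) (by norm_num)

/-- A product of functions in `L⁴`. -/
lemma sqLe_mul_of_memLp_four {u v : Ω → ℝ} (hu : MemLp u 4 P) (hv : MemLp v 4 P) :
    SqLe P A (fun ω => u ω * v ω) ((∫ ω, ‖u ω‖ ^ 4 ∂P + ∫ ω, ‖v ω‖ ^ 4 ∂P) / 2) := by
  have iu := integrable_norm_pow_four_of_memLp hu
  have iv := integrable_norm_pow_four_of_memLp hv
  have hle : ∀ ω, ‖u ω * v ω‖ ^ 2 ≤ (‖u ω‖ ^ 4 + ‖v ω‖ ^ 4) / 2 := fun ω => by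
    rw [norm_mul, mul_pow]
    nlinarith [sq_nonneg (‖u ω‖ ^ 2 - ‖v ω‖ ^ 2)]
  have hm : AEStronglyMeasurable (fun ω => u ω * v ω) P := hu.1.mul hv.1
  have hL : MemLp (fun ω => u ω * v ω) 2 P := by
    rw [memLp_two_iff_integrable_sq_norm hm]
    refine ((iu.add iv).div_const 2).mono' (hm.norm.pow 2) (Eventually.of_forall fun ω => ?_)
    rw [Real.norm_of_nonneg (by positivity)]
    exact hle ω
  refine SqLe.of_integral_le hL ?_
  rw [← integral_add iu iv, ← integral_div]
  exact integral_mono (integrable_norm_sq_of_memLp hL) ((iu.add iv).div_const 2) hle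

end SqLe

lemma mseRate_one_one (n : ℕ) {a : ℝ} (ha : 0 < a) :
    mseRate 1 1 n a = (n : ℝ)⁻¹ * (Real.sqrt a)⁻¹ + a ^ 2 := by
  rw [mseRate, one_mul, one_mul, Real.rpow_neg ha.le, ← Real.sqrt_eq_rpow]

/-- For `α ≤ 1` the parametric rate `1/n` is dominated by the target rate, so remainders of that
order can be absorbed. -/
lemma inv_le_mseRate {n : ℕ} {a : ℝ} (ha : 0 < a) (ha1 : a ≤ 1) :
    (n : ℝ)⁻¹ ≤ mseRate 1 1 n a := by
  rw [mseRate_one_one n ha]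
  have h1 : 1 ≤ (Real.sqrt a)⁻¹ :=
    (one_le_inv₀ (Real.sqrt_pos.2 ha)).2 (Real.sqrt_le_one.2 ha1)
  have h2 : (0 : ℝ) ≤ (n : ℝ)⁻¹ := by positivity
  nlinarith [sq_nonneg a]

namespace Design

variable {Ω : Type*} {H : Type*} [NormedAddCommGroup H] [InnerProductSpace ℝ H]
  {dx d : ℕ} (S : Design Ω H dx d)

lemma noise_add (n : ℕ) (ω : Ω) (u v : H) :
    S.noise n ω (u + v) = S.noise n ω u + S.noise n ω v := by
  simp only [noise, inner_add_right, add_smul, Finset.sum_add_distrib, smul_add]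

lemma inner_noise (n : ℕ) (ω : Ω) (w : Vec d) (v : H) : inner ℝ w (S.noise n ω v) =
    (n : ℝ)⁻¹ * ∑ j ∈ Finset.range n, inner ℝ w (S.V j ω) * inner ℝ (S.Zi j ω) v := by
  simp only [noise, inner_smul_right, inner_sum]
  congr 1
  exact Finset.sum_congr rfl fun j _ => mul_comm _ _

/-- Cauchy-Schwarz over the sample: pairing with an average of instruments sees `u` only through
`K_n^{1/2} u`. The half power gained here is what brings the bias down to order `α`. -/
lemma abs_inner_avg_le {φ : (Fin dx → ℝ) × Vec d × ℝ → ℝ} {C : ℝ} {n : ℕ} {ω : Ω}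
    (hC : ∀ i, |φ (S.obs i ω)| ≤ C) (u : H) :
    inner ℝ u (S.avg φ n ω) ^ 2 ≤ C ^ 2 * inner ℝ u (S.covN n ω u) := by
  rcases Nat.eq_zero_or_pos n with rfl | hn
  · simp [avg, covN]
  have hn0 : (0 : ℝ) < n := by exact_mod_cast hn
  have e : inner ℝ u (S.avg φ n ω) =
      (n : ℝ)⁻¹ * ∑ i ∈ Finset.range n, φ (S.obs i ω) * inner ℝ (S.Zi i ω) u := by
    simp only [avg, inner_smul_right, inner_sum]
    congr 1
    exact Finset.sum_congr rfl fun i _ => by rw [real_inner_comm]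
  rw [e, inner_covN, mul_pow]
  have h1 := Finset.sum_mul_sq_le_sq_mul_sq (Finset.range n) (fun i => φ (S.obs i ω))
    (fun i => inner ℝ (S.Zi i ω) u)
  have h2 : ∑ i ∈ Finset.range n, φ (S.obs i ω) ^ 2 ≤ n * C ^ 2 := by
    refine (Finset.sum_le_sum (g := fun _ => C ^ 2) fun i _ => ?_).trans (by simp)
    rw [← sq_abs]
    exact pow_le_pow_left₀ (abs_nonneg _) (hC i) 2
  have h3 : 0 ≤ ∑ i ∈ Finset.range n, (inner ℝ (S.Zi i ω) u : ℝ) ^ 2 :=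
    Finset.sum_nonneg fun i _ => sq_nonneg _
  simp only [← sq]
  calc (n : ℝ)⁻¹ ^ 2 * _ ≤ (n : ℝ)⁻¹ ^ 2 * ((n * C ^ 2) *
        ∑ i ∈ Finset.range n, (inner ℝ (S.Zi i ω) u : ℝ) ^ 2) :=
      mul_le_mul_of_nonneg_left (h1.trans (mul_le_mul_of_nonneg_right h2 h3)) (by positivity)
    _ = _ := by field_simp

end Design

namespace ModelConditions

variable {Ω : Type*} [mΩ : MeasurableSpace Ω] {P : Measure Ω} [IsProbabilityMeasure P]
  {H : Type*} [NormedAddCommGroup H] [InnerProductSpace ℝ H] [CompleteSpace H]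
  [SecondCountableTopology H] [MeasurableSpace H] [BorelSpace H] {dx d : ℕ}
  {S : Design Ω H dx d} {Θ : Set (Vec2 d)} {ρ : ℝ} (hS : ModelConditions P S Θ ρ)
include hS

lemma measurable_V_apply (l : Fin d) :
    Measurable fun p : (Fin dx → ℝ) × Vec d × ℝ => p.2.1 l := by fun_prop

lemma mean_V_mul_Z (l : Fin d) : S.mean P (fun p => p.2.1 l) = 0 := by
  obtain ⟨C, hC⟩ := hS.exists_ae_norm_V_le
  have hb : ∀ᵐ ω ∂P, |S.V 0 ω l| ≤ C := by
    filter_upwards [hC] with ω h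
    exact (PiLp.norm_apply_le (S.V 0 ω) l).trans (h 0)
  have hL := hS.memLp_smul_Z (i := 0) (hS.measurable_V_apply l) hb
  have hi : Integrable (fun ω => S.V 0 ω l • S.Zi 0 ω) P := hL.integrable (by norm_num)
  refine ext_inner_left ℝ (fun u : H => ?_)
  rw [inner_zero_right]
  change inner ℝ u (∫ ω, S.V 0 ω l • S.Zi 0 ω ∂P) = 0
  rw [← integral_inner hi]
  have e : ∀ ω, inner ℝ u (S.V 0 ω l • S.Zi 0 ω) =
      inner ℝ (EuclideanSpace.single l (1 : ℝ)) (S.V 0 ω) * inner ℝ u (S.Zi 0 ω) := fun ω => by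
    rw [inner_smul_right, EuclideanSpace.inner_single_left]
    simp
  have hi2 := hi.const_inner (𝕜 := ℝ) u
  simp_rw [e] at hi2 ⊢
  refine hS.integral_V_mul_eq_zero 0 _ ?_ hi2
  have h1 : Measurable[MeasurableSpace.comap (S.x 0) inferInstance] (S.Zi 0) :=
    hS.meas_Z.comp (comap_measurable (S.x 0))
  exact (measurable_const.inner h1).stronglyMeasurable.mono le_sup_left

/-- Each coordinate of the noise is an average of `V_l Z`, centred because `E[V | x] = 0`, so the
fourth moment bound for averages applies. Fourth moments are needed because the noise is later
multiplied by another fluctuating quantity. -/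
lemma exists_noiseBd : ∃ B : ℝ, 0 < B ∧ ∀ n : ℕ, 1 ≤ n → MemLp (S.noiseBd n) 4 P ∧
    ∫ ω, ‖S.noiseBd n ω‖ ^ 4 ∂P ≤ B * (n : ℝ)⁻¹ ^ 2 := by
  obtain ⟨C, hC⟩ := hS.exists_ae_norm_V_le
  obtain ⟨B, hB0, hB⟩ := hS.exists_fourth_moment C
  have h1 : ∀ l n, 1 ≤ n → MemLp (S.noiseVec n l) 4 P ∧
      ∫ ω, ‖S.noiseVec n l ω‖ ^ 4 ∂P ≤ B * (n : ℝ)⁻¹ ^ 2 := by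
    intro l n hn
    have hb : ∀ᵐ ω ∂P, |(S.obs 0 ω).2.1 l| ≤ C := by
      filter_upwards [hC] with ω h
      exact (PiLp.norm_apply_le (S.V 0 ω) l).trans (h 0)
    have := hB _ (hS.measurable_V_apply l) hb n hn
    rw [hS.mean_V_mul_Z l] at this
    simp only [sub_zero] at this
    exact this
  refine ⟨(d : ℝ) ^ 4 * B + 1, by positivity, fun n hn => ⟨?_, ?_⟩⟩
  · exact memLp_finsetSum _ fun l _ => (h1 l n hn).1.norm
  have hi : ∀ l, Integrable (fun ω => ‖S.noiseVec n l ω‖ ^ 4) P := fun l =>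
    integrable_norm_pow_four_of_memLp (h1 l n hn).1
  have hL : MemLp (S.noiseBd n) 4 P := memLp_finsetSum _ fun l _ => (h1 l n hn).1.norm
  calc ∫ ω, ‖S.noiseBd n ω‖ ^ 4 ∂P ≤ ∫ ω, (d : ℝ) ^ 3 * ∑ l, ‖S.noiseVec n l ω‖ ^ 4 ∂P := by
        refine integral_mono (integrable_norm_pow_four_of_memLp hL)
          ((integrable_finsetSum _ fun l _ => hi l).const_mul _) fun ω => ?_
        simp only
        rw [Real.norm_of_nonneg (S.noiseBd_nonneg n ω), Design.noiseBd]

        have h3 := pow_le_pow_left₀ (sq_nonneg _) (sq_sum_le_card_mul_sum_sq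
          (s := (Finset.univ : Finset (Fin d))) (f := fun l => ‖S.noiseVec n l ω‖)) 2
        have h4 := sq_sum_le_card_mul_sum_sq
          (s := (Finset.univ : Finset (Fin d))) (f := fun l => ‖S.noiseVec n l ω‖ ^ 2)
        simp only [Finset.card_univ, Fintype.card_fin, ← pow_mul] at h3 h4
        refine h3.trans ?_
        rw [mul_pow]
        calc (d : ℝ) ^ 2 * _ ≤ (d : ℝ) ^ 2 * (d * ∑ l, ‖S.noiseVec n l ω‖ ^ 4) := by gcongr
          _ = _ := by ring
    _ = (d : ℝ) ^ 3 * ∑ l, ∫ ω, ‖S.noiseVec n l ω‖ ^ 4 ∂P := by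
        rw [integral_const_mul, integral_finsetSum _ fun l _ => hi l]
    _ ≤ (d : ℝ) ^ 3 * ∑ _l : Fin d, B * (n : ℝ)⁻¹ ^ 2 := by
        refine mul_le_mul_of_nonneg_left (Finset.sum_le_sum fun l _ => (h1 l n hn).2)
          (by positivity)
    _ = (d : ℝ) ^ 4 * B * (n : ℝ)⁻¹ ^ 2 := by
        simp only [Finset.sum_const, Finset.card_univ, Fintype.card_fin, nsmul_eq_mul]
        ring
    _ ≤ _ := by
        gcongr
        linarith

lemma measurable_noise (n : ℕ) {b : Ω → H} (hb : Measurable b) :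
    Measurable fun ω => S.noise n ω (b ω) := by
  unfold Design.noise
  have h1 : ∀ j, Measurable fun ω => (inner ℝ (S.Zi j ω) (b ω) : ℝ) := fun j =>
    (hS.measurable_Z j).inner hb
  have h : Measurable fun ω => ∑ j ∈ Finset.range n, (inner ℝ (S.Zi j ω) (b ω) : ℝ) • S.V j ω :=
    Finset.measurable_fun_sum _ fun j _ => (h1 j).smul (hS.meas_V j)
  exact h.const_smul (n : ℝ)⁻¹

lemma measurableSet_trN_le (n : ℕ) (M : ℝ) : MeasurableSet[S.sigmaX] {ω | S.trN n ω ≤ M} := by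
  have h1 : ∀ i, Measurable[S.sigmaX] fun ω => ‖S.Zi i ω‖ ^ 2 := fun i =>
    (measurable_norm.pow_const 2).comp (hS.measurable_Z_sigmaX i)
  have h : Measurable[S.sigmaX] (S.trN n) :=
    (Finset.measurable_fun_sum _ fun i _ => h1 i).const_mul _
  exact h measurableSet_Iic

/-- Bound on the bias of the regularized inverse at the source elements. -/
lemma exists_bias_bound {q : ℝ → ℝ → ℝ} (hq : IsRegularization q ρ) (M : ℝ) : ∃ C : ℝ, 0 < C ∧
    ∀ (n : ℕ) (a : ℝ), 1 ≤ n → 0 < a → a ≤ 1 → ∃ Y : Ω → ℝ,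
      (∀ A, SqLe P A Y (C * (a ^ 2 + (n : ℝ)⁻¹))) ∧ ∀ ω, S.trN n ω ≤ M →
      ‖fc (fun κ => Real.sqrt κ * resid q a κ) (S.covN n ω)
        (S.Pi0.adjoint ((S.D n).adjoint S.psi0))‖ ≤ Y ω := by
  obtain ⟨s, C1, hs1, hsρ, hC10, -, -, hC1⟩ := hq.exists_consts
  obtain ⟨W, hW0, hW⟩ := hS.exists_sum_norm_src_le hsρ
  obtain ⟨CD, hCD0, hCD⟩ := hS.exists_norm_D_le
  -- One interval must contain the spectra of both operators for the Lipschitz constant of `κ ↦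
  -- κ^s`. On the event considered, the trace bounds the norm of `K_n` by `M`.
  set M' := max M ‖S.cov P‖ with hM'
  have hM'0 : 0 ≤ M' := (norm_nonneg (S.cov P)).trans (le_max_right _ _)
  set W' : ℝ := W * (CD * ‖S.psi0‖) with hW'
  have hW'0 : 0 ≤ W' := by positivity
  set L : ℝ := s * M' ^ (s - 1) with hL
  have hL0 : 0 ≤ L := by positivity
  set m4 := ∫ ω, ‖S.Zi 0 ω‖ ^ 4 ∂P with hm4
  have hm40 : 0 ≤ m4 := integral_nonneg fun ω => by positivity
  refine ⟨4 * (C1 * W') ^ 2 + 8 * ((Real.sqrt M' * L) ^ 2 * (W' ^ 2 * m4)) + 4 * M' + 1,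
    by positivity, fun n a hn ha ha1 => ?_⟩
  set π := S.Pi0.adjoint ((S.D n).adjoint S.psi0) with hπ
  have hn0 : (0 : ℝ) < n := by exact_mod_cast hn
  have hη : 0 < Real.sqrt (n : ℝ)⁻¹ := Real.sqrt_pos.2 (by positivity)
  -- The eigenexpansion is truncated to accuracy `n^{-1/2}`. The set `t` may grow with `n`, because
  -- no later bound depends on its size.
  obtain ⟨t, ht⟩ : ∃ t : Finset ℝ, ‖π - ∑ κ ∈ t, eigProj (S.cov P) κ π‖ ≤ Real.sqrt (n : ℝ)⁻¹ := by
    have h := hasSum_eigProj hS.cov_symm hS.isCompactOperator_cov π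
    have h2 := (Metric.tendsto_nhds.1 h) _ hη
    obtain ⟨t, ht⟩ := h2.exists
    refine ⟨t, ?_⟩
    rw [dist_comm, dist_eq_norm] at ht
    exact ht.le
  have hsrc : ∑ κ ∈ t, ‖src (S.cov P) s π κ‖ ^ 2 ≤ W' ^ 2 := by
    refine (hW _ t).trans (pow_le_pow_left₀ (by positivity) ?_ 2)
    refine mul_le_mul_of_nonneg_left ?_ hW0
    refine ((S.D n).adjoint.le_opNorm _).trans ?_
    rw [LinearIsometryEquiv.norm_map]
    gcongr
    exact hCD n
  obtain ⟨hδL, hδ⟩ := hS.integral_sq_sum_cov_sub_le t π hsrc hn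
  set δ : Ω → ℝ := fun ω => ∑ κ ∈ t, ‖(S.cov P - S.covN n ω) (src (S.cov P) s π κ)‖ with hδd
  refine ⟨fun ω => (C1 * a * W' + Real.sqrt M' * Real.sqrt (n : ℝ)⁻¹)
    + Real.sqrt M' * L * δ ω, fun A => ?_, fun ω hω => ?_⟩
  · have h1 : SqLe P A δ (W' ^ 2 * ((n : ℝ)⁻¹ * m4)) :=
      SqLe.of_integral_le hδL (by simpa only [Real.norm_eq_abs, sq_abs] using hδ)
    have h2 : SqLe P A (fun ω => Real.sqrt M' * L * δ ω)
        ((Real.sqrt M' * L) ^ 2 * (W' ^ 2 * ((n : ℝ)⁻¹ * m4))) := by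
      refine h1.of_le (hδL.const_mul _).1 (Eventually.of_forall fun ω => ?_)
      rw [norm_mul, Real.norm_of_nonneg (by positivity)]
    refine ((SqLe.const (P := P) (A := A)
      (C1 * a * W' + Real.sqrt M' * Real.sqrt (n : ℝ)⁻¹)).add h2).mono ?_
    rw [Real.norm_eq_abs, sq_abs]
    have e1 : (C1 * a * W' + Real.sqrt M' * Real.sqrt (n : ℝ)⁻¹) ^ 2 ≤
        2 * ((C1 * W') ^ 2 * a ^ 2 + M' * (n : ℝ)⁻¹) := by
      have e2 := add_sq_le (a := C1 * a * W') (b := Real.sqrt M' * Real.sqrt (n : ℝ)⁻¹)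
      rw [mul_pow (Real.sqrt M'), Real.sq_sqrt hM'0, Real.sq_sqrt (by positivity)] at e2
      refine e2.trans (le_of_eq ?_)
      ring
    set N : ℝ := (n : ℝ)⁻¹
    have hN : 0 ≤ N := by positivity
    have p1 : 0 ≤ (Real.sqrt M' * L) ^ 2 * (W' ^ 2 * m4) := by positivity
    have p2 : 0 ≤ (C1 * W') ^ 2 := sq_nonneg _
    have p3 : (Real.sqrt M' * L) ^ 2 * (W' ^ 2 * (N * m4)) =
        (Real.sqrt M' * L) ^ 2 * (W' ^ 2 * m4) * N := by ring
    rw [p3]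
    set Q := (Real.sqrt M' * L) ^ 2 * (W' ^ 2 * m4)
    set U := (C1 * W') ^ 2
    have := sq_nonneg a
    nlinarith [mul_nonneg p1 hN, mul_nonneg p2 hN, mul_nonneg hM'0 hN, mul_nonneg p1 this,
      mul_nonneg hM'0 this]
  · obtain ⟨s0, hs0⟩ := S.exists_spec_covN n ω
    have h := hs0.norm_sqrt_resid_le (S.covN_nonneg n ω) hS.cov_nonneg hS.cov_symm hq ha
      (by linarith : 1 ≤ s) hM'0 (((S.norm_covN_le n ω).trans hω).trans (le_max_left _ _))
      (le_max_right _ _) (fun κ hκ => hC1 κ a hκ ha ha1)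
      (hS.eigProj_zero_adjoint ((S.D n).adjoint S.psi0)) t hsrc hW'0
    refine h.trans ?_
    have h3 := mul_le_mul_of_nonneg_left ht (Real.sqrt_nonneg M')
    simp only [hδd]
    nlinarith [h3]

end ModelConditions

/-! ### Mean square error of linear functionals of the first stage -/

namespace ModelConditions

variable {Ω : Type*} [mΩ : MeasurableSpace Ω] {P : Measure Ω} [IsProbabilityMeasure P]
  {H : Type*} [NormedAddCommGroup H] [InnerProductSpace ℝ H] [CompleteSpace H]
  [SecondCountableTopology H] [MeasurableSpace H] [BorelSpace H] {dx d : ℕ}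
  {S : Design Ω H dx d} {Θ : Set (Vec2 d)} {ρ : ℝ} (hS : ModelConditions P S Θ ρ)
include hS

omit hS in
/-- Constants of the regularized inverse of the sample covariance operator. -/
lemma exists_norm_regInv_le {q : ℝ → ℝ → ℝ} (hq : IsRegularization q ρ) : ∃ C : ℝ, 0 < C ∧
    ∀ (n : ℕ) (ω : Ω) (a : ℝ) (v : H), 0 < a → a ≤ 1 →
      ‖regInv q a (S.covN n ω) v‖ ≤ C * (Real.sqrt a)⁻¹ * ‖v‖ ∧
      inner ℝ (regInv q a (S.covN n ω) v) (S.covN n ω (regInv q a (S.covN n ω) v))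
        ≤ C * (Real.sqrt a)⁻¹ * ‖v‖ ^ 2 := by
  obtain ⟨s, C, -, -, hC0, h1, h2, -⟩ := hq.exists_consts
  refine ⟨C, hC0, fun n ω a v ha ha1 => ?_⟩
  obtain ⟨t, ht⟩ := S.exists_spec_covN n ω
  refine ⟨ht.norm_regInv_le (S.covN_nonneg n ω) (fun κ hκ => h1 κ a hκ ha ha1) v, ?_⟩
  rw [regInv_eq_fc, ht.inner_fc_apply_fc (S.covN_nonneg n ω)]
  have hc : 0 ≤ C * (Real.sqrt a)⁻¹ := by positivity
  have h3 := ht.norm_fc_le (S.covN_nonneg n ω) (h := fun κ => Real.sqrt κ * (κ⁻¹ * q κ a))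
    (C := Real.sqrt (C * (Real.sqrt a)⁻¹))
    (fun κ hκ _ => Real.le_sqrt_of_sq_le (h2 κ a hκ ha ha1)) (Real.sqrt_nonneg _) v
  refine (pow_le_pow_left₀ (norm_nonneg _) h3 2).trans (le_of_eq ?_)
  rw [mul_pow, Real.sq_sqrt hc]

/-- For a nonrandom `v` the weights `⟨Z_j, Rv⟩` are functions of `x`, so the terms with different
`V_j` are orthogonal. The sum of squared weights is `n⟨Rv, K_n R v⟩`, of order `n α^{-1/2}`. This is
the leading variance. -/
lemma sqLe_inner_noise {q : ℝ → ℝ → ℝ} (hq : IsRegularization q ρ) : ∃ C : ℝ, 0 < C ∧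
    ∀ (n : ℕ) (a : ℝ) (v : H), 1 ≤ n → 0 < a → a ≤ 1 → ∀ A, SqLe P A
      (fun ω => inner ℝ S.psi0 (S.noise n ω (regInv q a (S.covN n ω) v)))
      (C * ‖v‖ ^ 2 * ((n : ℝ)⁻¹ * (Real.sqrt a)⁻¹)) := by
  obtain ⟨C1, hC10, hR⟩ := exists_norm_regInv_le (S := S) hq
  obtain ⟨CV, hCV⟩ := hS.exists_ae_norm_V_le
  refine ⟨(‖S.psi0‖ * CV) ^ 2 * C1 + 1, by positivity, fun n a v hn ha ha1 A => ?_⟩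
  have hn0 : (n : ℝ) ≠ 0 := by positivity
  set b : ℕ → Ω → ℝ := fun j ω => inner ℝ (S.Zi j ω) (regInv q a (S.covN n ω) v) with hb
  have hbm : ∀ j, Measurable[S.sigmaX] (b j) := fun j =>
    (hS.measurable_Z_sigmaX j).inner (hS.measurable_regInv le_rfl hq a n measurable_const)
  have hbL : ∀ j, MemLp (b j) 2 P := fun j => by
    refine (hS.memLp_Z j).of_le_mul (c := C1 * (Real.sqrt a)⁻¹ * ‖v‖)
      ((hbm j).mono hS.sigmaX_le le_rfl).aestronglyMeasurable (Eventually.of_forall fun ω => ?_)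
    refine (norm_inner_le_norm _ _).trans ?_
    rw [mul_comm]
    gcongr
    exact (hR n ω a v ha ha1).1
  have hvC : ∀ i, ∀ᵐ ω ∂P, |inner ℝ S.psi0 (S.V i ω)| ≤ ‖S.psi0‖ * CV := fun i => by
    filter_upwards [hCV] with ω h
    refine (abs_real_inner_le_norm _ _).trans ?_
    gcongr
    exact h i
  obtain ⟨hL, hI⟩ := hS.integral_sq_sum_V_mul_le S.psi0 n hvC
    (fun j _ => (hbm j).stronglyMeasurable) (fun j _ => hbL j)
  have hsum : ∑ j ∈ Finset.range n, ∫ ω, b j ω ^ 2 ∂P ≤ n * (C1 * (Real.sqrt a)⁻¹ * ‖v‖ ^ 2) := by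
    have hi : ∀ j, Integrable (fun ω => b j ω ^ 2) P := fun j => (hbL j).integrable_sq
    rw [← integral_finsetSum _ fun j _ => hi j]
    have hle : ∀ ω, ∑ j ∈ Finset.range n, b j ω ^ 2 ≤ n * (C1 * (Real.sqrt a)⁻¹ * ‖v‖ ^ 2) := by
      intro ω
      have h := (hR n ω a v ha ha1).2
      rw [S.inner_covN, inv_mul_le_iff₀ (by positivity)] at h
      simpa only [← sq] using h
    refine (integral_mono (integrable_finsetSum _ fun j _ => hi j) (integrable_const _) hle).trans ?_
    simp
  simp_rw [S.inner_noise]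
  refine SqLe.of_integral_le (hL.const_mul _) ?_
  simp only [norm_mul, mul_pow, Real.norm_eq_abs, sq_abs]
  rw [integral_const_mul]
  calc (n : ℝ)⁻¹ ^ 2 * _ ≤ (n : ℝ)⁻¹ ^ 2 * ((‖S.psi0‖ * CV) ^ 2 *
        (n * (C1 * (Real.sqrt a)⁻¹ * ‖v‖ ^ 2))) := by
        refine mul_le_mul_of_nonneg_left (hI.trans ?_) (by positivity)
        exact mul_le_mul_of_nonneg_left hsum (sq_nonneg _)
    _ = (‖S.psi0‖ * CV) ^ 2 * C1 * ‖v‖ ^ 2 * ((n : ℝ)⁻¹ * (Real.sqrt a)⁻¹) := by field_simp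
    _ ≤ _ := by
        gcongr
        linarith

lemma measurable_regInv' {q : ℝ → ℝ → ℝ} (hq : IsRegularization q ρ) (a : ℝ) (n : ℕ) {b : Ω → H}
    (hb : Measurable b) : Measurable fun ω => regInv q a (S.covN n ω) (b ω) :=
  hS.measurable_regInv hS.sigmaX_le hq a n hb

lemma norm_mean_le {φ : (Fin dx → ℝ) × Vec d × ℝ → ℝ} {C : ℝ}
    (hC : ∀ᵐ ω ∂P, ∀ i, |φ (S.obs i ω)| ≤ C) : ‖S.mean P φ‖ ≤ C * ∫ ω, ‖S.Zi 0 ω‖ ∂P := by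
  rw [Design.mean, ← integral_const_mul]
  refine norm_integral_le_of_norm_le ((hS.integrable_Z 0).norm.const_mul _) ?_
  filter_upwards [hC] with ω h
  rw [norm_smul]
  exact mul_le_mul_of_nonneg_right (h 0) (norm_nonneg _)

/-- Effect of replacing a mean by a sample average in the noise part. -/
lemma sqLe_inner_noise_dev {q : ℝ → ℝ → ℝ} (hq : IsRegularization q ρ) (C : ℝ) :
    ∃ B : ℝ, 0 < B ∧ ∀ φ : (Fin dx → ℝ) × Vec d × ℝ → ℝ, Measurable φ →
    (∀ᵐ ω ∂P, ∀ i, |φ (S.obs i ω)| ≤ C) →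
    ∀ (n : ℕ) (a : ℝ), 1 ≤ n → 0 < a → a ≤ 1 → 1 ≤ n * a → ∀ A, SqLe P A
      (fun ω => inner ℝ S.psi0 (S.noise n ω (regInv q a (S.covN n ω)
        (S.avg φ n ω - S.mean P φ)))) (B * (n : ℝ)⁻¹) := by
  obtain ⟨C1, hC10, hR⟩ := exists_norm_regInv_le (S := S) hq
  obtain ⟨B1, hB10, hB1⟩ := hS.exists_noiseBd
  obtain ⟨B2, hB20, hB2⟩ := hS.exists_fourth_moment C
  refine ⟨(‖S.psi0‖ * C1) ^ 2 * ((B1 + B2) / 2) + 1, by positivity,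
    fun φ hφ hC n a hn ha ha1 hna A => ?_⟩
  have hn0 : (0 : ℝ) < n := by positivity
  obtain ⟨hL1, hI1⟩ := hB1 n hn
  obtain ⟨hL2, hI2⟩ := hB2 φ hφ (by filter_upwards [hC] with ω h using h 0) n hn
  -- The deviation depends on the `V_j` and the orthogonality argument is not available. Two
  -- fluctuations of size `n^{-1/2}` are multiplied instead.
  have h1 := (sqLe_mul_of_memLp_four (A := A) hL1 hL2.norm).mono
    (b' := (B1 + B2) / 2 * (n : ℝ)⁻¹ ^ 2) (by
      simp only [norm_norm] at hI2 ⊢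
      linarith)
  refine (h1.of_le (c := ‖S.psi0‖ * (C1 * (Real.sqrt a)⁻¹)) ?_ ?_).mono ?_
  · exact (measurable_const.inner (hS.measurable_noise n (hS.measurable_regInv' hq a n
      ((hS.measurable_avg hφ n).sub measurable_const)))).aestronglyMeasurable
  · refine Eventually.of_forall fun ω => (norm_inner_le_norm _ _).trans ?_
    rw [mul_assoc]
    refine mul_le_mul_of_nonneg_left ((S.norm_noise_le _ _ _).trans ?_) (norm_nonneg _)
    rw [Real.norm_of_nonneg (mul_nonneg (S.noiseBd_nonneg n ω) (norm_nonneg _))]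
    have h2 := mul_le_mul_of_nonneg_left (hR n ω a (S.avg φ n ω - S.mean P φ) ha ha1).1
      (S.noiseBd_nonneg n ω)
    exact h2.trans (le_of_eq (by ring))
  · rw [mul_pow, mul_pow, inv_pow, Real.sq_sqrt ha.le]
    -- The crude operator bound loses `a⁻¹`, which `1 ≤ n a` turns into one lost power of `n`.
    have h3 : a⁻¹ * (n : ℝ)⁻¹ ^ 2 ≤ (n : ℝ)⁻¹ := by
      rw [sq, ← mul_assoc, ← mul_inv, mul_comm a]
      exact mul_le_of_le_one_left (by positivity) (inv_le_one_of_one_le₀ hna)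
    calc ‖S.psi0‖ ^ 2 * (C1 ^ 2 * a⁻¹) * ((B1 + B2) / 2 * (n : ℝ)⁻¹ ^ 2)
        = (‖S.psi0‖ * C1) ^ 2 * ((B1 + B2) / 2) * (a⁻¹ * (n : ℝ)⁻¹ ^ 2) := by ring
      _ ≤ (‖S.psi0‖ * C1) ^ 2 * ((B1 + B2) / 2) * (n : ℝ)⁻¹ := by gcongr
      _ ≤ _ := by
        gcongr
        linarith

lemma measurable_resid {q : ℝ → ℝ → ℝ} (hq : IsRegularization q ρ) (a : ℝ) :
    Measurable (resid q a) :=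
  measurable_const.sub (measurable_id.mul (measurable_inv.mul (hq.measurable a)))

omit hS in
lemma norm_fc_resid_le {q : ℝ → ℝ → ℝ} (hq : IsRegularization q ρ) {a : ℝ} (ha : 0 < a) (n : ℕ)
    (ω : Ω) (v : H) : ‖fc (resid q a) (S.covN n ω) v‖ ≤ ‖v‖ := by
  obtain ⟨t, ht⟩ := S.exists_spec_covN n ω
  simpa using ht.norm_fc_le (S.covN_nonneg n ω) (C := 1)
    (fun κ hκ _ => abs_resid_le hq hκ ha) zero_le_one v

lemma measurable_fc_resid {q : ℝ → ℝ → ℝ} (hq : IsRegularization q ρ) (a : ℝ) (n : ℕ) {b : Ω → H}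
    (hb : Measurable b) : Measurable fun ω => fc (resid q a) (S.covN n ω) (b ω) :=
  hS.measurable_fc_covN hS.sigmaX_le n (hS.measurable_resid hq a) hb

lemma exists_norm_adjoint_le :
    ∃ C : ℝ, 0 < C ∧ ∀ n, ‖S.Pi0.adjoint ((S.D n).adjoint S.psi0)‖ ≤ C := by
  obtain ⟨CD, hCD0, hCD⟩ := hS.exists_norm_D_le
  refine ⟨‖S.Pi0‖ * (CD * ‖S.psi0‖) + 1, by positivity, fun n => ?_⟩
  refine (S.Pi0.adjoint.le_opNorm _).trans ?_
  rw [LinearIsometryEquiv.norm_map]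
  have h1 : ‖(S.D n).adjoint S.psi0‖ ≤ CD * ‖S.psi0‖ := by
    refine ((S.D n).adjoint.le_opNorm _).trans ?_
    rw [LinearIsometryEquiv.norm_map]
    gcongr
    exact hCD n
  have := mul_le_mul_of_nonneg_left h1 (norm_nonneg S.Pi0)
  linarith

/-- Effect of replacing a mean by a sample average in the bias part. -/
lemma sqLe_inner_resid_dev {q : ℝ → ℝ → ℝ} (hq : IsRegularization q ρ) (C : ℝ) :
    ∃ B : ℝ, 0 < B ∧ ∀ φ : (Fin dx → ℝ) × Vec d × ℝ → ℝ, Measurable φ →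
    (∀ᵐ ω ∂P, ∀ i, |φ (S.obs i ω)| ≤ C) → ∀ (n : ℕ) (a : ℝ), 1 ≤ n → 0 < a → ∀ A, SqLe P A
      (fun ω => inner ℝ (fc (resid q a) (S.covN n ω) (S.Pi0.adjoint ((S.D n).adjoint S.psi0)))
        (S.avg φ n ω - S.mean P φ)) (B * (n : ℝ)⁻¹) := by
  obtain ⟨B2, hB20, hB2⟩ := hS.exists_fourth_moment C
  obtain ⟨Cπ, hCπ0, hCπ⟩ := hS.exists_norm_adjoint_le
  refine ⟨Cπ ^ 2 * ((B2 + 1) / 2), by positivity, fun φ hφ hC n a hn ha A => ?_⟩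
  have hn0 : (0 : ℝ) < n := by positivity
  obtain ⟨hL2, hI2⟩ := hB2 φ hφ (by filter_upwards [hC] with ω h using h 0) n hn
  have hL : MemLp (fun ω => S.avg φ n ω - S.mean P φ) 2 P := hL2.mono_exponent (by norm_num)
  have i4 := integrable_norm_pow_four_of_memLp hL2
  have h1 : SqLe P A (fun ω => S.avg φ n ω - S.mean P φ) ((B2 + 1) / 2 * (n : ℝ)⁻¹) := by
    refine SqLe.of_integral_le hL ?_
    -- The inequality `x ≤ n x²/2 + 1/(2n)` converts the fourth moment bound of order `n⁻²` into a
    -- second moment bound of order `n⁻¹`.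
    have hle : ∀ ω, ‖S.avg φ n ω - S.mean P φ‖ ^ 2 ≤
        n / 2 * ‖S.avg φ n ω - S.mean P φ‖ ^ 4 + (n : ℝ)⁻¹ / 2 := fun ω => by
      set x := ‖S.avg φ n ω - S.mean P φ‖ ^ 2
      have e : ‖S.avg φ n ω - S.mean P φ‖ ^ 4 = x ^ 2 := by rw [← pow_mul]
      have e2 : n / 2 * x ^ 2 + (n : ℝ)⁻¹ / 2 - x = (n : ℝ)⁻¹ / 2 * (n * x - 1) ^ 2 := by
        field_simp
        ring
      have e3 : 0 ≤ (n : ℝ)⁻¹ / 2 * (n * x - 1) ^ 2 := by positivity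
      rw [e]
      linarith
    have i5 : Integrable (fun ω => (n : ℝ) / 2 * ‖S.avg φ n ω - S.mean P φ‖ ^ 4) P :=
      i4.const_mul _
    have i6 : Integrable (fun ω => (n : ℝ) / 2 * ‖S.avg φ n ω - S.mean P φ‖ ^ 4 + (n : ℝ)⁻¹ / 2) P :=
      i5.add (integrable_const _)
    refine (integral_mono (integrable_norm_sq_of_memLp hL) i6 hle).trans ?_
    rw [integral_add i5 (integrable_const _), integral_const_mul, integral_const]
    simp only [probReal_univ, smul_eq_mul, one_mul]
    have h2 := mul_le_mul_of_nonneg_left hI2 (by positivity : (0 : ℝ) ≤ n / 2)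
    have e3 : (n : ℝ) / 2 * (B2 * (n : ℝ)⁻¹ ^ 2) = B2 / 2 * (n : ℝ)⁻¹ := by field_simp
    rw [e3] at h2
    linarith
  refine (h1.of_le (c := Cπ) ?_ ?_).mono (le_of_eq (by ring))
  · exact ((hS.measurable_fc_resid hq a n measurable_const).inner
      ((hS.measurable_avg hφ n).sub measurable_const)).aestronglyMeasurable
  · refine Eventually.of_forall fun ω => (norm_inner_le_norm _ _).trans ?_
    gcongr
    exact (norm_fc_resid_le hq ha n ω _).trans (hCπ n)

/-- The bias part at a sample average. -/
lemma sqLe_inner_resid_avg {q : ℝ → ℝ → ℝ} (hq : IsRegularization q ρ) (C M : ℝ) :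
    ∃ B : ℝ, 0 < B ∧ ∀ φ : (Fin dx → ℝ) × Vec d × ℝ → ℝ, Measurable φ →
    (∀ᵐ ω ∂P, ∀ i, |φ (S.obs i ω)| ≤ C) → ∀ (n : ℕ) (a : ℝ), 1 ≤ n → 0 < a → a ≤ 1 →
      SqLe P {ω | S.trN n ω ≤ M}
      (fun ω => inner ℝ (fc (resid q a) (S.covN n ω) (S.Pi0.adjoint ((S.D n).adjoint S.psi0)))
        (S.avg φ n ω)) (B * (a ^ 2 + (n : ℝ)⁻¹)) := by
  obtain ⟨B, hB0, hB⟩ := hS.exists_bias_bound hq M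
  refine ⟨|C| ^ 2 * B + 1, by positivity, fun φ hφ hC n a hn ha ha1 => ?_⟩
  obtain ⟨Y, hY, hYle⟩ := hB n a hn ha ha1
  have hA := hS.sigmaX_le _ (hS.measurableSet_trN_le n M)
  have hY2 : SqLe P {ω | S.trN n ω ≤ M} (fun ω => |C| * Y ω) (|C| ^ 2 * (B * (a ^ 2 + (n : ℝ)⁻¹))) :=
    (hY _).of_le ((hY ∅).memLp.const_mul _).1 (Eventually.of_forall fun ω => by
      rw [norm_mul, Real.norm_of_nonneg (abs_nonneg C)])
  have havg : MemLp (S.avg φ n) 2 P := by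
    have h : MemLp (fun ω => ∑ i ∈ Finset.range n, φ (S.obs i ω) • S.Zi i ω) 2 P :=
      memLp_finsetSum _ fun i _ =>
        (hS.memLp_smul_Z hφ (C := C) (by filter_upwards [hC] with ω h using h i)).mono_exponent
          (by norm_num)
    exact h.const_smul (n : ℝ)⁻¹
  have hX : MemLp (fun ω => inner ℝ (fc (resid q a) (S.covN n ω)
      (S.Pi0.adjoint ((S.D n).adjoint S.psi0))) (S.avg φ n ω)) 2 P := by
    refine havg.of_le_mul (c := ‖S.Pi0.adjoint ((S.D n).adjoint S.psi0)‖) ?_ ?_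
    · exact ((hS.measurable_fc_resid hq a n measurable_const).inner
        (hS.measurable_avg hφ n)).aestronglyMeasurable
    · refine Eventually.of_forall fun ω => (norm_inner_le_norm _ _).trans ?_
      gcongr
      exact norm_fc_resid_le hq ha n ω _
  refine (SqLe.of_le_on hX hY2 hA ?_).mono ?_
  · filter_upwards [hC] with ω h hω
    obtain ⟨t, ht⟩ := S.exists_spec_covN n ω
    -- The pairing is reduced to `‖K_n^{1/2} r(K_n) π‖`, the quantity for which the bias bound was
    -- prepared.
    have h1 := S.abs_inner_avg_le h (n := n) (fc (resid q a) (S.covN n ω)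
      (S.Pi0.adjoint ((S.D n).adjoint S.psi0)))
    rw [ht.inner_fc_apply_fc (S.covN_nonneg n ω)] at h1
    have h2 := hYle ω hω
    rw [Real.norm_eq_abs, Real.norm_eq_abs]
    refine sq_le_sq.1 (h1.trans ?_)
    rw [mul_pow, sq_abs]
    exact mul_le_mul_of_nonneg_left (pow_le_pow_left₀ (norm_nonneg _) h2 2) (sq_nonneg _)
  · have : 0 ≤ a ^ 2 + (n : ℝ)⁻¹ := by positivity
    nlinarith

/-- Mean square of `⟨ψ₀, (Π̂ - Π) v⟩` for a sample average `v` and for its mean. -/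
lemma sqLe_inner_err {q : ℝ → ℝ → ℝ} (hq : IsRegularization q ρ) (C M : ℝ) :
    ∃ B : ℝ, 0 < B ∧ ∀ φ : (Fin dx → ℝ) × Vec d × ℝ → ℝ, Measurable φ →
    (∀ᵐ ω ∂P, ∀ i, |φ (S.obs i ω)| ≤ C) →
    ∀ (n : ℕ) (a : ℝ), 1 ≤ n → 0 < a → a ≤ 1 → 1 ≤ n * a →
      SqLe P {ω | S.trN n ω ≤ M} (fun ω => inner ℝ S.psi0 (S.err q a n ω (S.avg φ n ω)))
        (B * mseRate 1 1 n a) ∧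
      SqLe P {ω | S.trN n ω ≤ M} (fun ω => inner ℝ S.psi0 (S.err q a n ω (S.mean P φ)))
        (B * mseRate 1 1 n a) := by
  obtain ⟨B1, hB10, h1⟩ := hS.sqLe_inner_noise hq
  obtain ⟨B2, hB20, h2⟩ := hS.sqLe_inner_noise_dev hq C
  obtain ⟨B3, hB30, h3⟩ := hS.sqLe_inner_resid_dev hq C
  obtain ⟨B4, hB40, h4⟩ := hS.sqLe_inner_resid_avg hq C M
  set m1 := ∫ ω, ‖S.Zi 0 ω‖ ∂P
  set B1' : ℝ := B1 * (C * m1) ^ 2 with hB1'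
  have hB1'0 : 0 ≤ B1' := by positivity
  refine ⟨4 * (B1' + B2 + B3 + 2 * B4), by positivity, fun φ hφ hC n a hn ha ha1 hna => ?_⟩
  set A := {ω | S.trN n ω ≤ M}
  have r0 : (n : ℝ)⁻¹ ≤ mseRate 1 1 n a := inv_le_mseRate ha ha1
  have r1 := mseRate_one_one n ha
  have rn : (0 : ℝ) ≤ (n : ℝ)⁻¹ := by positivity
  have rs : (0 : ℝ) ≤ (n : ℝ)⁻¹ * (Real.sqrt a)⁻¹ := by positivity
  set r := mseRate 1 1 n a
  have ra : a ^ 2 ≤ r := by linarith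
  have rs' : (n : ℝ)⁻¹ * (Real.sqrt a)⁻¹ ≤ r := by nlinarith [sq_nonneg a]
  have hr0 : 0 ≤ r := rn.trans r0
  have g1 := (h1 n a (S.mean P φ) hn ha ha1 A).mono (b' := B1' * r) (by
    have := hS.norm_mean_le hC
    calc B1 * ‖S.mean P φ‖ ^ 2 * ((n : ℝ)⁻¹ * (Real.sqrt a)⁻¹)
        ≤ B1 * (C * m1) ^ 2 * r := by gcongr
      _ = _ := rfl)
  have g2 := (h2 φ hφ hC n a hn ha ha1 hna A).mono (b' := B2 * r)
    (mul_le_mul_of_nonneg_left r0 hB20.le)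
  have g3 := (h3 φ hφ hC n a hn ha A).mono (b' := B3 * r)
    (mul_le_mul_of_nonneg_left r0 hB30.le)
  have g4 := (h4 φ hφ hC n a hn ha ha1).mono (b' := B4 * (2 * r))
    (mul_le_mul_of_nonneg_left (by linarith) hB40.le)
  have p1 := mul_nonneg hB1'0 hr0
  have p2 := mul_nonneg hB20.le hr0
  have p3 := mul_nonneg hB30.le hr0
  have p4 := mul_nonneg hB40.le hr0
  constructor
  -- At the average: the noise is split into its value at the mean and at the deviation, and the
  -- bias is bounded directly.
  · have e := ((g1.add g2).add g4.neg).mono (b' := 4 * (B1' + B2 + B3 + 2 * B4) * r) (by linarith)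
    convert e using 2 with ω
    rw [S.inner_psi0_err, ← inner_add_right, ← S.noise_add, ← map_add, add_sub_cancel,
      sub_eq_add_neg]
  -- At the mean: the noise is bounded directly, while the bias goes through the average, where the
  -- half power of `K_n` is available, and is corrected by the deviation.
  · have e := ((g3.add g4.neg).add g1).mono (b' := 4 * (B1' + B2 + B3 + 2 * B4) * r) (by linarith)
    convert e using 2 with ω
    rw [S.inner_psi0_err, inner_sub_right]
    ring

end ModelConditions

/-! ### Mean square error of the linearized score -/

lemma norm_pair_le {d : ℕ} (a b : Vec d) : ‖pair a b‖ ≤ ‖a‖ + ‖b‖ := by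
  refine (sq_le_sq₀ (norm_nonneg _) (by positivity)).1 ?_
  rw [norm_pair_sq]
  nlinarith [norm_nonneg a, norm_nonneg b]

namespace Design

variable {Ω : Type*} {H : Type*} [NormedAddCommGroup H] [InnerProductSpace ℝ H]
  {dx d : ℕ} (S : Design Ω H dx d)

/-- The weight `w_i ⟨F_i, v⟩` of an instrument in the derivative of the score. -/
noncomputable def wF (c : Criterion) (n : ℕ) (v : Vec2 d) (p : (Fin dx → ℝ) × Vec d × ℝ) : ℝ :=
  wgt c (S.idxD n (p.1, p.2.1)) * inner ℝ v (S.FD (p.1, p.2.1))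

lemma wF_obs (c : Criterion) (n : ℕ) (v : Vec2 d) (i : ℕ) (ω : Ω) :
    S.wF c n v (S.obs i ω) = wgt c (S.idx n i ω) * inner ℝ v (S.F i ω) := by
  rw [idx_eq]
  rfl

lemma abs_wF_le {c : Criterion} {C c₀ : ℝ} {ω : Ω} (h : UniformBound S c C c₀ ω) (n i : ℕ)
    (v : Vec2 d) : |S.wF c n v (S.obs i ω)| ≤ C * (‖v‖ * C) := by
  rw [wF_obs, abs_mul]
  have h1 := abs_real_inner_le_norm v (S.F i ω)
  have h2 := mul_le_mul_of_nonneg_left (h.norm_F i) (norm_nonneg v)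
  exact mul_le_mul (h.abs_wgt n i) (h1.trans h2) (abs_nonneg _) ((abs_nonneg _).trans (h.abs_wgt n i))

/-- The weighted sum of the regressors in terms of the instrument averages `avg`. -/
lemma sum_wgt_smul_F {ι : Type*} [Fintype ι] (b : OrthonormalBasis ι ℝ (Vec2 d)) (c : Criterion)
    (n : ℕ) (B : H →L[ℝ] Vec d) (ω : Ω) :
    (n : ℝ)⁻¹ • ∑ i ∈ Finset.range n,
        (wgt c (S.idx n i ω) * inner ℝ S.psi0 (B (S.Zi i ω))) • S.F i ω
      = ∑ k, (inner ℝ S.psi0 (B (S.avg (S.wF c n (b k)) n ω)) : ℝ) • b k := by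
  have e1 : ∀ k, inner ℝ S.psi0 (B (S.avg (S.wF c n (b k)) n ω)) =
      inner ℝ (b k) ((n : ℝ)⁻¹ • ∑ i ∈ Finset.range n,
        (wgt c (S.idx n i ω) * inner ℝ S.psi0 (B (S.Zi i ω))) • S.F i ω) := by
    intro k
    simp only [avg, map_smul, map_sum, inner_smul_right, inner_sum, wF_obs]
    congr 1
    exact Finset.sum_congr rfl fun i _ => by ring
  simp_rw [e1]
  exact (b.sum_repr' _).symm

/-- Only the first block is exposed to the inverse scaling. Its contribution is kept separate
because signal and noise of the first stage behave differently under `DInv`. -/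
lemma norm_lin_le {c : Criterion} {C c₀ : ℝ} {ω : Ω} (h : UniformBound S c C c₀ ω) (n i : ℕ)
    (B : H →L[ℝ] Vec d) : ‖S.lin c n i B ω‖ ≤
      C * ‖S.DInv n (B (S.Zi i ω))‖ + C * (1 + ‖S.psi0‖ * C) * ‖B (S.Zi i ω)‖ := by
  set z := B (S.Zi i ω)
  have hC : 0 ≤ C := (norm_nonneg _).trans (h.norm_F 0)
  have h1 : ‖S.scaleInv n (pair z (-z))‖ ≤ ‖S.DInv n z‖ + ‖z‖ := by
    rw [scaleInv_eq, pair_fst, pair_snd]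
    exact (norm_pair_le _ _).trans (by rw [norm_neg])
  have h2 : |hfacD c (S.idx n i ω) * inner ℝ S.psi0 z| ≤ C * (‖S.psi0‖ * ‖z‖) := by
    rw [abs_mul]
    exact mul_le_mul (h.abs_hfacD n i) (abs_real_inner_le_norm _ _) (abs_nonneg _) hC
  rw [lin]
  refine (norm_sub_le _ _).trans ?_
  rw [norm_smul, norm_smul, Real.norm_eq_abs, Real.norm_eq_abs]
  have h3 := mul_le_mul (h.abs_hfac n i) h1 (norm_nonneg _) hC
  have h4 := mul_le_mul h2 (h.norm_F i) (norm_nonneg _) (by positivity)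
  linarith

end Design

namespace ModelConditions

variable {Ω : Type*} [mΩ : MeasurableSpace Ω] {P : Measure Ω} [IsProbabilityMeasure P]
  {H : Type*} [NormedAddCommGroup H] [InnerProductSpace ℝ H] [CompleteSpace H]
  [SecondCountableTopology H] [MeasurableSpace H] [BorelSpace H] {dx d : ℕ}
  {S : Design Ω H dx d} {Θ : Set (Vec2 d)} {ρ : ℝ} (hS : ModelConditions P S Θ ρ)
include hS

/-- The inverse scaling can itself be undone by a bounded map, so that integrability may be checked
on the scaled scores, whose form is explicit. -/
lemma adjoint_scaleTL_scaleInv {n : ℕ} (hn : 1 ≤ n) (x : Vec2 d) :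
    (S.scaleTL n).adjoint (S.scaleInv n x) = x := by
  refine ext_inner_right ℝ fun v => ?_
  rw [ContinuousLinearMap.adjoint_inner_left, S.scaleTL_apply, hS.inner_scaleInv_scaleT hn]

lemma integrable_of_scaleInv {n : ℕ} (hn : 1 ≤ n) {f : Ω → Vec2 d}
    (h : Integrable (fun ω => S.scaleInv n (f ω)) P) : Integrable f P := by
  have := (S.scaleTL n).adjoint.integrable_comp h
  simpa only [hS.adjoint_scaleTL_scaleInv hn] using this

lemma measurable_wF (c : Criterion) (n : ℕ) (v : Vec2 d) : Measurable (S.wF c n v) := by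
  have h1 : Measurable fun p : (Fin dx → ℝ) × Vec d × ℝ => (p.1, p.2.1) :=
    measurable_fst.prodMk (measurable_fst.comp measurable_snd)
  exact ((continuous_wgt c).measurable.comp ((hS.measurable_idxD n).comp h1)).mul
    (measurable_const.inner (hS.measurable_FD.comp h1))

lemma measurable_Z_sigmaXV (i : ℕ) : Measurable[S.sigmaXV] (S.Zi i) :=
  hS.meas_Z.comp (measurable_fst.comp (S.measurable_xV_sigmaXV i))

omit hS in
lemma measurable_V_sigmaXV (i : ℕ) : Measurable[S.sigmaXV] (S.V i) :=
  measurable_snd.comp (S.measurable_xV_sigmaXV i)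

lemma measurable_F_sigmaXV (i : ℕ) : Measurable[S.sigmaXV] (S.F i) :=
  hS.measurable_FD.comp (S.measurable_xV_sigmaXV i)

lemma measurable_idx_sigmaXV (n i : ℕ) : Measurable[S.sigmaXV] (S.idx n i) := by
  have : S.idx n i = fun ω => S.idxD n (S.x i ω, S.V i ω) := funext (S.idx_eq n i)
  rw [this]
  exact (hS.measurable_idxD n).comp (S.measurable_xV_sigmaXV i)

/-- The first stage does not use `u`. Its error is a function of `(x, V)` and may therefore appear
in the coefficients of the residuals. -/
lemma measurable_err_sigmaXV {q : ℝ → ℝ → ℝ} (hq : IsRegularization q ρ) (a : ℝ) (n i : ℕ) :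
    Measurable[S.sigmaXV] fun ω => S.err q a n ω (S.Zi i ω) := by
  simp only [S.err_apply, Design.noise]
  have hR := hS.measurable_regInv S.sigmaX_le_sigmaXV hq a n (hS.measurable_Z_sigmaXV i)
  have h1 : ∀ j, Measurable[S.sigmaXV] fun ω =>
      (inner ℝ (S.Zi j ω) (regInv q a (S.covN n ω) (S.Zi i ω)) : ℝ) := fun j =>
    (hS.measurable_Z_sigmaXV j).inner hR
  have h2 : Measurable[S.sigmaXV] fun ω => ∑ j ∈ Finset.range n,
      (inner ℝ (S.Zi j ω) (regInv q a (S.covN n ω) (S.Zi i ω)) : ℝ) • S.V j ω :=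
    Finset.measurable_fun_sum _ fun j _ => (h1 j).smul (measurable_V_sigmaXV j)
  have h3 := hS.measurable_fc_covN S.sigmaX_le_sigmaXV n (hS.measurable_resid hq a)
    (hS.measurable_Z_sigmaXV i)
  exact (h2.const_smul (n : ℝ)⁻¹).sub
    ((S.D n).continuous.measurable.comp (S.Pi0.continuous.measurable.comp h3))

lemma measurable_lin_sigmaXV (c : Criterion) (n i : ℕ) {B : Ω → H →L[ℝ] Vec d}
    (hB : Measurable[S.sigmaXV] fun ω => B ω (S.Zi i ω)) :
    Measurable[S.sigmaXV] fun ω => S.lin c n i (B ω) ω := by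
  have hidx := hS.measurable_idx_sigmaXV n i
  have h1 : Measurable[S.sigmaXV] fun ω => S.scaleInv n (pair (B ω (S.Zi i ω)) (-(B ω (S.Zi i ω)))) :=
    (S.scaleInvL n).continuous.measurable.comp
      (continuous_pair.measurable.comp (hB.prodMk hB.neg))
  have h2 : Measurable[S.sigmaXV] fun ω => hfac c (S.idx n i ω) :=
    (continuous_hfac c).measurable.comp hidx
  have h3 : Measurable[S.sigmaXV] fun ω => hfacD c (S.idx n i ω) :=
    (continuous_hfacD c).measurable.comp hidx
  have h4 : Measurable[S.sigmaXV] fun ω => (inner ℝ S.psi0 (B ω (S.Zi i ω)) : ℝ) :=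
    measurable_const.inner hB
  unfold Design.lin
  exact (h2.smul h1).sub ((h3.mul h4).smul (hS.measurable_F_sigmaXV i))

lemma integral_norm_Z_pow_four (i : ℕ) :
    ∫ ω, ‖S.Zi i ω‖ ^ 4 ∂P = ∫ ω, ‖S.Zi 0 ω‖ ^ 4 ∂P := by
  have h : Measurable fun p : (Fin dx → ℝ) × Vec d × ℝ => ‖S.Z p.1‖ ^ 4 :=
    (hS.meas_Z.comp measurable_fst).norm.pow_const 4
  exact (hS.identDistrib_obs h i).integral_eq

/-- Mean square of the coefficients of the residuals. -/
lemma exists_sqLe_coef (c : Criterion) {q : ℝ → ℝ → ℝ} (hq : IsRegularization q ρ) (CI : ℝ) :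
    ∃ B : ℝ, 0 < B ∧ ∀ (n : ℕ) (a : ℝ), 1 ≤ n → 0 < a → a ≤ 1 → 1 ≤ n * a →
      ‖S.DInv n‖ ^ 2 ≤ CI * (n * a) → ∀ i A,
      SqLe P A (fun ω => hfac c (S.idx n i ω) • S.F i ω + S.lin c n i (S.err q a n ω) ω) B := by
  obtain ⟨C, c₀, hC0, hc₀, hU⟩ := hS.exists_uniformBound c
  obtain ⟨C1, hC10, hR⟩ := exists_norm_regInv_le (S := S) hq
  obtain ⟨B1, hB10, hB1⟩ := hS.exists_noiseBd
  obtain ⟨CD, hCD0, hCD⟩ := hS.exists_norm_D_le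
  set m4 := ∫ ω, ‖S.Zi 0 ω‖ ^ 4 ∂P with hm4
  have hm40 : 0 ≤ m4 := integral_nonneg fun ω => by positivity
  set K1 : ℝ := C * (1 + ‖S.psi0‖ * C) with hK1
  have hK10 : 0 ≤ K1 := by positivity
  set K2 : ℝ := Real.sqrt (|CI| + 1) * C1 with hK2
  have hK20 : 0 ≤ K2 := by positivity
  set K : ℝ := C ^ 2 + (C * ‖S.Pi0‖ + K1 * (CD * ‖S.Pi0‖)) + (C * K2 + K1 * C1) with hK
  refine ⟨K ^ 2 * (2 * (2 * (1 + (1 + m4)) + (B1 + m4))) + 1, by positivity,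
    fun n a hn ha ha1 hna hI i A => ?_⟩
  have hn0 : (0 : ℝ) < n := by positivity
  have hsn : Real.sqrt n ^ 2 = n := Real.sq_sqrt hn0.le
  have hsa : 0 < Real.sqrt a := Real.sqrt_pos.2 ha
  obtain ⟨hL1, hI1⟩ := hB1 n hn
  have m2 : SqLe P A (fun ω => ‖S.Zi i ω‖) (1 + m4) := by
    refine SqLe.of_integral_le (hS.memLp_Z i).norm ?_
    have hi4 := hS.integrable_norm_Z_pow_four i
    have hi5 : Integrable (fun ω => 1 + ‖S.Zi i ω‖ ^ 4) P := (integrable_const _).add hi4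
    refine (integral_mono (g := fun ω => 1 + ‖S.Zi i ω‖ ^ 4)
      (integrable_norm_sq_of_memLp (hS.memLp_Z i).norm) hi5 fun ω => ?_).trans ?_
    · simp only [norm_norm]
      nlinarith [sq_nonneg (‖S.Zi i ω‖ ^ 2 - 1), sq_nonneg (‖S.Zi i ω‖ ^ 2)]
    · rw [integral_add (integrable_const _) hi4, hS.integral_norm_Z_pow_four, ← hm4]
      simp
  have m3 : SqLe P A (fun ω => Real.sqrt n * S.noiseBd n ω * ‖S.Zi i ω‖) (B1 + m4) := by
    refine (sqLe_mul_of_memLp_four (hL1.const_mul (Real.sqrt n)) (hS.moment_Z i).norm).mono ?_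
    simp only [norm_mul, mul_pow, norm_norm]
    rw [integral_const_mul, hS.integral_norm_Z_pow_four]
    have e : ‖Real.sqrt n‖ ^ 4 = (n : ℝ) ^ 2 := by
      rw [Real.norm_of_nonneg (Real.sqrt_nonneg _)]
      nlinarith [hsn]
    rw [e]
    have h1 := mul_le_mul_of_nonneg_left hI1 (sq_nonneg (n : ℝ))
    have h2 : (n : ℝ) ^ 2 * (B1 * (n : ℝ)⁻¹ ^ 2) = B1 := by field_simp
    rw [h2] at h1
    linarith
  -- The coefficient will be dominated by a multiple of `1 + ‖Z‖ + √n · noise · ‖Z‖`, which has a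
  -- second moment bounded in `n`.
  have mt := ((SqLe.const (P := P) (A := A) (1 : ℝ)).add m2).add m3
  -- The inflation of order `√(na)` cancels the `a^{-1/2}` of the regularized inverse and leaves
  -- `√n`, which the noise compensates.
  have hDr : ‖S.DInv n‖ * (C1 * (Real.sqrt a)⁻¹) ≤ K2 * Real.sqrt n := by
    have h1 : ‖S.DInv n‖ ≤ Real.sqrt (|CI| + 1) * (Real.sqrt n * Real.sqrt a) := by
      refine (sq_le_sq₀ (norm_nonneg _) (by positivity)).1 ?_
      rw [mul_pow, mul_pow, Real.sq_sqrt (by positivity), hsn, Real.sq_sqrt ha.le]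
      refine hI.trans (mul_le_mul_of_nonneg_right ?_ (by positivity))
      linarith [le_abs_self CI]
    calc ‖S.DInv n‖ * (C1 * (Real.sqrt a)⁻¹)
        ≤ Real.sqrt (|CI| + 1) * (Real.sqrt n * Real.sqrt a) * (C1 * (Real.sqrt a)⁻¹) := by gcongr
      _ = _ := by
        rw [hK2]
        field_simp
  have hr : C1 * (Real.sqrt a)⁻¹ ≤ C1 * Real.sqrt n := by
    refine mul_le_mul_of_nonneg_left ?_ hC10.le
    rw [inv_le_iff_one_le_mul₀ hsa, ← Real.sqrt_mul hn0.le]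
    exact Real.one_le_sqrt.2 hna
  refine ((mt.of_le (c := K) ?_ ?_).mono ?_)
  · have h1 : Measurable[S.sigmaXV] fun ω =>
        hfac c (S.idx n i ω) • S.F i ω + S.lin c n i (S.err q a n ω) ω := by
      have h2 : Measurable[S.sigmaXV] fun ω => hfac c (S.idx n i ω) :=
        (continuous_hfac c).measurable.comp (hS.measurable_idx_sigmaXV n i)
      exact (h2.smul (hS.measurable_F_sigmaXV i)).add
        (hS.measurable_lin_sigmaXV c n i (hS.measurable_err_sigmaXV hq a n i))
    exact (h1.mono hS.sigmaXV_le le_rfl).aestronglyMeasurable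
  · filter_upwards [hU] with ω h
    have hN := S.noiseBd_nonneg n ω
    set N := S.noiseBd n ω
    set ζ := ‖S.Zi i ω‖ with hζ
    have hζ0 : 0 ≤ ζ := norm_nonneg _
    set x := S.noise n ω (regInv q a (S.covN n ω) (S.Zi i ω)) with hx
    have hxn : ‖x‖ ≤ N * (C1 * (Real.sqrt a)⁻¹ * ζ) := by
      refine (S.norm_noise_le _ _ _).trans ?_
      exact mul_le_mul_of_nonneg_left (hR n ω a _ ha ha1).1 hN
    have hp := norm_fc_resid_le (S := S) hq ha n ω (S.Zi i ω)
    set y := S.Pi0 (fc (resid q a) (S.covN n ω) (S.Zi i ω)) with hy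
    have hyn : ‖y‖ ≤ ‖S.Pi0‖ * ζ := (S.Pi0.le_opNorm _).trans (by gcongr)
    have hDy : ‖S.D n y‖ ≤ CD * (‖S.Pi0‖ * ζ) :=
      ((S.D n).le_opNorm _).trans (mul_le_mul (hCD n) hyn (norm_nonneg _) hCD0.le)
    have hNζ : 0 ≤ N * ζ := mul_nonneg hN hζ0
    have hx1 : ‖x‖ ≤ C1 * (Real.sqrt n * N * ζ) := by
      refine hxn.trans ?_
      have := mul_le_mul_of_nonneg_right hr hNζ
      linarith
    have hx2 : ‖S.DInv n x‖ ≤ K2 * (Real.sqrt n * N * ζ) := by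
      refine ((S.DInv n).le_opNorm _).trans ?_
      have h1 := mul_le_mul_of_nonneg_left hxn (norm_nonneg (S.DInv n))
      have h2 := mul_le_mul_of_nonneg_right hDr hNζ
      linarith
    have he : S.err q a n ω (S.Zi i ω) = x - S.D n y := S.err_apply q a n ω _
    have h3 : ‖S.err q a n ω (S.Zi i ω)‖ ≤ C1 * (Real.sqrt n * N * ζ) + CD * (‖S.Pi0‖ * ζ) := by
      rw [he]
      exact (norm_sub_le _ _).trans (add_le_add hx1 hDy)
    have h4 : ‖S.DInv n (S.err q a n ω (S.Zi i ω))‖ ≤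
        K2 * (Real.sqrt n * N * ζ) + ‖S.Pi0‖ * ζ := by
      -- The bias carries the factor `D`, so inverse scaling does not inflate it. Only the noise
      -- needs the cancellation above.
      rw [he, map_sub, hS.DInv_D hn]
      exact (norm_sub_le _ _).trans (add_le_add hx2 hyn)
    have h5 := S.norm_lin_le h n i (S.err q a n ω)
    have h6 : ‖hfac c (S.idx n i ω) • S.F i ω‖ ≤ C ^ 2 := by
      rw [norm_smul, sq]
      exact mul_le_mul (h.abs_hfac n i) (h.norm_F i) (norm_nonneg _) hC0.le
    have h7 := mul_le_mul_of_nonneg_left h3 hK10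
    have h8 := mul_le_mul_of_nonneg_left h4 hC0.le
    set T := Real.sqrt n * N * ζ with hT
    have hT0 : 0 ≤ T := by positivity
    rw [Real.norm_of_nonneg (by positivity)]
    refine (norm_add_le _ _).trans ?_
    have q1 : 0 ≤ C * ‖S.Pi0‖ + K1 * (CD * ‖S.Pi0‖) := by positivity
    have q2 : 0 ≤ C * K2 + K1 * C1 := by positivity
    have q3 : 0 ≤ C ^ 2 := by positivity
    have e : K * (1 + ζ + T) = C ^ 2 + (C * ‖S.Pi0‖ + K1 * (CD * ‖S.Pi0‖)) * ζ
        + (C * K2 + K1 * C1) * T + (C ^ 2 * (ζ + T)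
        + (C * ‖S.Pi0‖ + K1 * (CD * ‖S.Pi0‖)) * (1 + T) + (C * K2 + K1 * C1) * (1 + ζ)) := by
      rw [hK]
      ring
    have q4 : 0 ≤ C ^ 2 * (ζ + T)
        + (C * ‖S.Pi0‖ + K1 * (CD * ‖S.Pi0‖)) * (1 + T) + (C * K2 + K1 * C1) * (1 + ζ) := by
      positivity
    linarith
  · simp

/-- Mean square of the residual part of the score. -/
lemma sqLe_residual_part (n : ℕ) {coef : ℕ → Ω → Vec2 d} {B : ℝ} (hn : 1 ≤ n)
    (hm : ∀ i, Measurable[S.sigmaXV] (coef i)) (hB : ∀ i, SqLe P Set.univ (coef i) B) (A : Set Ω) :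
    SqLe P A (fun ω => (n : ℝ)⁻¹ • ∑ i ∈ Finset.range n, S.eps n i ω • coef i ω)
      (B * (n : ℝ)⁻¹) := by
  obtain ⟨h1, h2⟩ := hS.integral_norm_sq_sum_eps_smul_le n n
    (fun i _ => (hm i).stronglyMeasurable) (fun i _ => (hB i).memLp)
  have hn0 : (n : ℝ) ≠ 0 := by positivity
  have hL : MemLp (fun ω => ∑ i ∈ Finset.range n, S.eps n i ω • coef i ω) 2 P :=
    memLp_finsetSum _ fun i hi => h1 i (Finset.mem_range.1 hi)
  refine SqLe.of_integral_le (hL.const_smul (n : ℝ)⁻¹) ?_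
  simp only [norm_smul, mul_pow, norm_inv, Real.norm_natCast]
  rw [integral_const_mul]
  have h3 : ∑ i ∈ Finset.range n, ∫ ω, ‖coef i ω‖ ^ 2 ∂P ≤ n * B := by
    refine (Finset.sum_le_sum fun i _ => ?_).trans (by simp : ∑ i ∈ Finset.range n, B ≤ n * B)
    have := (hB i).le
    rwa [setIntegral_univ] at this
  refine (mul_le_mul_of_nonneg_left (h2.trans h3) (by positivity)).trans (le_of_eq ?_)
  field_simp

end ModelConditions

/-! ### Population derivatives and the two linearized scores -/

namespace ModelConditions

variable {Ω : Type*} [mΩ : MeasurableSpace Ω] {P : Measure Ω} [IsProbabilityMeasure P]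
  {H : Type*} [NormedAddCommGroup H] [InnerProductSpace ℝ H] [CompleteSpace H]
  [SecondCountableTopology H] [MeasurableSpace H] [BorelSpace H] {dx d : ℕ}
  {S : Design Ω H dx d} {Θ : Set (Vec2 d)} {ρ : ℝ} (hS : ModelConditions P S Θ ρ)
include hS

lemma scaleInv_integral (n : ℕ) {f : Ω → Vec2 d} (hf : Integrable f P) :
    S.scaleInv n (∫ ω, f ω ∂P) = ∫ ω, S.scaleInv n (f ω) ∂P :=
  ((S.scaleInvL n).integral_comp_comm hf).symm

/-- A residual times a vector depending on `(x, V)` has mean zero. -/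
lemma integral_eps_smul_eq_zero (n i : ℕ) {G : Ω → Vec2 d} (hG : Measurable[S.sigmaXV] G)
    (hi : Integrable (fun ω => S.eps n i ω • G ω) P) : ∫ ω, S.eps n i ω • G ω ∂P = 0 := by
  refine ext_inner_left ℝ (fun v : Vec2 d => ?_)
  rw [inner_zero_right, ← integral_inner hi]
  have h1 := hi.const_inner (𝕜 := ℝ) v
  have e : ∀ ω, inner ℝ v (S.eps n i ω • G ω) = S.eps n i ω * inner ℝ v (G ω) := fun ω =>
    inner_smul_right _ _ _
  simp_rw [e] at h1 ⊢
  refine hS.integral_eps_mul_eq_zero n i ?_ h1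
  exact (measurable_const.inner hG).stronglyMeasurable.mono (S.sigmaXV_le_sup i)

lemma integrable_eps_smul (n i : ℕ) {G : Ω → Vec2 d} (hG : Integrable G P) :
    Integrable (fun ω => S.eps n i ω • G ω) P := by
  refine hG.norm.mono' ((hS.measurable_eps n i).aestronglyMeasurable.smul hG.1)
    (Eventually.of_forall fun ω => ?_)
  rw [norm_smul]
  exact mul_le_of_le_one_left (norm_nonneg _) (S.abs_eps_le n i ω)

lemma integrable_lin (c : Criterion) (n i : ℕ) (B : H →L[ℝ] Vec d) :
    Integrable (S.lin c n i B) P := by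
  obtain ⟨C, c₀, hC0, hc₀, hU⟩ := hS.exists_uniformBound c
  have hm : Measurable[S.sigmaXV] fun ω => B (S.Zi i ω) :=
    B.continuous.measurable.comp (hS.measurable_Z_sigmaXV i)
  refine ((hS.integrable_Z i).norm.const_mul
    (C * (‖S.DInv n‖ * ‖B‖) + C * (1 + ‖S.psi0‖ * C) * ‖B‖)).mono'
    ((hS.measurable_lin_sigmaXV c n i hm).mono hS.sigmaXV_le le_rfl).aestronglyMeasurable ?_
  filter_upwards [hU] with ω h
  refine (S.norm_lin_le h n i B).trans ?_
  have h1 := B.le_opNorm (S.Zi i ω)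
  have h2 : ‖S.DInv n (B (S.Zi i ω))‖ ≤ ‖S.DInv n‖ * (‖B‖ * ‖S.Zi i ω‖) :=
    ((S.DInv n).le_opNorm _).trans (by gcongr)
  have h3 := mul_le_mul_of_nonneg_left h1 (by positivity : 0 ≤ C * (1 + ‖S.psi0‖ * C))
  have h4 := mul_le_mul_of_nonneg_left h2 hC0.le
  linarith

lemma integrable_wgt_smul_F (c : Criterion) (n i : ℕ) {g : Ω → ℝ} (hg : Integrable g P) :
    Integrable (fun ω => (wgt c (S.idx n i ω) * g ω) • S.F i ω) P := by
  obtain ⟨C, c₀, hC0, hc₀, hU⟩ := hS.exists_uniformBound c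
  have h1 : Measurable fun ω => wgt c (S.idx n i ω) :=
    (continuous_wgt c).measurable.comp ((hS.measurable_idx_sigmaXV n i).mono hS.sigmaXV_le le_rfl)
  have h2 : Measurable (S.F i) := (hS.measurable_F_sigmaXV i).mono hS.sigmaXV_le le_rfl
  refine (hg.norm.const_mul (C * C)).mono'
    ((h1.aestronglyMeasurable.mul hg.1).smul h2.aestronglyMeasurable) ?_
  filter_upwards [hU] with ω h
  rw [norm_smul, norm_mul, Real.norm_eq_abs]
  have h3 := mul_le_mul (h.abs_wgt n i) (h.norm_F i) (norm_nonneg _) hC0.le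
  have h4 := mul_le_mul_of_nonneg_right h3 (norm_nonneg (g ω))
  linarith

/-- The scaled population derivative in the first stage. -/
lemma scaleInv_Gamma2 {ι : Type*} [Fintype ι] (b : OrthonormalBasis ι ℝ (Vec2 d)) (c : Criterion)
    {n : ℕ} (hn : 1 ≤ n) (B : H →L[ℝ] Vec d) :
    S.scaleInv n (S.Gamma2 P c n B) =
      ∑ k, (inner ℝ S.psi0 (B (S.mean P (S.wF c n (b k)))) : ℝ) • b k := by
  have hBZ : Integrable (fun ω => (inner ℝ S.psi0 (B (S.Zi 0 ω)) : ℝ)) P :=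
    (B.integrable_comp (hS.integrable_Z 0)).const_inner (𝕜 := ℝ) S.psi0
  have h1 := hS.integrable_wgt_smul_F c n 0 hBZ
  have h2 := hS.integrable_eps_smul n 0 (hS.integrable_lin c n 0 B)
  have h12 : Integrable (fun ω => (wgt c (S.idx n 0 ω) * inner ℝ S.psi0 (B (S.Zi 0 ω))) • S.F 0 ω
      + S.eps n 0 ω • S.lin c n 0 B ω) P := h1.add h2
  have hm : Measurable[S.sigmaXV] fun ω => B (S.Zi 0 ω) :=
    B.continuous.measurable.comp (hS.measurable_Z_sigmaXV 0)
  simp_rw [← hS.scaleInv_scoreD2 c hn 0] at h12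
  rw [Design.Gamma2, hS.scaleInv_integral n (hS.integrable_of_scaleInv hn h12)]
  simp_rw [hS.scaleInv_scoreD2 c hn 0]
  rw [integral_add h1 h2, hS.integral_eps_smul_eq_zero n 0 (hS.measurable_lin_sigmaXV c n 0 hm) h2,
    add_zero]
  obtain ⟨C, c₀, hC0, hc₀, hU⟩ := hS.exists_uniformBound c
  have e1 : ∀ k, inner ℝ S.psi0 (B (S.mean P (S.wF c n (b k)))) = inner ℝ (b k)
      (∫ ω, (wgt c (S.idx n 0 ω) * inner ℝ S.psi0 (B (S.Zi 0 ω))) • S.F 0 ω ∂P) := by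
    intro k
    have hi : Integrable (fun ω => S.wF c n (b k) (S.obs 0 ω) • S.Zi 0 ω) P :=
      (hS.memLp_smul_Z (hS.measurable_wF c n (b k)) (C := C * (‖b k‖ * C)) (by
        filter_upwards [hU] with ω h using S.abs_wF_le h n 0 _)).integrable (by norm_num)
    rw [← integral_inner h1, Design.mean, ← B.integral_comp_comm hi,
      ← integral_inner (B.integrable_comp hi)]
    refine integral_congr_ae (Eventually.of_forall fun ω => ?_)
    simp only [map_smul, inner_smul_right, S.wF_obs]
    ring
  simp_rw [e1]
  exact (b.sum_repr' _).symm

omit hS in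
lemma ae_abs_wF_le {c : Criterion} {C c₀ : ℝ} (hU : ∀ᵐ ω ∂P, UniformBound S c C c₀ ω) (n : ℕ)
    {v : Vec2 d} (hv : ‖v‖ = 1) : ∀ᵐ ω ∂P, ∀ i, |S.wF c n v (S.obs i ω)| ≤ C * C := by
  filter_upwards [hU] with ω h i
  have := S.abs_wF_le h n i v
  rwa [hv, one_mul] at this

/-- Mean square of the scaled linearized scores, on the event that the trace of the sample
covariance operator is bounded. -/
lemma exists_sqLe_score [NeZero d] (c : Criterion) {q : ℝ → ℝ → ℝ} (hq : IsRegularization q ρ)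
    {α : ℕ → ℝ} (hα_pos : ∀ n, 0 < α n) (hα : Tendsto α atTop (𝓝 0))
    (hμα : ∀ j, Tendsto (fun n => S.mu j n ^ 2 * α n) atTop atTop) (M : ℝ) :
    ∃ B : ℝ, 0 < B ∧ ∀ᶠ n in atTop,
      SqLe P {ω | S.trN n ω ≤ M} (fun ω => S.scaleInv n (S.scoreN c n ω
        + S.Gamma2N c n ω (S.PiHat q (α n) n ω - S.PiN n))) (B * mseRate 1 1 n (α n)) ∧
      SqLe P {ω | S.trN n ω ≤ M} (fun ω => S.scaleInv n (S.scoreN c n ω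
        + S.Gamma2 P c n (S.PiHat q (α n) n ω - S.PiN n))) (B * mseRate 1 1 n (α n)) := by
  obtain ⟨C, c₀, hC0, hc₀, hU⟩ := hS.exists_uniformBound c
  obtain ⟨CI, hCI0, hCI⟩ := hS.exists_norm_DInv_sq_le hα_pos hμα
  obtain ⟨B1, hB10, hB1⟩ := hS.exists_sqLe_coef c hq CI
  obtain ⟨B2, hB20, hB2⟩ := hS.sqLe_inner_err hq (C * C) M
  let b := stdOrthonormalBasis ℝ (Vec2 d)
  set m : ℝ := ((Finset.univ : Finset (Fin (Module.finrank ℝ (Vec2 d)))).card : ℝ) with hm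
  have hm0 : 0 ≤ m := by positivity
  refine ⟨2 * (B1 + (C ^ 2) ^ 2 + m * (m * B2)), by positivity, ?_⟩
  filter_upwards [hCI, hS.eventually_one_le_mul hα_pos hμα, eventually_ge_atTop 1,
    hα.eventually_le_const one_pos] with n hCI hna hn ha1
  have ha := hα_pos n
  set a := α n
  set A := {ω | S.trN n ω ≤ M}
  have r0 : (n : ℝ)⁻¹ ≤ mseRate 1 1 n a := inv_le_mseRate ha ha1
  have hr : 0 ≤ mseRate 1 1 n a := le_trans (by positivity) r0
  set r := mseRate 1 1 n a
  have hhF : ∀ i, Measurable[S.sigmaXV] fun ω => hfac c (S.idx n i ω) • S.F i ω := fun i => by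
    have h2 : Measurable[S.sigmaXV] fun ω => hfac c (S.idx n i ω) :=
      (continuous_hfac c).measurable.comp (hS.measurable_idx_sigmaXV n i)
    exact h2.smul (hS.measurable_F_sigmaXV i)
  have c1 : ∀ i, SqLe P Set.univ (fun ω => hfac c (S.idx n i ω) • S.F i ω) ((C ^ 2) ^ 2) := by
    intro i
    refine ((SqLe.const (P := P) (1 : ℝ)).of_le (c := C ^ 2)
      ((hhF i).mono hS.sigmaXV_le le_rfl).aestronglyMeasurable ?_).mono (le_of_eq (by simp))
    filter_upwards [hU] with ω h
    rw [norm_smul, norm_one, mul_one, sq]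
    exact mul_le_mul (h.abs_hfac n i) (h.norm_F i) (norm_nonneg _) hC0.le
  have c2 := fun i => hB1 n a hn ha ha1 hna hCI i Set.univ
  have c2m : ∀ i, Measurable[S.sigmaXV] fun ω =>
      hfac c (S.idx n i ω) • S.F i ω + S.lin c n i (S.err q a n ω) ω := fun i =>
    (hhF i).add (hS.measurable_lin_sigmaXV c n i (hS.measurable_err_sigmaXV hq a n i))
  have e1 := hS.sqLe_residual_part n hn hhF c1 A
  have e2 := hS.sqLe_residual_part n hn c2m c2 A
  have hk := fun k => hB2 (S.wF c n (b k)) (hS.measurable_wF c n _)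
    (ae_abs_wF_le hU n (b.norm_eq_one k)) n a hn ha ha1 hna
  -- A vector is assembled from its coordinates in a fixed orthonormal basis, at the cost of a
  -- factor depending on the dimension only.
  have hvec : ∀ {g : Fin (Module.finrank ℝ (Vec2 d)) → Ω → ℝ}, (∀ k, SqLe P A (g k) (B2 * r)) →
      SqLe P A (fun ω => ∑ k, g k ω • b k) (m * (m * B2) * r) := by
    intro g hg
    refine (SqLe.sum Finset.univ (X := fun k ω => g k ω • b k) (b := fun _ => B2 * r)
      fun k _ => ?_).mono (le_of_eq ?_)
    · refine ((hg k).of_le (c := 1) ((hg k).memLp.1.smul_const _)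
        (Eventually.of_forall fun ω => ?_)).mono (le_of_eq (by ring))
      rw [norm_smul, b.norm_eq_one, mul_one, one_mul]
    · rw [Finset.sum_const, nsmul_eq_mul, ← hm]
      ring
  have f1 := hvec fun k => (hk k).1
  have f2 := hvec fun k => (hk k).2
  have p1 := mul_le_mul_of_nonneg_left r0 hB10.le
  have p2 := mul_le_mul_of_nonneg_left r0 (sq_nonneg (C ^ 2))
  have p3 := mul_nonneg hB10.le hr
  have p4 := mul_nonneg (sq_nonneg (C ^ 2)) hr
  constructor
  -- With sample derivatives the first-stage error enters the residual coefficients, and the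
  -- functionals are evaluated at averages.
  · have hid : ∀ ω, S.scaleInv n (S.scoreN c n ω
        + S.Gamma2N c n ω (S.PiHat q a n ω - S.PiN n)) =
        (n : ℝ)⁻¹ • ∑ i ∈ Finset.range n,
          S.eps n i ω • (hfac c (S.idx n i ω) • S.F i ω + S.lin c n i (S.err q a n ω) ω)
        + ∑ k, (inner ℝ S.psi0 (S.err q a n ω (S.avg (S.wF c n (b k)) n ω)) : ℝ) • b k := by
      intro ω
      rw [hS.scaleInv_sample c hn ω, S.sum_wgt_smul_F b]
      rfl
    simp_rw [hid]
    exact (e2.add f1).mono (by linarith)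
  -- With the population derivative the residual terms of `Γ₂` have been integrated out, and the
  -- functionals are evaluated at means.
  · have hid : ∀ ω, S.scaleInv n (S.scoreN c n ω
        + S.Gamma2 P c n (S.PiHat q a n ω - S.PiN n)) =
        (n : ℝ)⁻¹ • ∑ i ∈ Finset.range n, S.eps n i ω • hfac c (S.idx n i ω) • S.F i ω
        + ∑ k, (inner ℝ S.psi0 (S.err q a n ω (S.mean P (S.wF c n (b k)))) : ℝ) • b k := by
      intro ω
      rw [← S.scaleInvL_apply, map_add, S.scaleInvL_apply, S.scaleInvL_apply,
        hS.scaleInv_Gamma2 b c hn, Design.scoreN, ← S.scaleInvL_apply, map_smul, map_sum]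
      simp only [S.scaleInvL_apply, hS.scaleInv_score c hn]
      rfl
    simp_rw [hid]
    exact (e1.add f2).mono (by linarith)

end ModelConditions

/-! ### Derivative matrices of the second stage -/

lemma inner_sq_eq_sum {d : ℕ} (u v : Vec d) : inner ℝ u v ^ 2 = ∑ a, ∑ b, u a * u b * (v a * v b) := by
  have : inner ℝ u v = ∑ a, u a * v a := by
    rw [PiLp.inner_apply]
    exact Finset.sum_congr rfl fun a _ => by simp [mul_comm]
  rw [this, sq, Finset.sum_mul_sum]
  exact Finset.sum_congr rfl fun a _ => Finset.sum_congr rfl fun b _ => by ring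

/-- Conditional positive definiteness is given entry by entry, so the quadratic form has to be
expanded before it can be used. -/
lemma condExp_inner_sq {Ω : Type*} {m mΩ : MeasurableSpace Ω} {P : Measure Ω} {d : ℕ}
    {V : Ω → Vec d} (hV : ∀ a b, Integrable (fun ω => V ω a * V ω b) P) (u : Vec d) :
    P[fun ω => inner ℝ u (V ω) ^ 2 | m] =ᵐ[P] fun ω => ∑ a, ∑ b,
      u a * u b * (P[fun ω => V ω a * V ω b | m]) ω := by
  have e : (fun ω => (inner ℝ u (V ω) : ℝ) ^ 2) =
      ∑ p : Fin d × Fin d, (u p.1 * u p.2) • fun ω => V ω p.1 * V ω p.2 := by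
    funext ω
    rw [inner_sq_eq_sum, Finset.sum_apply, Fintype.sum_prod_type]
    rfl
  rw [e]
  have h4 := condExp_finsetSum (μ := P) (s := Finset.univ)
    (f := fun p : Fin d × Fin d => (u p.1 * u p.2) • fun ω => V ω p.1 * V ω p.2)
    (fun p _ => (hV p.1 p.2).smul _) m
  have h5 := ae_all_iff.2 fun p : Fin d × Fin d =>
    condExp_smul (μ := P) (u p.1 * u p.2) (fun ω => V ω p.1 * V ω p.2) m
  filter_upwards [h4, h5] with ω h4 h5
  rw [h4, Finset.sum_apply, Fintype.sum_prod_type]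
  refine Finset.sum_congr rfl fun a _ => Finset.sum_congr rfl fun b _ => ?_
  rw [h5 (a, b)]
  rfl

namespace ModelConditions

variable {Ω : Type*} [mΩ : MeasurableSpace Ω] {P : Measure Ω} [IsProbabilityMeasure P]
  {H : Type*} [NormedAddCommGroup H] [InnerProductSpace ℝ H] [CompleteSpace H]
  [SecondCountableTopology H] [MeasurableSpace H] [BorelSpace H] {dx d : ℕ}
  {S : Design Ω H dx d} {Θ : Set (Vec2 d)} {ρ : ℝ} (hS : ModelConditions P S Θ ρ)
include hS

lemma memLp_V (i : ℕ) : MemLp (S.V i) 2 P := (hS.moment_V i).mono_exponent (by norm_num)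

lemma integrable_V_mul_V (i : ℕ) (a b : Fin d) : Integrable (fun ω => S.V i ω a * S.V i ω b) P := by
  have h : ∀ a, MemLp (fun ω => S.V i ω a) 2 P := fun a =>
    (hS.memLp_V i).mono (((by fun_prop : Measurable fun v : Vec d => v a).comp
      (hS.meas_V i)).aestronglyMeasurable)
      (Eventually.of_forall fun ω => PiLp.norm_apply_le (S.V i ω) a)
  exact (h a).integrable_mul (h b)

lemma integral_inner_V_sq (u : Vec d) : ∫ ω, inner ℝ u (S.V 0 ω) ^ 2 ∂P =
    ∑ a, ∑ b, u a * u b * ∫ ω, S.V 0 ω a * S.V 0 ω b ∂P := by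
  simp_rw [inner_sq_eq_sum]
  rw [integral_finsetSum _ fun a _ => integrable_finsetSum _ fun b _ =>
    (hS.integrable_V_mul_V 0 a b).const_mul _]
  refine Finset.sum_congr rfl fun a _ => ?_
  rw [integral_finsetSum _ fun b _ => (hS.integrable_V_mul_V 0 a b).const_mul _]
  exact Finset.sum_congr rfl fun b _ => integral_const_mul _ _

lemma integrable_inner_V_sq (u : Vec d) : Integrable (fun ω => inner ℝ u (S.V 0 ω) ^ 2) P := by
  have h : MemLp (fun ω => (inner ℝ u (S.V 0 ω) : ℝ)) 2 P := (hS.memLp_V 0).const_inner u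
  exact h.integrable_sq

/-- A vanishing integral would make `⟨u, V⟩²` zero almost surely, and with it the conditional
quadratic form, which is positive almost surely. -/
lemma integral_inner_V_sq_pos {u : Vec d} (hu : u ≠ 0) :
    0 < ∫ ω, inner ℝ u (S.V 0 ω) ^ 2 ∂P := by
  refine lt_of_le_of_ne (integral_nonneg fun ω => sq_nonneg _) fun h0 => ?_
  have h1 := (integral_eq_zero_iff_of_nonneg (fun ω => sq_nonneg _)
    (hS.integrable_inner_V_sq u)).1 h0.symm
  have h2 : P[fun ω => inner ℝ u (S.V 0 ω) ^ 2 | MeasurableSpace.comap (S.x 0) inferInstance]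
      =ᵐ[P] 0 := (condExp_congr_ae h1).trans (by rw [condExp_zero])
  have h3 := condExp_inner_sq (m := MeasurableSpace.comap (S.x 0) inferInstance)
    (hS.integrable_V_mul_V 0) u
  obtain ⟨ω, h2, h3, h4⟩ := (h2.and (h3.and (hS.var_V 0))).exists
  have hu' : (fun a => u a) ≠ 0 := fun h => hu (by ext a; exact congrFun h a)
  have h5 := h4.dotProduct_mulVec_pos hu'
  rw [h3] at h2
  have e : ∑ a, ∑ b, u a * u b * (P[fun ω => S.V 0 ω a * S.V 0 ω b |
    MeasurableSpace.comap (S.x 0) inferInstance]) ω = 0 := h2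
  simp only [dotProduct, Matrix.mulVec, Matrix.of_apply, Finset.mul_sum, Pi.star_apply,
    star_trivial] at h5
  refine absurd h5 (not_lt.2 (le_of_eq ?_))
  rw [← e]
  exact Finset.sum_congr rfl fun a _ => Finset.sum_congr rfl fun b _ => by ring

lemma exists_le_integral_inner_V_sq : ∃ C : ℝ, 0 < C ∧ ∀ u : Vec d,
    C * ‖u‖ ^ 2 ≤ ∫ ω, inner ℝ u (S.V 0 ω) ^ 2 ∂P := by
  set Q : Vec d → ℝ := fun u => ∫ ω, inner ℝ u (S.V 0 ω) ^ 2 ∂P with hQ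
  have hc : Continuous Q := by
    have : Q = fun u : Vec d => ∑ a, ∑ b, u a * u b * ∫ ω, S.V 0 ω a * S.V 0 ω b ∂P :=
      funext hS.integral_inner_V_sq
    rw [this]
    fun_prop
  have hs : ∀ (t : ℝ) (u : Vec d), Q (t • u) = t ^ 2 * Q u := fun t u => by
    simp only [hQ, inner_smul_left, mul_pow, conj_trivial]
    exact integral_const_mul _ _
  -- The uniform constant is the minimum of the quadratic form over the unit sphere. The sphere is
  -- empty when the dimension is zero.
  rcases (Metric.sphere (0 : Vec d) 1).eq_empty_or_nonempty with h | h
  · refine ⟨1, one_pos, fun u => ?_⟩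
    have : u = 0 := by
      by_contra hu
      have : (‖u‖⁻¹ • u) ∈ Metric.sphere (0 : Vec d) 1 := by
        rw [mem_sphere_zero_iff_norm, norm_smul, norm_inv, norm_norm,
          inv_mul_cancel₀ (norm_ne_zero_iff.2 hu)]
      rw [h] at this
      exact this
    simp [this]
  · obtain ⟨u0, hu0, hmin⟩ := (isCompact_sphere (0 : Vec d) 1).exists_isMinOn h hc.continuousOn
    have hu1 : ‖u0‖ = 1 := by simpa using hu0
    refine ⟨Q u0, hS.integral_inner_V_sq_pos (fun h => by simp [h] at hu1), fun u => ?_⟩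
    by_cases hu : u = 0
    · simp [hu]
    have hn : ‖u‖ ≠ 0 := norm_ne_zero_iff.2 hu
    have h1 : (‖u‖⁻¹ • u) ∈ Metric.sphere (0 : Vec d) 1 := by
      rw [mem_sphere_zero_iff_norm, norm_smul, norm_inv, norm_norm, inv_mul_cancel₀ hn]
    have h2 : Q u0 ≤ Q (‖u‖⁻¹ • u) := hmin h1
    have h3 := hs ‖u‖ (‖u‖⁻¹ • u)
    rw [smul_smul, mul_inv_cancel₀ hn, one_smul] at h3
    change _ ≤ Q u
    rw [h3, mul_comm]
    exact mul_le_mul_of_nonneg_left h2 (sq_nonneg _)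

lemma memLp_F : MemLp (S.F 0) 2 P := by
  -- The choice of criterion is immaterial, since only the bound on `F` is used.
  obtain ⟨C, c₀, hC0, hc₀, hU⟩ := hS.exists_uniformBound Criterion.ml
  refine MemLp.of_bound (((hS.measurable_F_sigmaXV 0).mono hS.sigmaXV_le le_rfl).aestronglyMeasurable)
    C ?_
  filter_upwards [hU] with ω h using h.norm_F 0

/-- `f` is a function of `x` and `V` has conditional mean zero, so the cross moment vanishes and the
two nondegenerate blocks can be treated apart. -/
lemma exists_le_integral_inner_F_sq : ∃ C : ℝ, 0 < C ∧ ∀ u : Vec2 d,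
    C * ‖u‖ ^ 2 ≤ ∫ ω, inner ℝ u (S.F 0 ω) ^ 2 ∂P := by
  obtain ⟨C1, hC1, h1⟩ := hS.f_nondeg
  obtain ⟨C2, hC2, h2⟩ := hS.exists_le_integral_inner_V_sq
  refine ⟨min C1 C2, lt_min hC1 hC2, fun u => ?_⟩
  have hu : u = pair u.fst u.snd := rfl
  have hnu : ‖u‖ ^ 2 = ‖u.fst‖ ^ 2 + ‖u.snd‖ ^ 2 := by
    conv_lhs => rw [hu]
    exact norm_pair_sq _ _
  have hfL : MemLp (fun ω => (inner ℝ u.fst (S.f 0 ω) : ℝ)) 2 P :=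
    (S.Pi0.comp_memLp' (hS.memLp_Z 0)).const_inner u.fst
  have hVL : MemLp (fun ω => (inner ℝ u.snd (S.V 0 ω) : ℝ)) 2 P := (hS.memLp_V 0).const_inner u.snd
  have hx : Integrable (fun ω => (inner ℝ u.snd (S.V 0 ω) : ℝ) * inner ℝ u.fst (S.f 0 ω)) P :=
    hVL.integrable_mul hfL
  have h0 := hS.integral_V_mul_eq_zero 0 u.snd (G := fun ω => inner ℝ u.fst (S.f 0 ω)) (by
    have h1 : Measurable[MeasurableSpace.comap (S.x 0) inferInstance] (S.f 0) :=
      S.Pi0.continuous.measurable.comp (hS.meas_Z.comp (comap_measurable (S.x 0)))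
    exact (measurable_const.inner h1).stronglyMeasurable.mono le_sup_left) hx
  have e : ∀ ω, inner ℝ u (S.F 0 ω) ^ 2 = inner ℝ u.fst (S.f 0 ω) ^ 2
      + 2 * (inner ℝ u.snd (S.V 0 ω) * inner ℝ u.fst (S.f 0 ω))
      + inner ℝ u.snd (S.V 0 ω) ^ 2 := fun ω => by
    have : inner ℝ u (S.F 0 ω) = inner ℝ u.fst (S.f 0 ω) + inner ℝ u.snd (S.V 0 ω) := by
      rw [real_inner_comm, Design.F, inner_pair, real_inner_comm, real_inner_comm (S.V 0 ω)]
    rw [this]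
    ring
  simp_rw [e]
  have i1 : Integrable (fun ω => (inner ℝ u.fst (S.f 0 ω) : ℝ) ^ 2
      + 2 * (inner ℝ u.snd (S.V 0 ω) * inner ℝ u.fst (S.f 0 ω))) P :=
    hfL.integrable_sq.add (hx.const_mul 2)
  rw [integral_add i1 hVL.integrable_sq, integral_add hfL.integrable_sq (hx.const_mul 2),
    integral_const_mul, h0, mul_zero, add_zero, hnu, mul_add]
  refine add_le_add ((mul_le_mul_of_nonneg_right (min_le_left _ _) (sq_nonneg _)).trans (h1 _))
    ((mul_le_mul_of_nonneg_right (min_le_right _ _) (sq_nonneg _)).trans (h2 _))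

end ModelConditions

/-! ### Invertibility of the scaled derivative matrices -/

namespace Design

variable {Ω : Type*} {H : Type*} [NormedAddCommGroup H] [InnerProductSpace ℝ H]
  {dx d : ℕ} (S : Design Ω H dx d)

/-- The derivative of the score factor in the index. -/
noncomputable def slope (c : Criterion) (n i : ℕ) (ω : Ω) : ℝ :=
  -(wgt c (S.idx n i ω)) + S.eps n i ω * hfacD c (S.idx n i ω)

/-- The scaled derivative of one score in `θ`, as a function of the observation. -/
noncomputable def slopeD (c : Criterion) (n : ℕ) (u : Vec2 d) (p : (Fin dx → ℝ) × Vec d × ℝ) :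
    Vec2 d :=
  ((-(wgt c (S.idxD n (p.1, p.2.1))) + (S.yD n ((p.1, p.2.1), p.2.2) - Phi (S.idxD n (p.1, p.2.1)))
    * hfacD c (S.idxD n (p.1, p.2.1))) * inner ℝ (S.FD (p.1, p.2.1)) u) • S.FD (p.1, p.2.1)

lemma slopeD_obs (c : Criterion) (n : ℕ) (u : Vec2 d) (i : ℕ) (ω : Ω) :
    S.slopeD c n u (S.obs i ω) = (S.slope c n i ω * inner ℝ (S.F i ω) u) • S.F i ω := by
  rw [slope, eps, idx_eq, y_eq]
  rfl

lemma norm_slopeD_le {c : Criterion} {C c₀ : ℝ} {ω : Ω} (h : UniformBound S c C c₀ ω) (n i : ℕ)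
    (u : Vec2 d) : ‖S.slopeD c n u (S.obs i ω)‖ ≤ 2 * C ^ 3 * ‖u‖ := by
  have hC : 0 ≤ C := (norm_nonneg _).trans (h.norm_F 0)
  rw [slopeD_obs, norm_smul, norm_mul, Real.norm_eq_abs]
  have h1 : |S.slope c n i ω| ≤ 2 * C := by
    refine (abs_add_le _ _).trans ?_
    rw [abs_neg, abs_mul]
    have := mul_le_mul (S.abs_eps_le n i ω) (h.abs_hfacD n i) (abs_nonneg _) zero_le_one
    linarith [h.abs_wgt n i]
  have h2 : ‖inner ℝ (S.F i ω) u‖ ≤ C * ‖u‖ :=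
    (norm_inner_le_norm _ _).trans (mul_le_mul_of_nonneg_right (h.norm_F i) (norm_nonneg _))
  have h3 := mul_le_mul (mul_le_mul h1 h2 (norm_nonneg _) (by positivity)) (h.norm_F i)
    (norm_nonneg _) (by positivity)
  exact h3.trans (le_of_eq (by ring))

/-- The scaled sample derivative in `θ`. -/
noncomputable def infoN (c : Criterion) (n : ℕ) (ω : Ω) : Vec2 d →L[ℝ] Vec2 d :=
  (n : ℝ)⁻¹ • ∑ i ∈ Finset.range n, S.slope c n i ω • tensor (S.F i ω) (S.F i ω)

lemma infoN_apply (c : Criterion) (n : ℕ) (ω : Ω) (u : Vec2 d) : S.infoN c n ω u =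
    (n : ℝ)⁻¹ • ∑ i ∈ Finset.range n, S.slopeD c n u (S.obs i ω) := by
  simp only [infoN, _root_.smul_apply, _root_.sum_apply, tensor_apply, slopeD_obs, smul_smul]

/-- The scaled information matrix. -/
noncomputable def info [MeasurableSpace Ω] (P : Measure Ω) (c : Criterion) (n : ℕ) :
    Vec2 d →L[ℝ] Vec2 d :=
  ∫ ω, wgt c (S.idx n 0 ω) • tensor (S.F 0 ω) (S.F 0 ω) ∂P

end Design

namespace ModelConditions

variable {Ω : Type*} [mΩ : MeasurableSpace Ω] {P : Measure Ω} [IsProbabilityMeasure P]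
  {H : Type*} [NormedAddCommGroup H] [InnerProductSpace ℝ H] [CompleteSpace H]
  [SecondCountableTopology H] [MeasurableSpace H] [BorelSpace H] {dx d : ℕ}
  {S : Design Ω H dx d} {Θ : Set (Vec2 d)} {ρ : ℝ} (hS : ModelConditions P S Θ ρ)
include hS

lemma measurable_slopeD (c : Criterion) (n : ℕ) (u : Vec2 d) : Measurable (S.slopeD c n u) := by
  have h1 : Measurable fun p : (Fin dx → ℝ) × Vec d × ℝ => (p.1, p.2.1) :=
    measurable_fst.prodMk (measurable_fst.comp measurable_snd)
  have hi := (hS.measurable_idxD n).comp h1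
  have hF := hS.measurable_FD.comp h1
  have hw := (continuous_wgt c).measurable.comp hi
  have hd := (continuous_hfacD c).measurable.comp hi
  have hu : Measurable fun p : (Fin dx → ℝ) × Vec d × ℝ => (inner ℝ (S.FD (p.1, p.2.1)) u : ℝ) :=
    hF.inner measurable_const
  exact ((hw.neg.add ((hS.measurable_epsD n).mul hd)).mul hu).smul hF

lemma integrable_info (c : Criterion) (n : ℕ) :
    Integrable (fun ω => wgt c (S.idx n 0 ω) • tensor (S.F 0 ω) (S.F 0 ω)) P := by
  obtain ⟨C, c₀, hC0, hc₀, hU⟩ := hS.exists_uniformBound c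
  have h1 : Measurable fun ω => wgt c (S.idx n 0 ω) :=
    (continuous_wgt c).measurable.comp ((hS.measurable_idx_sigmaXV n 0).mono hS.sigmaXV_le le_rfl)
  refine (integrable_const (C * (C * C))).mono' (h1.aestronglyMeasurable.smul
    (continuous_tensor_self.comp_aestronglyMeasurable hS.memLp_F.1)) ?_
  filter_upwards [hU] with ω h
  rw [norm_smul]
  refine mul_le_mul (h.abs_wgt n 0) ((norm_tensor_le _ _).trans ?_) (norm_nonneg _) hC0.le
  exact mul_le_mul (h.norm_F 0) (h.norm_F 0) (norm_nonneg _) hC0.le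

lemma info_apply (c : Criterion) (n : ℕ) (u : Vec2 d) : S.info P c n u =
    ∫ ω, (wgt c (S.idx n 0 ω) * inner ℝ (S.F 0 ω) u) • S.F 0 ω ∂P := by
  rw [Design.info, ContinuousLinearMap.integral_apply (hS.integrable_info c n)]
  simp only [_root_.smul_apply, tensor_apply, smul_smul]

/-- The information matrices are uniformly positive definite. -/
lemma exists_le_norm_info (c : Criterion) :
    ∃ l : ℝ, 0 < l ∧ ∀ n (u : Vec2 d), l * ‖u‖ ≤ ‖S.info P c n u‖ := by
  obtain ⟨C, c₀, hC0, hc₀, hU⟩ := hS.exists_uniformBound c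
  obtain ⟨C1, hC1, h1⟩ := hS.exists_le_integral_inner_F_sq
  refine ⟨c₀ * C1, by positivity, fun n u => ?_⟩
  have hFu : MemLp (fun ω => (inner ℝ u (S.F 0 ω) : ℝ)) 2 P := hS.memLp_F.const_inner u
  have hi := hS.integrable_wgt_smul_F c n 0
    ((hS.memLp_F.integrable (by norm_num)).inner_const (𝕜 := ℝ) u)
  have h2 : c₀ * C1 * ‖u‖ ^ 2 ≤ inner ℝ u (S.info P c n u) := by
    rw [hS.info_apply, ← integral_inner hi, mul_assoc]
    refine (mul_le_mul_of_nonneg_left (h1 u) hc₀.le).trans ?_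
    rw [← integral_const_mul]
    refine integral_mono_ae (hFu.integrable_sq.const_mul _) (hi.const_inner (𝕜 := ℝ) u) ?_
    filter_upwards [hU] with ω h
    rw [inner_smul_right, real_inner_comm u (S.F 0 ω), mul_assoc, ← sq]
    exact mul_le_mul_of_nonneg_right (h.le_wgt n 0) (sq_nonneg _)
  have h3 := h2.trans (real_inner_le_norm _ _)
  rcases (norm_nonneg u).eq_or_lt with h0 | h0
  · rw [← h0, mul_zero]
    exact norm_nonneg _
  · rw [sq, ← mul_assoc, mul_comm ‖u‖ ‖S.info P c n u‖] at h3
    exact le_of_mul_le_mul_right h3 h0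

lemma integrable_slopeD (c : Criterion) (n : ℕ) (u : Vec2 d) :
    Integrable (fun ω => S.slopeD c n u (S.obs 0 ω)) P := by
  obtain ⟨C, c₀, hC0, hc₀, hU⟩ := hS.exists_uniformBound c
  refine (integrable_const (2 * C ^ 3 * ‖u‖)).mono'
    ((hS.measurable_slopeD c n u).comp (hS.measurable_obs 0)).aestronglyMeasurable ?_
  filter_upwards [hU] with ω h using S.norm_slopeD_le h n 0 u

/-- The part of the slope with the residual is centred given `(x, V)`. Only the positive weight
survives, which gives the population derivative its sign. -/
lemma integral_slopeD (c : Criterion) (n : ℕ) (u : Vec2 d) :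
    ∫ ω, S.slopeD c n u (S.obs 0 ω) ∂P = -S.info P c n u := by
  obtain ⟨C, c₀, hC0, hc₀, hU⟩ := hS.exists_uniformBound c
  have hi := hS.integrable_wgt_smul_F c n 0
    ((hS.memLp_F.integrable (by norm_num)).inner_const (𝕜 := ℝ) u)
  have hG : Measurable[S.sigmaXV] fun ω =>
      (hfacD c (S.idx n 0 ω) * (inner ℝ (S.F 0 ω) u : ℝ)) • S.F 0 ω := by
    have h2 : Measurable[S.sigmaXV] fun ω => hfacD c (S.idx n 0 ω) :=
      (continuous_hfacD c).measurable.comp (hS.measurable_idx_sigmaXV n 0)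
    have h3 : Measurable[S.sigmaXV] fun ω => (inner ℝ (S.F 0 ω) u : ℝ) :=
      (hS.measurable_F_sigmaXV 0).inner measurable_const
    exact (h2.mul h3).smul (hS.measurable_F_sigmaXV 0)
  have e : ∀ ω, S.slopeD c n u (S.obs 0 ω) =
      -((wgt c (S.idx n 0 ω) * (inner ℝ (S.F 0 ω) u : ℝ)) • S.F 0 ω)
      + S.eps n 0 ω • ((hfacD c (S.idx n 0 ω) * (inner ℝ (S.F 0 ω) u : ℝ)) • S.F 0 ω) := fun ω => by
    rw [S.slopeD_obs, Design.slope]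
    module
  have hi2 : Integrable (fun ω => S.eps n 0 ω •
      ((hfacD c (S.idx n 0 ω) * (inner ℝ (S.F 0 ω) u : ℝ)) • S.F 0 ω)) P := by
    refine ((hS.integrable_slopeD c n u).add hi).congr (Eventually.of_forall fun ω => ?_)
    simp only [Pi.add_apply, e]
    abel
  simp_rw [e]
  have hi1 : Integrable (fun ω => -((wgt c (S.idx n 0 ω) * (inner ℝ (S.F 0 ω) u : ℝ)) • S.F 0 ω)) P :=
    hi.neg
  rw [integral_add hi1 hi2, hS.integral_eps_smul_eq_zero n 0 hG hi2, add_zero, integral_neg,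
    hS.info_apply]

lemma scaleInv_Gamma1N (c : Criterion) {n : ℕ} (hn : 1 ≤ n) (ω : Ω) (v : Vec2 d) :
    S.scaleInv n (S.Gamma1N c n ω v) = S.infoN c n ω (S.scaleT n v) := by
  rw [Design.Gamma1N, _root_.smul_apply, _root_.sum_apply, ← S.scaleInvL_apply, map_smul, map_sum,
    S.infoN_apply]
  simp only [S.scaleInvL_apply, hS.scaleInv_scoreD1 c hn, S.slopeD_obs]
  rfl

lemma scaleInv_Gamma1 (c : Criterion) {n : ℕ} (hn : 1 ≤ n) (v : Vec2 d) :
    S.scaleInv n (S.Gamma1 P c n v) = -S.info P c n (S.scaleT n v) := by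
  have h := hS.integrable_slopeD c n (S.scaleT n v)
  have e : ∀ ω, S.slopeD c n (S.scaleT n v) (S.obs 0 ω) = S.scaleInv n
      (scoreD1 c (S.y n 0 ω) (S.Zi 0 ω) (S.Y2 n 0 ω) S.theta0 (S.PiN n) v) := fun ω => by
    rw [hS.scaleInv_scoreD1 c hn, S.slopeD_obs]
    rfl
  rw [← hS.integral_slopeD]
  simp_rw [e] at h ⊢
  rw [Design.Gamma1, hS.scaleInv_integral n (hS.integrable_of_scaleInv hn h)]

/-- Undoing the scaling on both sides exhibits `Γ₁` as minus the information matrix conjugated by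
the invertible scaling. Injectivity suffices in finite dimension. -/
lemma bijective_Gamma1 (c : Criterion) {n : ℕ} (hn : 1 ≤ n) :
    Function.Bijective (S.Gamma1 P c n) := by
  obtain ⟨l, hl0, hl⟩ := hS.exists_le_norm_info c
  let L : Vec2 d →L[ℝ] Vec2 d := -((S.scaleTL n).adjoint.comp ((S.info P c n).comp (S.scaleTL n)))
  have e : S.Gamma1 P c n = L := by
    funext v
    rw [← hS.adjoint_scaleTL_scaleInv hn (S.Gamma1 P c n v), hS.scaleInv_Gamma1 c hn, map_neg]
    simp only [L, _root_.neg_apply, ContinuousLinearMap.comp_apply, S.scaleTL_apply]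
  have hinj : Function.Injective (L : Vec2 d →ₗ[ℝ] Vec2 d) := by
    rw [injective_iff_map_eq_zero]
    intro v hv
    have h1 : S.Gamma1 P c n v = 0 := by
      rw [e]
      exact hv
    have h2 := hS.scaleInv_Gamma1 c hn v
    rw [h1, ← S.scaleInvL_apply, map_zero] at h2
    have h3 := hl n (S.scaleT n v)
    rw [← norm_neg (S.info P c n _), ← h2, norm_zero] at h3
    have h4 : ‖S.scaleT n v‖ ≤ 0 := nonpos_of_mul_nonpos_right h3 hl0
    exact hS.scaleT_injective hn (norm_le_zero_iff.1 h4)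
  rw [e]
  exact ⟨hinj, LinearMap.injective_iff_surjective.1 hinj⟩

/-- Convergence of the scaled sample derivative. -/
lemma integral_norm_sq_infoN_add_le (c : Criterion) : ∃ B : ℝ, 0 < B ∧ ∀ (n : ℕ) (u : Vec2 d),
    1 ≤ n → ‖u‖ = 1 → SqLe P Set.univ (fun ω => S.infoN c n ω u + S.info P c n u)
      (B * (n : ℝ)⁻¹) := by
  obtain ⟨C, c₀, hC0, hc₀, hU⟩ := hS.exists_uniformBound c
  refine ⟨(4 * C ^ 3) ^ 2, by positivity, fun n u hn hu => ?_⟩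
  have hn0 : (n : ℝ) ≠ 0 := by positivity
  set k := S.info P c n u with hk
  have hkC : ‖k‖ ≤ 2 * C ^ 3 := by
    rw [← norm_neg, hk, ← hS.integral_slopeD]
    refine (norm_integral_le_of_norm_le (integrable_const (2 * C ^ 3)) ?_).trans (by simp)
    filter_upwards [hU] with ω h
    have := S.norm_slopeD_le h n 0 u
    rwa [hu, mul_one] at this
  set ψ : (Fin dx → ℝ) × Vec d × ℝ → Vec2 d := fun p => S.slopeD c n u p + k with hψ
  have hψm : Measurable ψ := (hS.measurable_slopeD c n u).add measurable_const
  have hbd : ∀ i, ∀ᵐ ω ∂P, ‖ψ (S.obs i ω)‖ ≤ 4 * C ^ 3 := fun i => by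
    filter_upwards [hU] with ω h
    have := S.norm_slopeD_le h n i u
    rw [hu, mul_one] at this
    exact (norm_add_le _ _).trans (by linarith)
  have hL : ∀ i, MemLp (fun ω => ψ (S.obs i ω)) 2 P := fun i =>
    MemLp.of_bound (hψm.comp (hS.measurable_obs i)).aestronglyMeasurable _ (hbd i)
  have hb : ∀ i, ∫ ω, ‖ψ (S.obs i ω)‖ ^ 2 ∂P ≤ (4 * C ^ 3) ^ 2 := fun i => by
    refine (integral_mono_ae (integrable_norm_sq_of_memLp (hL i))
      (integrable_const ((4 * C ^ 3) ^ 2)) ?_).trans (by simp)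
    filter_upwards [hbd i] with ω h
    exact pow_le_pow_left₀ (norm_nonneg _) h 2
  have hz : ∀ i, ∫ ω, ψ (S.obs i ω) ∂P = 0 := fun i => by
    rw [(hS.identDistrib_obs hψm i).integral_eq]
    change ∫ ω, (S.slopeD c n u (S.obs 0 ω) + k) ∂P = 0
    rw [integral_add (hS.integrable_slopeD c n u) (integrable_const _), integral_const,
      hS.integral_slopeD]
    simp [hk]
  have key := integral_norm_sq_sum_le_of_iIndepFun hL (hS.iIndepFun_obs hψm) hz hb n
  have e : ∀ ω, S.infoN c n ω u + k = (n : ℝ)⁻¹ • ∑ i ∈ Finset.range n, ψ (S.obs i ω) := by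
    intro ω
    simp only [hψ, Finset.sum_add_distrib, Finset.sum_const, Finset.card_range, smul_add,
      S.infoN_apply]
    rw [← Nat.cast_smul_eq_nsmul ℝ, smul_smul, inv_mul_cancel₀ hn0, one_smul]
  simp_rw [e]
  have hLs : MemLp (fun ω => ∑ i ∈ Finset.range n, ψ (S.obs i ω)) 2 P :=
    memLp_finsetSum _ fun i _ => hL i
  refine SqLe.of_integral_le (hLs.const_smul (n : ℝ)⁻¹) ?_
  simp only [norm_smul, mul_pow, norm_inv, Real.norm_natCast]
  rw [integral_const_mul]
  refine (mul_le_mul_of_nonneg_left key (by positivity)).trans (le_of_eq ?_)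
  field_simp

lemma measurable_infoN (c : Criterion) (n : ℕ) (u : Vec2 d) :
    Measurable fun ω => S.infoN c n ω u := by
  simp only [S.infoN_apply]
  have h : Measurable fun ω => ∑ i ∈ Finset.range n, S.slopeD c n u (S.obs i ω) :=
    Finset.measurable_fun_sum _ fun i _ =>
      (hS.measurable_slopeD c n u).comp (hS.measurable_obs i)
  exact h.const_smul (n : ℝ)⁻¹

/-- The condition is closed in `v`, so the uncountable family of inequalities reduces to a countable
dense set of directions. -/
lemma measurableSet_wellCond (c : Criterion) {n : ℕ} (hn : 1 ≤ n) (τ : ℝ) :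
    MeasurableSet (S.wellCond c n τ) := by
  obtain ⟨D, hDc, hDd⟩ := TopologicalSpace.exists_countable_dense (Vec2 d)
  have e : S.wellCond c n τ =
      ⋂ v ∈ D, {ω | τ * ‖S.scaleT n v‖ ≤ ‖S.infoN c n ω (S.scaleT n v)‖} := by
    ext ω
    simp only [Design.wellCond, hS.scaleInv_Gamma1N c hn, Set.mem_ofPred_eq, Set.mem_iInter]
    refine ⟨fun h v _ => h v, fun h v => ?_⟩
    have hcl : IsClosed {v : Vec2 d | τ * ‖S.scaleTL n v‖ ≤ ‖S.infoN c n ω (S.scaleTL n v)‖} :=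
      isClosed_le (by fun_prop) (by fun_prop)
    have h2 : closure D ⊆ {v : Vec2 d | τ * ‖S.scaleTL n v‖ ≤ ‖S.infoN c n ω (S.scaleTL n v)‖} :=
      hcl.closure_subset_iff.2 fun w hw => by
        simpa only [Set.mem_ofPred_eq, S.scaleTL_apply] using h w hw
    rw [hDd.closure_eq] at h2
    simpa only [Set.mem_ofPred_eq, S.scaleTL_apply] using h2 (Set.mem_univ v)
  rw [e]
  exact MeasurableSet.biInter hDc fun v _ =>
    measurableSet_le measurable_const (hS.measurable_infoN c n _).norm

/-- If the sample matrix differs from its mean by at most half the lower bound of the information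
matrix, it keeps the other half. The difference is measured by its values on a basis, and
Chebyshev's inequality bounds the probability of the exception by a multiple of `1/n`. -/
lemma tendsto_wellCond (c : Criterion) :
    ∃ τ : ℝ, 0 < τ ∧ Tendsto (fun n => P (S.wellCond c n τ)) atTop (𝓝 1) := by
  obtain ⟨l, hl0, hl⟩ := hS.exists_le_norm_info c
  obtain ⟨B, hB0, hB⟩ := hS.integral_norm_sq_infoN_add_le c
  let b := stdOrthonormalBasis ℝ (Vec2 d)
  set m : ℝ := ((Finset.univ : Finset (Fin (Module.finrank ℝ (Vec2 d)))).card : ℝ) with hm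
  refine ⟨l / 2, by positivity, ?_⟩
  set G : ℕ → Ω → ℝ := fun n ω => ∑ k, ‖S.infoN c n ω (b k) + S.info P c n (b k)‖ with hG
  have hGm : ∀ n, Measurable (G n) := fun n =>
    Finset.measurable_fun_sum _ fun k _ =>
      ((hS.measurable_infoN c n (b k)).add measurable_const).norm
  have hsub : ∀ n, 1 ≤ n → {ω | G n ω ≤ l / 2} ⊆ S.wellCond c n (l / 2) := by
    intro n hn ω hω v
    rw [hS.scaleInv_Gamma1N c hn]
    set u := S.scaleT n v
    have h1 : ‖S.infoN c n ω u + S.info P c n u‖ ≤ l / 2 * ‖u‖ := by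
      have e : S.infoN c n ω u + S.info P c n u =
          ∑ k, inner ℝ (b k) u • (S.infoN c n ω (b k) + S.info P c n (b k)) := by
        conv_lhs => rw [← b.sum_repr' u, map_sum, map_sum, ← Finset.sum_add_distrib]
        exact Finset.sum_congr rfl fun k _ => by rw [map_smul, map_smul, smul_add]
      rw [e]
      refine (norm_sum_le _ _).trans ?_
      refine le_trans (Finset.sum_le_sum fun k _ => ?_)
        (le_of_eq (Finset.mul_sum Finset.univ
          (fun k => ‖S.infoN c n ω (b k) + S.info P c n (b k)‖) ‖u‖).symm) |>.trans ?_
      · rw [norm_smul]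
        refine mul_le_mul_of_nonneg_right ?_ (norm_nonneg _)
        refine (norm_inner_le_norm _ _).trans ?_
        rw [b.norm_eq_one, one_mul]
      · rw [mul_comm]
        exact mul_le_mul_of_nonneg_right hω (norm_nonneg _)
    have h2 := hl n u
    have h3 : ‖S.info P c n u‖ ≤ ‖S.infoN c n ω u + S.info P c n u‖ + ‖S.infoN c n ω u‖ := by
      have := norm_sub_le (S.infoN c n ω u + S.info P c n u) (S.infoN c n ω u)
      rwa [add_sub_cancel_left] at this
    linarith
  have hGL : ∀ n, 1 ≤ n → SqLe P Set.univ (G n) (m * (m * (B * (n : ℝ)⁻¹))) := by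
    intro n hn
    refine (SqLe.sum Finset.univ (b := fun _ => B * (n : ℝ)⁻¹)
      (X := fun k ω => ‖S.infoN c n ω (b k) + S.info P c n (b k)‖) fun k _ => ?_).mono (le_of_eq ?_)
    · have h := hB n (b k) hn (b.norm_eq_one k)
      exact ⟨h.memLp.norm, by simpa only [norm_norm] using h.le⟩
    · rw [Finset.sum_const, nsmul_eq_mul]
  have hcompl : ∀ n, 1 ≤ n → P {ω | l / 2 < G n ω} ≤
      ENNReal.ofReal (m * (m * (B * (n : ℝ)⁻¹)) / (l / 2) ^ 2) := by
    intro n hn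
    have hi := integrable_norm_sq_of_memLp (hGL n hn).memLp
    have h1 := mul_meas_ge_le_integral_of_nonneg (Eventually.of_forall fun ω => sq_nonneg ‖G n ω‖) hi
      ((l / 2) ^ 2)
    have h2 := (hGL n hn).le
    rw [setIntegral_univ] at h2
    have h3 : P.real {ω | l / 2 < G n ω} ≤ P.real {ω | (l / 2) ^ 2 ≤ ‖G n ω‖ ^ 2} := by
      refine measureReal_mono fun ω hω => ?_
      have hω' : l / 2 < G n ω := hω
      exact pow_le_pow_left₀ (by positivity) (hω'.le.trans (le_abs_self _)) 2
    rw [← ofReal_measureReal]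
    refine ENNReal.ofReal_le_ofReal ?_
    rw [le_div_iff₀ (by positivity), mul_comm]
    exact (mul_le_mul_of_nonneg_left h3 (by positivity)).trans (h1.trans h2)
  have hlim : Tendsto (fun n : ℕ => ENNReal.ofReal (m * (m * (B * (n : ℝ)⁻¹)) / (l / 2) ^ 2)) atTop
      (𝓝 0) := by
    rw [← ENNReal.ofReal_zero]
    refine (ENNReal.continuous_ofReal.tendsto 0).comp ?_
    have := (((tendsto_inv_atTop_nhds_zero_nat (𝕜 := ℝ)).const_mul B).const_mul m |>.const_mul
      m).div_const ((l / 2) ^ 2)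
    simpa using this
  have hlow : Tendsto (fun n : ℕ => 1 - ENNReal.ofReal (m * (m * (B * (n : ℝ)⁻¹)) / (l / 2) ^ 2))
      atTop (𝓝 1) := by
    have := ENNReal.Tendsto.sub (tendsto_const_nhds (x := (1 : ENNReal))) hlim
      (Or.inl ENNReal.one_ne_top)
    simpa using this
  refine tendsto_of_tendsto_of_tendsto_of_le_of_le' hlow tendsto_const_nhds ?_
    (Eventually.of_forall fun n => prob_le_one)
  filter_upwards [eventually_ge_atTop 1] with n hn
  refine le_trans ?_ (measure_mono (hsub n hn))
  have hc : {ω | G n ω ≤ l / 2} = {ω | l / 2 < G n ω}ᶜ := by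
    ext ω
    simp
  rw [hc, prob_compl_eq_one_sub (measurableSet_lt measurable_const (hGm n))]
  exact tsub_le_tsub_left (hcompl n hn) 1

lemma existsUnique_solvesSample (c : Criterion) (q : ℝ → ℝ → ℝ) (a : ℝ) {n : ℕ} (hn : 1 ≤ n) {τ : ℝ}
    (hτ : 0 < τ) {ω : Ω} (hω : ω ∈ S.wellCond c n τ) : ∃! t, S.SolvesSample c q a n ω t := by
  have hinj : Function.Injective (S.Gamma1N c n ω : Vec2 d →ₗ[ℝ] Vec2 d) := by
    rw [injective_iff_map_eq_zero]
    intro v hv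
    have h3 := hω v
    have h1 : S.Gamma1N c n ω v = 0 := hv
    rw [h1, ← S.scaleInvL_apply, map_zero, norm_zero] at h3
    exact hS.scaleT_injective hn (norm_le_zero_iff.1 (nonpos_of_mul_nonpos_right h3 hτ))
  have hsurj := LinearMap.injective_iff_surjective.1 hinj
  obtain ⟨v, hv⟩ := hsurj (-(S.scoreN c n ω + S.Gamma2N c n ω (S.PiHat q a n ω - S.PiN n)))
  have hv' : S.Gamma1N c n ω v =
    -(S.scoreN c n ω + S.Gamma2N c n ω (S.PiHat q a n ω - S.PiN n)) := hv
  refine ⟨v + S.theta0, ?_, fun t ht => ?_⟩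
  · simp only [Design.SolvesSample, add_sub_cancel_right, hv']
    abel
  · have ht' : S.scoreN c n ω + S.Gamma1N c n ω (t - S.theta0)
      + S.Gamma2N c n ω (S.PiHat q a n ω - S.PiN n) = 0 := ht
    have h1 : S.Gamma1N c n ω (t - S.theta0) = S.Gamma1N c n ω v := by
      rw [hv', ← sub_eq_zero, ← ht']
      abel
    rw [← hinj h1, sub_add_cancel]

end ModelConditions

/-! ### The regularization parameter that minimizes the rate -/

/-- In the variable `s = √α` the rate is `c₁ n⁻¹ s⁻¹ + c₂ s⁴`, whose critical point satisfies `s⁵ =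
c₁/(4 c₂ n)`. The comparison is then a polynomial identity and avoids calculus. -/
lemma mseRate_lt_mseRate {c₁ c₂ a b : ℝ} {n : ℕ} (hc₁ : 0 < c₁) (hc₂ : 0 < c₂) (hn : 1 ≤ n)
    (ha : a = (c₁ / (4 * c₂ * n)) ^ (2 / 5 : ℝ)) (hb : 0 < b) (hne : b ≠ a) :
    mseRate c₁ c₂ n a < mseRate c₁ c₂ n b := by
  have hn0 : (0 : ℝ) < n := by exact_mod_cast hn
  have hk : 0 < c₁ / (4 * c₂ * n) := by positivity
  have ha0 : 0 < a := by rw [ha]; exact Real.rpow_pos_of_pos hk _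
  have key : ∀ x, 0 < x → mseRate c₁ c₂ n x = c₁ * (n : ℝ)⁻¹ * (Real.sqrt x)⁻¹
      + c₂ * Real.sqrt x ^ 4 := fun x hx => by
    have h : Real.sqrt x ^ 4 = x ^ 2 := by
      rw [show (4 : ℕ) = 2 * 2 from rfl, pow_mul, Real.sq_sqrt hx.le]
    rw [mseRate, Real.rpow_neg hx.le, ← Real.sqrt_eq_rpow, h, mul_assoc]
  set s := Real.sqrt a with hs
  set t := Real.sqrt b with ht
  have hs0 : 0 < s := Real.sqrt_pos.2 ha0
  have ht0 : 0 < t := Real.sqrt_pos.2 hb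
  have hst : t ≠ s := fun h => hne ((Real.sqrt_inj hb.le ha0.le).1 h)
  have h5 : s ^ 5 = c₁ / (4 * c₂ * n) := by
    rw [hs, Real.sqrt_eq_rpow, ha, ← Real.rpow_mul hk.le, ← Real.rpow_natCast, ← Real.rpow_mul hk.le]
    norm_num
  have hc : c₁ * (n : ℝ)⁻¹ = 4 * c₂ * s ^ 5 := by
    rw [h5]
    field_simp
  rw [key a ha0, key b hb, hc, ← hs, ← ht, ← sub_pos]
  -- After multiplication by `t` the difference is `c₂ (t⁵ - 5 s⁴ t + 4 s⁵)`. It has a double root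
  -- at the critical point, and the cofactor has positive coefficients.
  have e : 4 * c₂ * s ^ 5 * t⁻¹ + c₂ * t ^ 4 - (4 * c₂ * s ^ 5 * s⁻¹ + c₂ * s ^ 4) =
      c₂ * t⁻¹ * ((t - s) ^ 2 * (t ^ 3 + 2 * s * t ^ 2 + 3 * s ^ 2 * t + 4 * s ^ 3)) := by
    field_simp
    ring
  rw [e]
  have : 0 < (t - s) ^ 2 := by
    have := sub_ne_zero.2 hst
    positivity
  positivity

lemma exists_minimizer_mseRate {c₁ c₂ : ℝ} (hc₁ : 0 < c₁) (hc₂ : 0 < c₂) : ∃ a : ℕ → ℝ,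
    (∀ n, 1 ≤ n → 0 < a n ∧
      ∀ b : ℝ, 0 < b → b ≠ a n → mseRate c₁ c₂ n (a n) < mseRate c₁ c₂ n b) ∧
    a =Θ[atTop] fun n => (n : ℝ) ^ (-(2 / 5) : ℝ) := by
  refine ⟨fun n => (c₁ / (4 * c₂ * n)) ^ (2 / 5 : ℝ), fun n hn => ⟨?_, fun b hb hne =>
    mseRate_lt_mseRate hc₁ hc₂ hn rfl hb hne⟩, ?_⟩
  · have hn0 : (0 : ℝ) < n := by exact_mod_cast hn
    exact Real.rpow_pos_of_pos (by positivity) _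
  · have e : (fun n : ℕ => (c₁ / (4 * c₂ * n)) ^ (2 / 5 : ℝ)) =
        fun n : ℕ => (c₁ / (4 * c₂)) ^ (2 / 5 : ℝ) * (n : ℝ) ^ (-(2 / 5) : ℝ) := by
      funext n
      rw [← div_div, div_eq_mul_inv, Real.mul_rpow (by positivity) (by positivity),
        Real.inv_rpow (by positivity), Real.rpow_neg (by positivity)]
    rw [e]
    have hk : (c₁ / (4 * c₂)) ^ (2 / 5 : ℝ) ≠ 0 := (Real.rpow_pos_of_pos (by positivity) _).ne'
    exact (Asymptotics.isTheta_const_mul_left hk).2 Asymptotics.isTheta_rfl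

/-! ### From mean square bounds to the conditional rates. -/

namespace ModelConditions

variable {Ω : Type*} [mΩ : MeasurableSpace Ω] {P : Measure Ω} [IsProbabilityMeasure P]
  {H : Type*} [NormedAddCommGroup H] [InnerProductSpace ℝ H] [CompleteSpace H]
  [SecondCountableTopology H] [MeasurableSpace H] [BorelSpace H] {dx d : ℕ}
  {S : Design Ω H dx d} {Θ : Set (Vec2 d)} {ρ : ℝ} (hS : ModelConditions P S Θ ρ)
include hS

lemma exists_measure_trN_gt_le {ε : ℝ} (hε : 0 < ε) :
    ∃ M : ℝ, ∀ n, P {ω | S.trN n ω ≤ M}ᶜ ≤ ENNReal.ofReal ε := by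
  set m2 := ∫ ω, ‖S.Zi 0 ω‖ ^ 2 ∂P with hm2
  have hm20 : 0 ≤ m2 := integral_nonneg fun ω => sq_nonneg _
  have hi : ∀ i, ∫ ω, ‖S.Zi i ω‖ ^ 2 ∂P = m2 := fun i => by
    have h : Measurable fun p : (Fin dx → ℝ) × Vec d × ℝ => ‖S.Z p.1‖ ^ 2 :=
      (hS.meas_Z.comp measurable_fst).norm.pow_const 2
    exact (hS.identDistrib_obs h i).integral_eq
  have htr : ∀ n, Integrable (S.trN n) P := fun n =>
    (integrable_finsetSum _ fun i _ => hS.integrable_norm_Z_sq i).const_mul _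
  have hE : ∀ n, ∫ ω, S.trN n ω ∂P ≤ m2 := by
    intro n
    simp only [Design.trN]
    rw [integral_const_mul, integral_finsetSum _ fun i _ => hS.integrable_norm_Z_sq i]
    simp only [hi, Finset.sum_const, Finset.card_range, nsmul_eq_mul]
    rcases Nat.eq_zero_or_pos n with rfl | hn
    · simpa using hm20
    · have hn0 : (n : ℝ) ≠ 0 := by positivity
      rw [← mul_assoc, inv_mul_cancel₀ hn0, one_mul]
  -- Markov's inequality; the added one keeps the threshold positive even if the second moment
  -- vanishes.
  refine ⟨(m2 + 1) / ε, fun n => ?_⟩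
  have h1 := mul_meas_ge_le_integral_of_nonneg (Eventually.of_forall fun ω => S.trN_nonneg n ω)
    (htr n) ((m2 + 1) / ε)
  rw [← ofReal_measureReal]
  refine ENNReal.ofReal_le_ofReal ?_
  have h2 : P.real {ω | S.trN n ω ≤ (m2 + 1) / ε}ᶜ ≤ P.real {ω | (m2 + 1) / ε ≤ S.trN n ω} := by
    refine measureReal_mono fun ω hω => ?_
    exact (not_le.1 (show ¬ S.trN n ω ≤ (m2 + 1) / ε from hω)).le
  have h3 : 0 < (m2 + 1) / ε := by positivity
  have h4 := (mul_le_mul_of_nonneg_left h2 h3.le).trans (h1.trans (hE n))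
  rw [div_mul_eq_mul_div, div_le_iff₀ hε] at h4
  by_contra hlt
  push Not at hlt
  nlinarith

/-- A nonnegative statistic dominated by a mean square bound has a conditional mean of that
order. -/
lemma isBigOp_of_sqLe {α : ℕ → ℝ} (hα_pos : ∀ n, 0 < α n) {T : ℕ → Ω → Vec2 d} {Y : ℕ → Ω → ℝ}
    (hT : ∀ M, ∃ B : ℝ, ∀ᶠ n in atTop,
      SqLe P {ω | S.trN n ω ≤ M} (T n) (B * mseRate 1 1 n (α n)))
    (hY0 : ∀ n ω, 0 ≤ Y n ω) (hYm : ∀ᶠ n in atTop, AEStronglyMeasurable (Y n) P) {k : ℝ}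
    (hk : 0 ≤ k) (hle : ∀ᶠ n in atTop, ∀ᵐ ω ∂P, Y n ω ≤ k * ‖T n ω‖ ^ 2) :
    (∀ᶠ n in atTop, Integrable (Y n) P) ∧
      IsBigOp P (fun n => P[Y n | S.sigmaX]) fun n => mseRate 1 1 n (α n) := by
  have hbd : ∀ᶠ n in atTop, Integrable (Y n) P := by
    -- Any truncation level would do, since square integrability in `SqLe` refers to the whole
    -- space.
    obtain ⟨B, hB⟩ := hT 0
    filter_upwards [hB, hYm, hle] with n hB hYm hle
    refine ((integrable_norm_sq_of_memLp hB.memLp).const_mul k).mono' hYm ?_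
    filter_upwards [hle] with ω h
    rwa [Real.norm_of_nonneg (hY0 n ω)]
  refine ⟨hbd, isBigOp_condExp hS.sigmaX_le ?_ (fun n => Eventually.of_forall (hY0 n)) hbd ?_⟩
  · filter_upwards [eventually_ge_atTop 1] with n hn
    have hn0 : (0 : ℝ) < n := by exact_mod_cast hn
    rw [mseRate_one_one n (hα_pos n)]
    have := Real.sqrt_pos.2 (hα_pos n)
    have := hα_pos n
    positivity
  · intro ε hε
    obtain ⟨M, hM⟩ := hS.exists_measure_trN_gt_le hε
    obtain ⟨B, hB⟩ := hT M
    refine ⟨k * B, fun n => {ω | S.trN n ω ≤ M}, fun n => hS.measurableSet_trN_le n M, ?_⟩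
    filter_upwards [hB, hbd, hle] with n hB hbd hle
    refine ⟨hM n, ?_⟩
    rw [mul_assoc]
    refine le_trans ?_ (mul_le_mul_of_nonneg_left hB.le hk)
    rw [← integral_const_mul]
    exact integral_mono_ae hbd.integrableOn
      ((integrable_norm_sq_of_memLp hB.memLp).integrableOn.const_mul k) (ae_restrict_of_ae hle)

/-- `exists_sqLe_score` without the restriction `d ≠ 0`. -/
lemma exists_sqLe_score' (c : Criterion) {q : ℝ → ℝ → ℝ} (hq : IsRegularization q ρ)
    {α : ℕ → ℝ} (hα_pos : ∀ n, 0 < α n) (hα : Tendsto α atTop (𝓝 0))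
    (hμα : ∀ j, Tendsto (fun n => S.mu j n ^ 2 * α n) atTop atTop) (M : ℝ) :
    ∃ B : ℝ, ∀ᶠ n in atTop,
      SqLe P {ω | S.trN n ω ≤ M} (fun ω => S.scaleInv n (S.scoreN c n ω
        + S.Gamma2N c n ω (S.PiHat q (α n) n ω - S.PiN n))) (B * mseRate 1 1 n (α n)) ∧
      SqLe P {ω | S.trN n ω ≤ M} (fun ω => S.scaleInv n (S.scoreN c n ω
        + S.Gamma2 P c n (S.PiHat q (α n) n ω - S.PiN n))) (B * mseRate 1 1 n (α n)) := by
  rcases Nat.eq_zero_or_pos d with rfl | hd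
  · have h0 : ∀ (n : ℕ) (X : Ω → Vec2 0), SqLe P {ω | S.trN n ω ≤ M} X (0 * mseRate 1 1 n (α n)) := by
      intro n X
      have : X = fun _ => 0 := by
        funext ω
        have h1 : (X ω).fst = 0 := Subsingleton.elim _ _
        have h2 : (X ω).snd = 0 := Subsingleton.elim _ _
        change pair (X ω).fst (X ω).snd = 0
        rw [h1, h2]
        rfl
      rw [this]
      exact (SqLe.const 0).mono (by simp)
    exact ⟨0, Eventually.of_forall fun n => ⟨h0 n _, h0 n _⟩⟩
  · have : NeZero d := ⟨hd.ne'⟩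
    obtain ⟨B, -, hB⟩ := hS.exists_sqLe_score c hq hα_pos hα hμα M
    exact ⟨B, hB⟩

lemma aestronglyMeasurable_sqErr (n : ℕ) {θ : Ω → Vec2 d} (hθ : AEStronglyMeasurable θ P) :
    AEStronglyMeasurable (fun ω => S.sqErr n (θ ω)) P := by
  have hc : Continuous fun t : Vec2 d => ‖S.scaleTL n (t - S.theta0)‖ ^ 2 := by fun_prop
  simpa only [Design.sqErr, S.scaleTL_apply] using hc.comp_aestronglyMeasurable hθ

/-- The equation equates the scaled score with the information matrix applied to `S_n'(θ̄ - θ₀)`.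
The uniform lower bound on that matrix transfers the mean square bound of the score to the
estimator. -/
lemma isBigOp_population (c : Criterion) {q : ℝ → ℝ → ℝ} (hq : IsRegularization q ρ)
    {α : ℕ → ℝ} (hα_pos : ∀ n, 0 < α n) (hα : Tendsto α atTop (𝓝 0))
    (hμα : ∀ j, Tendsto (fun n => S.mu j n ^ 2 * α n) atTop atTop) {θbar : ℕ → Ω → Vec2 d}
    (hθ : ∀ n, AEStronglyMeasurable (θbar n) P)
    (hsol : ∀ n, 1 ≤ n → ∀ᵐ ω ∂P, S.SolvesPopulation P c q (α n) n ω (θbar n ω)) :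
    (∀ᶠ n in atTop, Integrable (fun ω => S.sqErr n (θbar n ω)) P) ∧
      IsBigOp P (fun n => P[fun ω => S.sqErr n (θbar n ω) | S.sigmaX])
        fun n => mseRate 1 1 n (α n) := by
  obtain ⟨l, hl0, hl⟩ := hS.exists_le_norm_info c
  refine hS.isBigOp_of_sqLe hα_pos (k := (l ^ 2)⁻¹) (T := fun n ω => S.scaleInv n (S.scoreN c n ω
    + S.Gamma2 P c n (S.PiHat q (α n) n ω - S.PiN n))) (fun M => ?_) (fun n ω => sq_nonneg _)
    (Eventually.of_forall fun n => hS.aestronglyMeasurable_sqErr n (hθ n)) (by positivity) ?_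
  · obtain ⟨B, hB⟩ := hS.exists_sqLe_score' c hq hα_pos hα hμα M
    exact ⟨B, hB.mono fun n h => h.2⟩
  · filter_upwards [eventually_ge_atTop 1] with n hn
    filter_upwards [hsol n hn] with ω hω
    set δ := θbar n ω - S.theta0 with hδ
    have h1 : S.scoreN c n ω + S.Gamma2 P c n (S.PiHat q (α n) n ω - S.PiN n)
        = -S.Gamma1 P c n δ := by
      have hω' : S.scoreN c n ω + S.Gamma1 P c n δ
        + S.Gamma2 P c n (S.PiHat q (α n) n ω - S.PiN n) = 0 := hω
      rw [← sub_eq_zero, ← hω']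
      abel
    rw [h1, ← S.scaleInvL_apply, map_neg, norm_neg, S.scaleInvL_apply, hS.scaleInv_Gamma1 c hn,
      norm_neg, inv_mul_eq_div, le_div_iff₀ (by positivity), mul_comm]
    change l ^ 2 * ‖S.scaleT n δ‖ ^ 2 ≤ _
    rw [← mul_pow]
    exact pow_le_pow_left₀ (by positivity) (hl n _) 2

/-- The same transfer, with the lower bound supplied by the event itself; off the event the
truncated error is zero. The event is not `σ(x)`-measurable in general, hence the indicator inside
the conditional mean. -/
lemma isBigOp_sample (c : Criterion) {q : ℝ → ℝ → ℝ} (hq : IsRegularization q ρ)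
    {α : ℕ → ℝ} (hα_pos : ∀ n, 0 < α n) (hα : Tendsto α atTop (𝓝 0))
    (hμα : ∀ j, Tendsto (fun n => S.mu j n ^ 2 * α n) atTop atTop) {τ : ℝ} (hτ : 0 < τ)
    {θbar : ℕ → Ω → Vec2 d} (hθ : ∀ n, AEStronglyMeasurable (θbar n) P)
    (hsol : ∀ n, 1 ≤ n → ∀ᵐ ω ∂P, ω ∈ S.wellCond c n τ →
      S.SolvesSample c q (α n) n ω (θbar n ω)) :
    (∀ᶠ n in atTop, Integrable
        ((S.wellCond c n τ).indicator fun ω => S.sqErr n (θbar n ω)) P) ∧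
      IsBigOp P
        (fun n => P[(S.wellCond c n τ).indicator fun ω => S.sqErr n (θbar n ω) | S.sigmaX])
        fun n => mseRate 1 1 n (α n) := by
  refine hS.isBigOp_of_sqLe hα_pos (k := (τ ^ 2)⁻¹) (T := fun n ω => S.scaleInv n (S.scoreN c n ω
    + S.Gamma2N c n ω (S.PiHat q (α n) n ω - S.PiN n))) (fun M => ?_)
    (fun n ω => Set.indicator_nonneg (fun _ _ => sq_nonneg _) ω) ?_ (by positivity) ?_
  · obtain ⟨B, hB⟩ := hS.exists_sqLe_score' c hq hα_pos hα hμα M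
    exact ⟨B, hB.mono fun n h => h.1⟩
  · filter_upwards [eventually_ge_atTop 1] with n hn
    exact (hS.aestronglyMeasurable_sqErr n (hθ n)).indicator (hS.measurableSet_wellCond c hn τ)
  · filter_upwards [eventually_ge_atTop 1] with n hn
    filter_upwards [hsol n hn] with ω hω
    by_cases hA : ω ∈ S.wellCond c n τ
    · rw [Set.indicator_of_mem hA]
      set δ := θbar n ω - S.theta0 with hδ
      have h1 : S.scoreN c n ω + S.Gamma2N c n ω (S.PiHat q (α n) n ω - S.PiN n)
          = -S.Gamma1N c n ω δ := by
        have hω' : S.scoreN c n ω + S.Gamma1N c n ω δ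
          + S.Gamma2N c n ω (S.PiHat q (α n) n ω - S.PiN n) = 0 := hω hA
        rw [← sub_eq_zero, ← hω']
        abel
      rw [h1, ← S.scaleInvL_apply, map_neg, norm_neg, S.scaleInvL_apply, inv_mul_eq_div,
        le_div_iff₀ (by positivity), mul_comm]
      change τ ^ 2 * ‖S.scaleT n δ‖ ^ 2 ≤ _
      rw [← mul_pow]
      exact pow_le_pow_left₀ (by positivity) (hA δ) 2
    · rw [Set.indicator_of_notMem hA]
      positivity

end ModelConditions

end BinaryIV

theorem proposition1 {Ω : Type*} [MeasurableSpace Ω] (P : Measure Ω) [IsProbabilityMeasure P]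
    {H : Type*} [NormedAddCommGroup H] [InnerProductSpace ℝ H] [CompleteSpace H]
    [SecondCountableTopology H] [MeasurableSpace H] [BorelSpace H] {dx d : ℕ}
    (S : Design Ω H dx d) (Θ : Set (Vec2 d)) (ρ : ℝ) (q : ℝ → ℝ → ℝ) (α : ℕ → ℝ) (c : Criterion)
    (hS : ModelConditions P S Θ ρ) (hq : IsRegularization q ρ) (hw : WeightConditions P S c)
    (hα_pos : ∀ n, 0 < α n) (hα : Tendsto α atTop (𝓝 0))
    (hμα : ∀ j, Tendsto (fun n => S.mu j n ^ 2 * α n) atTop atTop) :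
    -- the linearization with population derivatives
    ((∀ n, 1 ≤ n → Function.Bijective (S.Gamma1 P c n)) ∧
      ∀ θbar : ℕ → Ω → Vec2 d, (∀ n, AEStronglyMeasurable (θbar n) P) →
        (∀ n, 1 ≤ n → ∀ᵐ ω ∂P, S.SolvesPopulation P c q (α n) n ω (θbar n ω)) →
        (∀ᶠ n in atTop, Integrable (fun ω => S.sqErr n (θbar n ω)) P) ∧
        IsBigOp P (fun n => P[fun ω => S.sqErr n (θbar n ω) | S.sigmaX])
          (fun n => mseRate 1 1 n (α n))) ∧
    -- the linearization with sample derivatives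
    ((∃ τ : ℝ, 0 < τ ∧ Tendsto (fun n => P (S.wellCond c n τ)) atTop (𝓝 1)) ∧
      ∀ τ : ℝ, 0 < τ →
        (∀ n, 1 ≤ n → ∀ ω ∈ S.wellCond c n τ, ∃! t, S.SolvesSample c q (α n) n ω t) ∧
        ∀ θbar : ℕ → Ω → Vec2 d, (∀ n, AEStronglyMeasurable (θbar n) P) →
          (∀ n, 1 ≤ n → ∀ᵐ ω ∂P, ω ∈ S.wellCond c n τ →
            S.SolvesSample c q (α n) n ω (θbar n ω)) →
          (∀ᶠ n in atTop, Integrable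
            ((S.wellCond c n τ).indicator fun ω => S.sqErr n (θbar n ω)) P) ∧
          IsBigOp P
            (fun n => P[(S.wellCond c n τ).indicator fun ω => S.sqErr n (θbar n ω) | S.sigmaX])
            (fun n => mseRate 1 1 n (α n))) ∧
    -- the regularization parameter that minimizes the rate
    (∀ c₁ c₂ : ℝ, 0 < c₁ → 0 < c₂ → ∃ a : ℕ → ℝ,
      (∀ n, 1 ≤ n → 0 < a n ∧ ∀ b : ℝ, 0 < b → b ≠ a n → mseRate c₁ c₂ n (a n) < mseRate c₁ c₂ n b) ∧
      a =Θ[atTop] fun n => (n : ℝ) ^ (-(2 / 5) : ℝ)) := by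
  refine ⟨⟨fun n hn => hS.bijective_Gamma1 c hn, fun θbar hθ hsol =>
      hS.isBigOp_population c hq hα_pos hα hμα hθ hsol⟩,
    ⟨hS.tendsto_wellCond c, fun τ hτ => ⟨fun n hn ω hω =>
      hS.existsUnique_solvesSample c q (α n) hn hτ hω, fun θbar hθ hsol =>
        hS.isBigOp_sample c hq hα_pos hα hμα hτ hθ hsol⟩⟩,
    fun c₁ c₂ hc₁ hc₂ => exists_minimizer_mseRate hc₁ hc₂⟩
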